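/- Let $\bar P\subset\mathbb R^3$ be a convex polyhedron (the convex hull of finitely many points, with non-empty interior), let $P$ denote $\bar P$ with its vertices removed, and let a tangent unit-vector field on $P$ be a map $P\to S^2\subset\mathbb R^3$ whose value at each point of $P$ lying on a (two-dimensional, closed) face of $\bar P$ is orthogonal to the normal of that face. For a vector field $\mathbf u$ with a weak gradient on the interior of $\bar P$ put $\|\mathbf u\|_{1,2}(P)=\left(\int_P|\nabla\mathbf u|^2\,dV\right)^{1/2}$, where $|\nabla \mathbf u|^2=\sum_{a,b}(\partial_a u_b)^2$. Suppose that $\tilde{\mathbf n}$ is a continuous tangent unit-vector field on $P$ that has a weak gradient and satisfies $\|\tilde{\mathbf n}\|_{1,2}(P)<\infty$. Then for every $\epsilon>0$ there is a tangent unit-vector field $\mathbf n$ on $P$ that is $C^\infty$ on $P$ (up to the relative interiors of the faces and edges), is homotopic to $\tilde{\mathbf n}$, and satisfies $\|\tilde{\mathbf n}-\mathbf n\|_{1,2}(P)\le\epsilon$. Here $\mathbf n\sim\tilde{\mathbf n}$ are homotopic if there is a continuous map $\mathbf H:P\times[0,1]\to S^2$ such that each $\mathbf H_t$ is a continuous tangent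 unit-vector field on $P$, $\mathbf H_0=\mathbf n$ and $\mathbf H_1=\tilde{\mathbf n}$. -/

import Mathlib

open scoped ContDiff ENNReal InnerProductSpace

noncomputable section

namespace PolyField

/-- Euclidean three-space. -/
abbrev E3 : Type := EuclideanSpace ℝ (Fin 3)

/-- A (closed, bounded, solid) convex polyhedron: the convex hull of finitely many points,
with nonempty interior. -/
def IsConvexPolyhedron (Pbar : Set E3) : Prop :=
  (∃ s : Set E3, s.Finite ∧ Pbar = convexHull ℝ s) ∧ (interior Pbar).Nonempty

/-- The vertices of a convex polyhedron are its extreme points. -/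
def vertices (Pbar : Set E3) : Set E3 := Pbar.extremePoints ℝ

/-- The polyhedron without its vertices. -/
def punctured (Pbar : Set E3) : Set E3 := Pbar \ vertices Pbar

/-- `F` is a (two-dimensional, closed) face of the polyhedron with outward unit normal `ν`. -/
def IsFace (Pbar F : Set E3) (ν : E3) : Prop :=
  ‖ν‖ = 1 ∧
  (∃ c : ℝ, (∀ x ∈ Pbar, ⟪ν, x⟫_ℝ ≤ c) ∧ F = {x | x ∈ Pbar ∧ ⟪ν, x⟫_ℝ = c}) ∧
  Module.finrank ℝ (vectorSpan ℝ F) = 2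

/-- `n` restricted to the polyhedron without its vertices is a unit-vector field that is tangent
to every face at every point of that face which is not a vertex. Values of `n` at the vertices
and outside the polyhedron play no role. -/
def IsTangentUnitField (Pbar : Set E3) (n : E3 → E3) : Prop :=
  (∀ x ∈ punctured Pbar, ‖n x‖ = 1) ∧
  (∀ (F : Set E3) (ν : E3), IsFace Pbar F ν → ∀ x ∈ F, x ∉ vertices Pbar → ⟪ν, n x⟫_ℝ = 0)

/-- Continuous tangent unit-vector fields on the polyhedron without its vertices. -/
def CTangent (Pbar : Set E3) (n : E3 → E3) : Prop :=
  ContinuousOn n (punctured Pbar) ∧ IsTangentUnitField Pbar n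

/-- Smooth tangent unit-vector fields on the polyhedron without its vertices; smoothness is up to
the boundary (relative interiors of faces and of edges included). -/
def SmoothTangent (Pbar : Set E3) (n : E3 → E3) : Prop :=
  ContDiffOn ℝ ∞ n (punctured Pbar) ∧ IsTangentUnitField Pbar n

/-- Homotopy through continuous tangent unit-vector fields. -/
def TangentHomotopic (Pbar : Set E3) (n n' : E3 → E3) : Prop :=
  ∃ H : E3 × ℝ → E3,
    ContinuousOn H (punctured Pbar ×ˢ Set.Icc (0 : ℝ) 1) ∧
    (∀ t ∈ Set.Icc (0 : ℝ) 1, CTangent Pbar (fun x => H (x, t))) ∧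
    (∀ x ∈ punctured Pbar, H (x, 0) = n x) ∧
    (∀ x ∈ punctured Pbar, H (x, 1) = n' x)

/-- `G` is a weak (distributional) gradient of the vector field `u` on the open set `Ω`. -/
def IsWeakGradient (Ω : Set E3) (u : E3 → E3) (G : E3 → (E3 →L[ℝ] E3)) : Prop :=
  MeasureTheory.LocallyIntegrableOn u Ω MeasureTheory.volume ∧
  MeasureTheory.LocallyIntegrableOn G Ω MeasureTheory.volume ∧
  ∀ φ : E3 → ℝ, ContDiff ℝ ∞ φ → HasCompactSupport φ → tsupport φ ⊆ Ω → ∀ v : E3,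
    ∫ x in Ω, (fderiv ℝ φ x v) • u x = - ∫ x in Ω, φ x • G x v

/-- The integral over `Ω` of the sum of the squares of the entries of the matrix field `G`. -/
def gradEnergy (Ω : Set E3) (G : E3 → (E3 →L[ℝ] E3)) : ℝ≥0∞ :=
  ∫⁻ x in Ω, ∑ a : Fin 3, ‖G x (EuclideanSpace.single a 1)‖ₑ ^ 2

/-- The Sobolev norm `(∫_Ω |∇u|²)^(1/2)` with `∇u` the weak gradient, and `∞` if `u` has no
weak gradient. The weak gradient is unique almost everywhere, so that the infimum runs
over at most one value. -/
def sobolevNorm (Ω : Set E3) (u : E3 → E3) : ℝ≥0∞ :=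
  ⨅ (G : E3 → (E3 →L[ℝ] E3)) (_ : IsWeakGradient Ω u G), gradEnergy Ω G ^ (1 / 2 : ℝ)

end PolyField

end

/-! Away from its vertices the polyhedron is locally the whole space, a half-space, or a wedge of
two half-spaces bounded by faces (`exists_local_wedge`). The proof approximates in these models,
patches the pieces together with summable errors, and normalizes at the end.

In a model, a cutoff of the field is extended across one bounding plane by reflecting both the point
and the vector. Tangency says that the vector is fixed by the reflection on the plane, so the
extension is continuous, and its weak gradient is the reflected gradient with no singular part on
the plane (`IsWeakGradient.reflect`). The reflections are oblique: at an edge, the direction for the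
first plane is parallel to the second, so the first reflection preserves the second half-space and
tangency to its boundary. Hence the planes can be removed one at a time for every dihedral angle. On
the whole space convolution approximates uniformly and in energy (`exists_smooth_approx`). Averaging
the result with its reflection restores tangency, at a cost depending only on the norm of the
reflection (`exists_smooth_approx_wedge`).

A countable partition of unity glues the local approximations. Infinitely many pieces may accumulate
at a vertex, but the `j`-th one is granted an error `δ / 2 ^ (j + 1)`, so the glued field `v` is
tangent, smooth, uniformly `δ`-close to `m`, and `δ`-close in energy (`exists_global_approx`).

The field `v / ‖v‖` is still tangent. Its derivative is, up to the factor `‖v‖⁻¹`, the part of the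
derivative of `v` orthogonal to `v`, so it is close to `G` only if `G` has almost no component along
`v`. This holds because `‖m‖ = 1` forces `G` to take values orthogonal to `m` almost everywhere
(`ae_inner_weakGradient_eq_zero`); the resulting bound is `norm_fderiv_normalize_sub_le`. Two
uniformly close tangent unit fields are homotopic along the normalized segment between them
(`tangentHomotopic_of_norm_sub_lt_one`). -/

noncomputable section

namespace PolyField

open MeasureTheory Set Filter Topology

/-! ### Test functions and integration by parts -/

section Basic

variable {F : Type*} [NormedAddCommGroup F] [NormedSpace ℝ F]

theorem integrable_smul_of_tsupport_subset {Ω : Set E3} {φ : E3 → ℝ} {f : E3 → F}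
    (hφ : Continuous φ) (hc : HasCompactSupport φ) (hs : tsupport φ ⊆ Ω)
    (hf : LocallyIntegrableOn f Ω volume) : Integrable (fun x => φ x • f x) volume := by
  have h1 : IntegrableOn f (tsupport φ) volume := hf.integrableOn_compact_subset hs hc
  have h2 := h1.continuousOn_smul hφ.continuousOn hc
  refine (integrableOn_iff_integrable_of_support_subset ?_).1 h2
  intro x hx
  refine subset_tsupport φ ?_
  intro h0
  exact hx (by simp [h0])

theorem setIntegral_eq_of_tsupport_subset {Ω : Set E3} {φ : E3 → ℝ} {f : E3 → F}
    (hs : tsupport φ ⊆ Ω) (hf : ∀ x, φ x = 0 → f x = 0) :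
    ∫ x in Ω, f x = ∫ x, f x :=
  setIntegral_eq_integral_of_forall_compl_eq_zero fun x hx =>
    hf x (image_eq_zero_of_notMem_tsupport fun h => hx (hs h))

theorem contDiff_smul_of_tsupport_subset {n : WithTop ℕ∞} {Ω : Set E3} (hΩ : IsOpen Ω) {φ : E3 → ℝ}
    {f : E3 → F} (hφ : ContDiff ℝ n φ) (hs : tsupport φ ⊆ Ω) (hf : ContDiffOn ℝ n f Ω) :
    ContDiff ℝ n (fun x => φ x • f x) := by
  rw [contDiff_iff_contDiffAt]
  intro x
  by_cases hx : x ∈ tsupport φ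
  · exact hφ.contDiffAt.smul (hf.contDiffAt (hΩ.mem_nhds (hs hx)))
  · have h0 := notMem_tsupport_iff_eventuallyEq.1 hx
    refine (contDiffAt_const (c := (0 : F))).congr_of_eventuallyEq ?_
    filter_upwards [h0] with y hy
    simp [hy]

theorem tsupport_fderiv_apply_subset (φ : E3 → ℝ) (v : E3) :
    tsupport (fun x => fderiv ℝ φ x v) ⊆ tsupport φ := by
  refine closure_minimal ?_ (isClosed_tsupport φ)
  intro x hx
  refine tsupport_fderiv_subset ℝ (subset_tsupport _ ?_)
  intro h
  exact hx (by simp [h])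

theorem hasCompactSupport_fderiv_apply {φ : E3 → ℝ} (hc : HasCompactSupport φ) (v : E3) :
    HasCompactSupport (fun x => fderiv ℝ φ x v) :=
  hc.of_isClosed_subset (isClosed_tsupport _) (tsupport_fderiv_apply_subset φ v)

theorem integral_fderiv_apply_eq_zero {g : E3 → F} (hg : ContDiff ℝ 1 g)
    (hc : HasCompactSupport g) (v : E3) : ∫ x, fderiv ℝ g x v = 0 := by
  have hi : Integrable (fun x => fderiv ℝ g x v) volume :=
    ((hg.continuous_fderiv one_ne_zero).clm_apply continuous_const).integrable_of_hasCompactSupport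
      (hc.fderiv_apply ℝ v)
  have := integral_smul_fderiv_eq_neg_fderiv_smul_of_integrable (μ := (volume : Measure E3))
    (f := fun _ : E3 => (1 : ℝ)) (g := g) (v := v) (by simp) (by simpa using hi)
    (by simpa using hg.continuous.integrable_of_hasCompactSupport hc)
    (fun x _ => differentiableAt_const _) (fun x _ => (hg.differentiable one_ne_zero) x)
  simpa using this

/-- The product `φ • f`, which vanishes outside the support of `φ`, is `C¹` with compact support on
the whole space, so the integral of its directional derivative is zero; the boundary of `Ω` never
enters. -/
theorem integral_fderiv_smul_eq_neg {Ω : Set E3} (hΩ : IsOpen Ω) {f : E3 → F}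
    (hf : ContDiffOn ℝ 1 f Ω) {φ : E3 → ℝ} (hφ : ContDiff ℝ ∞ φ) (hc : HasCompactSupport φ)
    (hs : tsupport φ ⊆ Ω) (v : E3) :
    ∫ x in Ω, (fderiv ℝ φ x v) • f x = - ∫ x in Ω, φ x • fderiv ℝ f x v := by
  have hφ1 : ContDiff ℝ 1 φ := hφ.of_le (by exact_mod_cast le_top)
  have hg := contDiff_smul_of_tsupport_subset hΩ hφ1 hs hf
  have hgc : HasCompactSupport (fun x => φ x • f x) := hc.smul_right
  have h0 := integral_fderiv_apply_eq_zero hg hgc v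
  have hcd : ContinuousOn (fun x => fderiv ℝ f x v) Ω :=
    (hf.continuousOn_fderiv_of_isOpen hΩ le_rfl).clm_apply continuousOn_const
  have hd : ∀ x, fderiv ℝ (fun x => φ x • f x) x v = φ x • fderiv ℝ f x v
      + (fderiv ℝ φ x v) • f x := by
    intro x
    by_cases hx : x ∈ tsupport φ
    · rw [fderiv_fun_smul (hφ1.differentiable one_ne_zero x)
        ((hf.contDiffAt (hΩ.mem_nhds (hs hx))).differentiableAt one_ne_zero)]
      simp
    · have e0 := notMem_tsupport_iff_eventuallyEq.1 hx
      have e1 : (fun x => φ x • f x) =ᶠ[𝓝 x] fun _ => 0 := by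
        filter_upwards [e0] with y hy
        simp [hy]
      rw [e1.fderiv_eq, e0.fderiv_eq, e0.self_of_nhds]
      simp
  have i1 : Integrable (fun x => φ x • fderiv ℝ f x v) volume :=
    integrable_smul_of_tsupport_subset hφ.continuous hc hs
      (hcd.locallyIntegrableOn hΩ.measurableSet)
  have i2 : Integrable (fun x => (fderiv ℝ φ x v) • f x) volume :=
    integrable_smul_of_tsupport_subset
      ((hφ1.continuous_fderiv one_ne_zero).clm_apply continuous_const)
      (hasCompactSupport_fderiv_apply hc v) ((tsupport_fderiv_apply_subset φ v).trans hs)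
      (hf.continuousOn.locallyIntegrableOn hΩ.measurableSet)
  simp_rw [hd] at h0
  rw [integral_add i1 i2] at h0
  rw [setIntegral_eq_of_tsupport_subset (φ := fun x => fderiv ℝ φ x v)
    ((tsupport_fderiv_apply_subset φ v).trans hs) (fun x hx => by simp only [hx, zero_smul]),
    setIntegral_eq_of_tsupport_subset (φ := φ) hs (fun x hx => by simp only [hx, zero_smul])]
  rw [add_comm] at h0
  exact eq_neg_of_add_eq_zero_left h0

end Basic

/-! ### Calculus of weak gradients -/

theorem isWeakGradient_fderiv {Ω : Set E3} (hΩ : IsOpen Ω) {f : E3 → E3}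
    (hf : ContDiffOn ℝ 1 f Ω) : IsWeakGradient Ω f (fderiv ℝ f) :=
  ⟨hf.continuousOn.locallyIntegrableOn hΩ.measurableSet,
    (hf.continuousOn_fderiv_of_isOpen hΩ le_rfl).locallyIntegrableOn hΩ.measurableSet,
    fun _ hφ hc hs v => integral_fderiv_smul_eq_neg hΩ hf hφ hc hs v⟩

theorem _root_.MeasureTheory.LocallyIntegrableOn.clm_apply_const {Ω : Set E3}
    {G : E3 → (E3 →L[ℝ] E3)} (hG : LocallyIntegrableOn G Ω volume) (v : E3) :
    LocallyIntegrableOn (fun x => G x v) Ω volume := by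
  intro x hx
  obtain ⟨t, ht, h⟩ := hG x hx
  exact ⟨t, ht, h.apply_continuousLinearMap v⟩

theorem IsWeakGradient.integral_smul_eq {Ω : Set E3} {u : E3 → E3} {G : E3 → (E3 →L[ℝ] E3)}
    (h : IsWeakGradient Ω u G) {φ : E3 → ℝ} (hφ : ContDiff ℝ ∞ φ) (hc : HasCompactSupport φ)
    (hs : tsupport φ ⊆ Ω) (v : E3) :
    ∫ x, (fderiv ℝ φ x v) • u x = - ∫ x, φ x • G x v := by
  have := h.2.2 φ hφ hc hs v
  rwa [setIntegral_eq_of_tsupport_subset (φ := fun x => fderiv ℝ φ x v)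
    ((tsupport_fderiv_apply_subset φ v).trans hs) (fun x hx => by simp only [hx, zero_smul]),
    setIntegral_eq_of_tsupport_subset (φ := φ) hs (fun x hx => by simp only [hx, zero_smul])]
    at this

/-- The defining identity of a weak gradient, with integrals over the whole space. -/
theorem IsWeakGradient.of_integral {Ω : Set E3} {u : E3 → E3} {G : E3 → (E3 →L[ℝ] E3)}
    (hu : LocallyIntegrableOn u Ω volume) (hG : LocallyIntegrableOn G Ω volume)
    (h : ∀ φ : E3 → ℝ, ContDiff ℝ ∞ φ → HasCompactSupport φ → tsupport φ ⊆ Ω → ∀ v : E3,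
      ∫ x, (fderiv ℝ φ x v) • u x = - ∫ x, φ x • G x v) : IsWeakGradient Ω u G := by
  refine ⟨hu, hG, fun φ hφ hc hs v => ?_⟩
  rw [setIntegral_eq_of_tsupport_subset (φ := fun x => fderiv ℝ φ x v)
    ((tsupport_fderiv_apply_subset φ v).trans hs) (fun x hx => by simp only [hx, zero_smul]),
    setIntegral_eq_of_tsupport_subset (φ := φ) hs (fun x hx => by simp only [hx, zero_smul])]
  exact h φ hφ hc hs v

theorem integrable_fderiv_smul {F : Type*} [NormedAddCommGroup F] [NormedSpace ℝ F] {Ω : Set E3}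
    {f : E3 → F} (hf : LocallyIntegrableOn f Ω volume)
    {φ : E3 → ℝ} (hφ : ContDiff ℝ ∞ φ) (hc : HasCompactSupport φ)
    (hs : tsupport φ ⊆ Ω) (v : E3) : Integrable (fun x => (fderiv ℝ φ x v) • f x) volume :=
  integrable_smul_of_tsupport_subset
      ((hφ.continuous_fderiv (by simp)).clm_apply continuous_const)
      (hasCompactSupport_fderiv_apply hc v) ((tsupport_fderiv_apply_subset φ v).trans hs) hf

theorem IsWeakGradient.sub {Ω : Set E3} {u u' : E3 → E3} {G G' : E3 → (E3 →L[ℝ] E3)}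
    (h : IsWeakGradient Ω u G) (h' : IsWeakGradient Ω u' G') :
    IsWeakGradient Ω (fun x => u x - u' x) (fun x => G x - G' x) := by
  refine .of_integral (h.1.sub h'.1) (h.2.1.sub h'.2.1) fun φ hφ hc hs v => ?_
  simp only [smul_sub, sub_apply]
  rw [integral_sub (integrable_fderiv_smul h.1 hφ hc hs v)
    (integrable_fderiv_smul h'.1 hφ hc hs v), integral_sub
    (integrable_smul_of_tsupport_subset hφ.continuous hc hs (h.2.1.clm_apply_const v))
    (integrable_smul_of_tsupport_subset hφ.continuous hc hs (h'.2.1.clm_apply_const v)),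
    h.integral_smul_eq hφ hc hs, h'.integral_smul_eq hφ hc hs]
  abel

theorem IsWeakGradient.congr_right {Ω : Set E3} {u : E3 → E3}
    {G G' : E3 → (E3 →L[ℝ] E3)}
    (h : IsWeakGradient Ω u G) (he : ∀ᵐ x ∂volume.restrict Ω, G x = G' x) :
    IsWeakGradient Ω u G' := by
  refine ⟨h.1, h.2.1.congr he, fun φ hφ hc hs v => ?_⟩
  rw [h.2.2 φ hφ hc hs v]
  congr 1
  refine integral_congr_ae ?_
  filter_upwards [he] with x hx
  rw [hx]

/-- Product rule for a smooth cutoff, with a change of the domain away from its support. -/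
theorem IsWeakGradient.smul_of_tsupport_subset {Ω Ω' : Set E3} {B : Set E3} (hB : B ∩ Ω' ⊆ Ω)
    {u : E3 → E3} {G : E3 → (E3 →L[ℝ] E3)} (h : IsWeakGradient Ω u G) {χ : E3 → ℝ}
    (hχ : ContDiff ℝ ∞ χ) (hχB : tsupport χ ⊆ B)
    (hu' : LocallyIntegrableOn (fun x => χ x • u x) Ω' volume)
    (hG' : LocallyIntegrableOn (fun x => χ x • G x + (fderiv ℝ χ x).smulRight (u x)) Ω' volume) :
    IsWeakGradient Ω' (fun x => χ x • u x)
      (fun x => χ x • G x + (fderiv ℝ χ x).smulRight (u x)) := by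
  refine .of_integral hu' hG' fun φ hφ hc hs v => ?_
  -- The product `φ * χ` is supported in `B ∩ Ω' ⊆ Ω`, so it may be tested against `u` there. The
  -- excess `φ * ∂χ` in its derivative produces the second summand of the new gradient.
  have hp : ContDiff ℝ ∞ (fun x => φ x * χ x) := hφ.mul hχ
  have hpc : HasCompactSupport (fun x => φ x * χ x) := hc.mul_right
  have hps : tsupport (fun x => φ x * χ x) ⊆ Ω := by
    intro x hx
    exact hB ⟨hχB (tsupport_mul_subset_right hx), hs (tsupport_mul_subset_left hx)⟩
  have key := h.integral_smul_eq hp hpc hps v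
  have hd : ∀ x, fderiv ℝ (fun x => φ x * χ x) x v
      = fderiv ℝ φ x v * χ x + φ x * fderiv ℝ χ x v := by
    intro x
    rw [fderiv_fun_mul (hφ.differentiable (by simp) x) (hχ.differentiable (by simp) x)]
    simp
    ring
  have hq : ContDiff ℝ ∞ (fun x => φ x * fderiv ℝ χ x v) :=
    hφ.mul ((hχ.fderiv_right (m := ∞) (by simp)).clm_apply contDiff_const)
  have hqc : HasCompactSupport (fun x => φ x * fderiv ℝ χ x v) := hc.mul_right
  have hqs : tsupport (fun x => φ x * fderiv ℝ χ x v) ⊆ Ω := by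
    intro x hx
    exact hB ⟨hχB (tsupport_fderiv_apply_subset χ v (tsupport_mul_subset_right hx)),
      hs (tsupport_mul_subset_left hx)⟩
  have iq := integrable_smul_of_tsupport_subset hq.continuous hqc hqs h.1
  have ip := integrable_fderiv_smul h.1 hp hpc hps v
  have ig := integrable_smul_of_tsupport_subset hp.continuous hpc hps (h.2.1.clm_apply_const v)
  have e1 : ∀ x, fderiv ℝ φ x v • χ x • u x
      = fderiv ℝ (fun x => φ x * χ x) x v • u x - (φ x * fderiv ℝ χ x v) • u x := by
    intro x
    rw [hd, smul_smul, add_smul, add_sub_cancel_right]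
  have e2 : ∀ x, φ x • (χ x • G x + (fderiv ℝ χ x).smulRight (u x)) v
      = (φ x * χ x) • G x v + (φ x * fderiv ℝ χ x v) • u x := by
    intro x
    simp [smul_smul]
  simp_rw [e1, e2]
  rw [integral_sub ip iq, integral_add ig iq, key]
  abel

theorem eLpNorm_two_sq {α V : Type*} [MeasurableSpace α] [NormedAddCommGroup V] (μ : Measure α)
    (f : α → V) : eLpNorm f 2 μ ^ 2 = ∫⁻ x, ‖f x‖ₑ ^ 2 ∂μ := by
  have := eLpNorm_nnreal_pow_eq_lintegral (μ := μ) (f := f) (p := 2) (by norm_num)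
  simp only [NNReal.coe_ofNat, ENNReal.rpow_ofNat, ENNReal.coe_ofNat] at this
  exact this

/-! ### Mollification in `L²` -/

section Mollify

variable {V : Type*} [NormedAddCommGroup V]

theorem measurePreserving_sub_left_const (x : E3) :
    MeasurePreserving (fun t : E3 => x - t) volume volume := by
  have h1 := measurePreserving_add_left (volume : Measure E3) x
  have h2 := Measure.measurePreserving_neg (volume : Measure E3)
  simpa [sub_eq_add_neg, Function.comp_def] using h1.comp h2

theorem measurePreserving_sub_const (t : E3) :
    MeasurePreserving (fun x : E3 => x - t) volume volume := measurePreserving_sub_right volume t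

/-- Translations are continuous in `L²`. -/
theorem eventually_eLpNorm_translate_sub_le {G : E3 → V} (hG : MemLp G 2 volume) {δ : ℝ≥0∞}
    (hδ : δ ≠ 0) : ∀ᶠ t in 𝓝 (0 : E3), eLpNorm (fun x => G (x - t) - G x) 2 volume ≤ δ := by
  let g : E3 → C(E3, E3) := fun t => ⟨fun x => x - t, by fun_prop⟩
  have hgc : Continuous g := by
    refine ContinuousMap.continuous_of_continuous_uncurry _ ?_
    simp only [g, ContinuousMap.coe_mk, Function.uncurry_def]
    fun_prop
  have hc : Continuous fun t => Lp.compMeasurePreserving (g t)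
      (measurePreserving_sub_const t) (hG.toLp G) :=
    Continuous.compMeasurePreservingLp continuous_const hgc
      (fun t => measurePreserving_sub_const t) (by simp)
  have h0 : Lp.compMeasurePreserving (g 0) (measurePreserving_sub_const 0) (hG.toLp G)
      = hG.toLp G := by
    refine Lp.ext ?_
    refine (Lp.coeFn_compMeasurePreserving _ _).trans ?_
    have : (g 0 : E3 → E3) = id := by ext x; simp [g]
    rw [this]
    rfl
  have ht := hc.tendsto 0
  rw [h0] at ht
  have := EMetric.tendsto_nhds.1 ht δ (pos_iff_ne_zero.2 hδ)
  filter_upwards [this] with t h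
  have e : (fun x => G (x - t) - G x) =ᵐ[volume]
      (Lp.compMeasurePreserving (g t) (measurePreserving_sub_const t) (hG.toLp G) - hG.toLp G :
        Lp V 2 volume) := by
    refine EventuallyEq.symm ((Lp.coeFn_sub _ _).trans ?_)
    have e1 := Lp.coeFn_compMeasurePreserving (hG.toLp G) (measurePreserving_sub_const t)
    have e2 := (measurePreserving_sub_const t).quasiMeasurePreserving.ae_eq_comp hG.coeFn_toLp
    filter_upwards [e1, e2, hG.coeFn_toLp] with x h1 h2 h3
    simp only [Pi.sub_apply]
    rw [h3]
    congr 1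
    exact h1.trans h2
  rw [eLpNorm_congr_ae e, ← Lp.enorm_def, ← edist_eq_enorm_sub]
  exact h.le

variable [NormedSpace ℝ V] [CompleteSpace V]

/-- Averages of translates are close in `L²` to the function. -/
theorem eLpNorm_average_translate_sub_le {G : E3 → V} (hGm : StronglyMeasurable G)
    (hG : LocallyIntegrable G volume)
    {ρ : E3 → ℝ} (hρ : Continuous ρ) (hρc : HasCompactSupport ρ) (hρ0 : ∀ x, 0 ≤ ρ x)
    (hρ1 : ∫ x, ρ x = 1) {δ : ℝ≥0∞}
    (h : ∀ t, ρ t ≠ 0 → eLpNorm (fun x => G (x - t) - G x) 2 volume ≤ δ) :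
    eLpNorm (fun x => (∫ t, ρ t • G (x - t)) - G x) 2 volume ≤ δ := by
  let κ : Measure E3 := volume.withDensity fun t => ENNReal.ofReal (ρ t)
  have hρm : Measurable fun t => ENNReal.ofReal (ρ t) := by fun_prop
  have hρi : Integrable ρ volume := hρ.integrable_of_hasCompactSupport hρc
  have hκ : IsProbabilityMeasure κ := by
    refine ⟨?_⟩
    rw [withDensity_apply _ MeasurableSet.univ, setLIntegral_univ,
      ← ofReal_integral_eq_lintegral_ofReal hρi (Eventually.of_forall hρ0), hρ1]
    simp
  have hint : ∀ x, Integrable (fun t => ρ t • G (x - t)) volume := by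
    intro x
    have h1 : LocallyIntegrable (fun t => G (x - t)) volume := by
      have := (locallyIntegrable_map_homeomorph (Homeomorph.subLeft x) (f := G)
        (μ := (volume : Measure E3))).1
      rw [show Measure.map (⇑(Homeomorph.subLeft x)) (volume : Measure E3) = volume from
        (measurePreserving_sub_left_const x).map_eq] at this
      exact this hG
    exact h1.integrable_smul_left_of_hasCompactSupport hρ hρc
  have hpt : ∀ x, ‖(∫ t, ρ t • G (x - t)) - G x‖ₑ ^ 2 ≤ ∫⁻ t, ‖G (x - t) - G x‖ₑ ^ 2 ∂κ := by
    intro x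
    have e : (∫ t, ρ t • G (x - t)) - G x = ∫ t, ρ t • (G (x - t) - G x) := by
      simp_rw [smul_sub]
      rw [integral_sub (hint x) (hρi.smul_const _), integral_smul_const, hρ1, one_smul]
    have m1 : StronglyMeasurable fun t => G (x - t) - G x :=
      (hGm.comp_measurable (by fun_prop)).sub stronglyMeasurable_const
    have h1 : ‖(∫ t, ρ t • G (x - t)) - G x‖ₑ ≤ ∫⁻ t, ‖G (x - t) - G x‖ₑ ∂κ := by
      rw [e]
      refine (enorm_integral_le_lintegral_enorm _).trans_eq ?_
      rw [lintegral_withDensity_eq_lintegral_mul _ hρm m1.enorm]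
      refine lintegral_congr fun t => ?_
      simp [enorm_smul, Real.enorm_of_nonneg (hρ0 t)]
    -- Jensen's inequality for the probability measure `κ`, in the form that the `L¹` norm is at
    -- most the `L²` norm.
    have h2 := eLpNorm_le_eLpNorm_of_exponent_le (μ := κ) (p := 1) (q := 2) (by norm_num)
      m1.aestronglyMeasurable
    rw [eLpNorm_one_eq_lintegral_enorm] at h2
    have h3 := pow_le_pow_left₀ (by simp) (h1.trans h2) 2
    exact h3.trans_eq (eLpNorm_two_sq _ _)
  have hsq : eLpNorm (fun x => (∫ t, ρ t • G (x - t)) - G x) 2 volume ^ 2 ≤ δ ^ 2 := by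
    refine (eLpNorm_two_sq _ _).trans_le ?_
    refine (lintegral_mono hpt).trans ?_
    have m2 : Measurable (Function.uncurry fun x t : E3 => ‖G (x - t) - G x‖ₑ ^ 2) := by
      have a : StronglyMeasurable fun p : E3 × E3 => G (p.1 - p.2) - G p.1 :=
        (hGm.comp_measurable (by fun_prop)).sub (hGm.comp_measurable (by fun_prop))
      exact a.enorm.pow_const 2
    rw [lintegral_lintegral_swap m2.aemeasurable]
    have m3 : Measurable fun t : E3 => ∫⁻ x, ‖G (x - t) - G x‖ₑ ^ 2 :=
      m2.lintegral_prod_left'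
    rw [lintegral_withDensity_eq_lintegral_mul _ hρm m3]
    calc ∫⁻ t, ((fun t => ENNReal.ofReal (ρ t)) * fun t => ∫⁻ x, ‖G (x - t) - G x‖ₑ ^ 2) t
        ≤ ∫⁻ t, ENNReal.ofReal (ρ t) * δ ^ 2 := by
          refine lintegral_mono fun t => ?_
          simp only [Pi.mul_apply]
          by_cases ht : ρ t = 0
          · simp [ht]
          · rw [← eLpNorm_two_sq]
            gcongr
            exact h t ht
      _ = δ ^ 2 := by
          rw [lintegral_mul_const _ hρm,
            ← ofReal_integral_eq_lintegral_ofReal hρi (Eventually.of_forall hρ0), hρ1]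
          simp
  exact (ENNReal.pow_le_pow_left_iff two_ne_zero).1 hsq

end Mollify

-- The derivative of the convolution falls on the kernel, and `s ↦ ρ (x - s)` is itself a test
-- function; the weak gradient identity then moves the derivative onto `u`.
open ContinuousLinearMap in
theorem fderiv_convolution_eq_average {u : E3 → E3} (hu : Continuous u)
    {G : E3 → (E3 →L[ℝ] E3)} (hw : IsWeakGradient univ u G) {ρ : E3 → ℝ}
    (hρ : ContDiff ℝ ∞ ρ) (hρc : HasCompactSupport ρ) (x : E3) :
    fderiv ℝ (convolution ρ u (lsmul ℝ ℝ) volume) x = ∫ t, ρ t • G (x - t) := by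
  have hul : LocallyIntegrable u volume := hu.locallyIntegrable
  have hρ1 : ContDiff ℝ 1 ρ := hρ.of_le (by exact_mod_cast le_top)
  have hGl : LocallyIntegrable G volume := locallyIntegrableOn_univ.1 hw.2.1
  have hd := (hρc.hasFDerivAt_convolution_left (lsmul ℝ ℝ) hρ1 hul x).fderiv
  rw [hd]
  have hφ : ContDiff ℝ ∞ fun s => ρ (x - s) := hρ.comp (contDiff_const.sub contDiff_id)
  have hφc : HasCompactSupport fun s => ρ (x - s) :=
    hρc.comp_homeomorph (Homeomorph.subLeft x)
  ext1 v
  have key := hw.integral_smul_eq hφ hφc (subset_univ _) v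
  have hfd : ∀ s, fderiv ℝ (fun s => ρ (x - s)) s v = - fderiv ℝ ρ (x - s) v := by
    intro s
    have h1 := (hρ1.differentiable one_ne_zero (x - s)).hasFDerivAt.comp s
      ((hasFDerivAt_id s).const_sub x)
    have h2 : fderiv ℝ (fun s => ρ (x - s)) s = _ := h1.fderiv
    rw [h2]
    simp
  simp_rw [hfd, neg_smul] at key
  rw [integral_neg, neg_inj] at key
  have hI : Integrable (fun t => ρ (x - t) • G t) volume :=
    integrable_smul_of_tsupport_subset hφ.continuous hφc (subset_univ _) hw.2.1
  have hR : (∫ t, ρ t • G (x - t)) v = ∫ s, ρ (x - s) • G s v := by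
    rw [← integral_sub_left_eq_self (fun t => ρ t • G (x - t)) volume x]
    simp only [sub_sub_cancel]
    rw [ContinuousLinearMap.integral_apply hI]
    simp
  rw [hR, ← key, convolution_eq_swap, ContinuousLinearMap.integral_apply]
  · simp [precompL_apply]
  · have := (hρc.fderiv ℝ).convolutionExists_left ((lsmul ℝ ℝ : ℝ →L[ℝ] E3 →L[ℝ] E3).precompL E3)
      (hρ1.continuous_fderiv one_ne_zero) hul x
    have h2 := (integrable_comp_sub_left (μ := (volume : Measure E3)) _ x).2 this.integrable
    simpa using h2

/-- Mollification: a compactly supported continuous field with square integrable weak gradient is a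
limit of smooth fields, uniformly and in energy. -/
theorem exists_smooth_approx {u : E3 → E3} (hu : Continuous u) (hc : HasCompactSupport u)
    {G : E3 → (E3 →L[ℝ] E3)} (hw : IsWeakGradient univ u G) (hG : MemLp G 2 volume)
    {δ : ℝ} (hδ : 0 < δ) :
    ∃ v : E3 → E3, ContDiff ℝ ∞ v ∧ (∀ x, ‖v x - u x‖ ≤ δ) ∧
      eLpNorm (fun x => fderiv ℝ v x - G x) 2 volume ≤ ENNReal.ofReal δ := by
  -- A strongly measurable representative makes `(x, t) ↦ G (x - t)` jointly measurable, as the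
  -- exchange of integrals in the averaging estimate requires.
  wlog hGm : StronglyMeasurable G generalizing G
  · obtain ⟨G', hG'm, hG'⟩ := hG.aestronglyMeasurable
    obtain ⟨v, h1, h2, h3⟩ := this (hw.congr_right (G' := G') (by rwa [Measure.restrict_univ]))
      ((memLp_congr_ae hG').1 hG) hG'm
    refine ⟨v, h1, h2, ?_⟩
    rwa [eLpNorm_congr_ae (g := fun x => fderiv ℝ v x - G' x)]
    filter_upwards [hG'] with x hx
    rw [hx]
  have huc : UniformContinuous u := hc.uniformContinuous_of_continuous hu
  obtain ⟨r, hr, hur⟩ := Metric.uniformContinuous_iff.1 huc δ hδ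
  obtain ⟨s, hs, hGs⟩ := Metric.eventually_nhds_iff_ball.1
    (eventually_eLpNorm_translate_sub_le hG (δ := ENNReal.ofReal δ) (by simpa using hδ))
  -- The outer radius puts every shift in the range of both moduli of continuity: the uniform one of
  -- `u` and the `L²` one of `G`.
  let b : ContDiffBump (0 : E3) := ⟨min r s / 2, min r s, by positivity, by
    have : 0 < min r s := by positivity
    linarith⟩
  let ρ : E3 → ℝ := b.normed volume
  have hρ : ContDiff ℝ ∞ ρ := b.contDiff_normed
  have hρc : HasCompactSupport ρ := b.hasCompactSupport_normed
  refine ⟨convolution ρ u (ContinuousLinearMap.lsmul ℝ ℝ) volume,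
    hρc.contDiff_convolution_left _ hρ hu.locallyIntegrable, fun x => ?_, ?_⟩
  · rw [← dist_eq_norm]
    refine b.dist_normed_convolution_le hu.aestronglyMeasurable fun y hy => ?_
    exact (hur (lt_of_lt_of_le hy (min_le_left _ _))).le
  · simp_rw [fderiv_convolution_eq_average hu hw hρ hρc]
    refine eLpNorm_average_translate_sub_le hGm (hG.locallyIntegrable (by norm_num)) hρ.continuous
      hρc b.nonneg_normed b.integral_normed fun t ht => hGs t ?_
    have : t ∈ Function.support ρ := ht
    rw [b.support_normed_eq] at this
    exact Metric.ball_subset_ball (min_le_right _ _) this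

/-! ### Oblique reflections -/

/-- The linear reflection along `e` which fixes the orthogonal complement of `ν`
(when `⟪ν, e⟫ = 1`). -/
def linRefl (ν e : E3) : E3 →L[ℝ] E3 :=
  ContinuousLinearMap.id ℝ E3 - (2 : ℝ) • (innerSL ℝ ν).smulRight e

/-- The affine reflection along `e` which fixes the plane `⟪ν, x⟫ = c`. -/
def affRefl (ν e : E3) (c : ℝ) (x : E3) : E3 := x - (2 * (⟪ν, x⟫_ℝ - c)) • e

section Refl

variable {ν e : E3} {c : ℝ}

theorem linRefl_apply (w : E3) : linRefl ν e w = w - (2 * ⟪ν, w⟫_ℝ) • e := by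
  simp [linRefl, smul_smul]

theorem inner_linRefl (he : ⟪ν, e⟫_ℝ = 1) (w : E3) : ⟪ν, linRefl ν e w⟫_ℝ = -⟪ν, w⟫_ℝ := by
  rw [linRefl_apply, inner_sub_right, inner_smul_right, he]
  ring

theorem linRefl_linRefl (he : ⟪ν, e⟫_ℝ = 1) (w : E3) : linRefl ν e (linRefl ν e w) = w := by
  rw [linRefl_apply (linRefl ν e w), inner_linRefl he, linRefl_apply]
  simp

theorem linRefl_eq_self {w : E3} (h : ⟪ν, w⟫_ℝ = 0) : linRefl ν e w = w := by
  simp [linRefl_apply, h]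

theorem affRefl_eq (x : E3) : affRefl ν e c x = linRefl ν e x + (2 * c) • e := by
  rw [linRefl_apply, affRefl, mul_sub, sub_smul]
  abel

theorem inner_affRefl (he : ⟪ν, e⟫_ℝ = 1) (x : E3) :
    ⟪ν, affRefl ν e c x⟫_ℝ = 2 * c - ⟪ν, x⟫_ℝ := by
  rw [affRefl, inner_sub_right, inner_smul_right, he]
  ring

theorem affRefl_affRefl (he : ⟪ν, e⟫_ℝ = 1) (x : E3) :
    affRefl ν e c (affRefl ν e c x) = x := by
  rw [affRefl, inner_affRefl he, affRefl, sub_sub, ← add_smul]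
  ring_nf
  simp

theorem affRefl_eq_self {x : E3} (h : ⟪ν, x⟫_ℝ = c) : affRefl ν e c x = x := by
  simp [affRefl, h]

theorem hasFDerivAt_affRefl (x : E3) : HasFDerivAt (affRefl ν e c) (linRefl ν e) x := by
  have : affRefl ν e c = fun x => linRefl ν e x + (2 * c) • e := funext affRefl_eq
  rw [this]
  exact (linRefl ν e).hasFDerivAt.add_const _

theorem contDiff_affRefl {n : WithTop ℕ∞} : ContDiff ℝ n (affRefl ν e c) := by
  have : affRefl ν e c = fun x => linRefl ν e x + (2 * c) • e := funext affRefl_eq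
  rw [this]
  exact (linRefl ν e).contDiff.add contDiff_const

theorem continuous_affRefl : Continuous (affRefl ν e c) :=
  (contDiff_affRefl (n := 0)).continuous

/-- The affine reflection as a homeomorphism. -/
def affReflHomeo (c : ℝ) (he : ⟪ν, e⟫_ℝ = 1) : E3 ≃ₜ E3 where
  toFun := affRefl ν e c
  invFun := affRefl ν e c
  left_inv := affRefl_affRefl he
  right_inv := affRefl_affRefl he
  continuous_toFun := continuous_affRefl
  continuous_invFun := continuous_affRefl

/-- Oblique reflections need not be isometries, but the linear part is an involution, so its
determinant is `±1`. -/
theorem measurePreserving_affRefl (he : ⟪ν, e⟫_ℝ = 1) :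
    MeasurePreserving (affRefl ν e c) volume volume := by
  let L : E3 →ₗ[ℝ] E3 := (linRefl ν e : E3 →ₗ[ℝ] E3)
  have hLL : L * L = 1 := LinearMap.ext fun w => linRefl_linRefl he w
  have hd : LinearMap.det L * LinearMap.det L = 1 := by rw [← map_mul, hLL, map_one]
  have hd0 : LinearMap.det L ≠ 0 := left_ne_zero_of_mul_eq_one hd
  have habs : |(LinearMap.det L)⁻¹| = 1 := by
    rcases mul_self_eq_one_iff.1 hd with h | h <;> simp [h]
  have h1 : MeasurePreserving (fun x => linRefl ν e x) volume volume := by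
    refine ⟨(linRefl ν e).continuous.measurable, ?_⟩
    have := Measure.map_linearMap_addHaar_eq_smul_addHaar (volume : Measure E3) hd0
    rw [habs, ENNReal.ofReal_one, one_smul] at this
    exact this
  have h2 := measurePreserving_add_right (volume : Measure E3) ((2 * c) • e)
  have : affRefl ν e c = (fun x => x + (2 * c) • e) ∘ fun x => linRefl ν e x := funext affRefl_eq
  rw [this]
  exact h2.comp h1

theorem volume_plane_eq_zero (he : ⟪ν, e⟫_ℝ = 1) : volume {x : E3 | ⟪ν, x⟫_ℝ = c} = 0 := by
  let A : AffineSubspace ℝ E3 := AffineSubspace.mk' (c • e) (LinearMap.ker (innerSL ℝ ν : E3 →ₗ[ℝ] ℝ))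
  have hA : (A : Set E3) = {x : E3 | ⟪ν, x⟫_ℝ = c} := by
    ext x
    simp only [A, SetLike.mem_coe, AffineSubspace.mem_mk', mem_ofPred_eq, LinearMap.mem_ker,
      vsub_eq_sub, ContinuousLinearMap.coe_coe, innerSL_apply_apply, inner_sub_right,
      inner_smul_right, he]
    constructor <;> intro h <;> linarith
  rw [← hA]
  refine Measure.addHaar_affineSubspace volume A fun h => ?_
  have h1 : ((c + 1) • e) ∈ (A : Set E3) := by rw [h]; trivial
  rw [hA, mem_ofPred_eq, inner_smul_right, he] at h1
  linarith

/-- The open half of a set below a plane. -/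
def below (Ω : Set E3) (ν : E3) (c : ℝ) : Set E3 := Ω ∩ {x | ⟪ν, x⟫_ℝ < c}

theorem isOpen_below {Ω : Set E3} (hΩ : IsOpen Ω) : IsOpen (below Ω ν c) :=
  hΩ.inter (isOpen_lt (by fun_prop) continuous_const)

/-- Only the plane itself is missed, and it is a null set. -/
theorem ae_eq_below_union {Ω : Set E3} (he : ⟪ν, e⟫_ℝ = 1) (hinv : ∀ x ∈ Ω, affRefl ν e c x ∈ Ω) :
    Ω =ᵐ[volume] (below Ω ν c ∪ affRefl ν e c ⁻¹' below Ω ν c : Set E3) := by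
  have h0 : ∀ᵐ x : E3, ⟪ν, x⟫_ℝ ≠ c := by
    rw [ae_iff]
    simpa using volume_plane_eq_zero (c := c) he
  filter_upwards [h0] with x hx
  refine propext ⟨fun h => ?_, ?_⟩
  · rcases lt_or_gt_of_ne hx with h1 | h1
    · exact Or.inl ⟨h, h1⟩
    · refine Or.inr ⟨hinv x h, ?_⟩
      rw [mem_ofPred_eq, inner_affRefl he]
      linarith
  · rintro (h | h)
    · exact h.1
    · have := hinv _ h.1
      rwa [affRefl_affRefl he] at this

theorem disjoint_below_preimage {Ω : Set E3} (he : ⟪ν, e⟫_ℝ = 1) :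
    Disjoint (below Ω ν c) (affRefl ν e c ⁻¹' below Ω ν c) := by
  rw [Set.disjoint_left]
  rintro x ⟨_, h1⟩ ⟨_, h2⟩
  rw [mem_ofPred_eq] at h1
  rw [mem_ofPred_eq, inner_affRefl he] at h2
  linarith

theorem measurableEmbedding_affRefl (he : ⟪ν, e⟫_ℝ = 1) : MeasurableEmbedding (affRefl ν e c) :=
  (affReflHomeo c he).measurableEmbedding

variable {F : Type*} [NormedAddCommGroup F]

theorem integrableOn_of_below {Ω : Set E3} (he : ⟪ν, e⟫_ℝ = 1)
    (hinv : ∀ x ∈ Ω, affRefl ν e c x ∈ Ω) {f : E3 → F} (h1 : IntegrableOn f (below Ω ν c) volume)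
    (h2 : IntegrableOn (fun x => f (affRefl ν e c x)) (below Ω ν c) volume) :
    IntegrableOn f Ω volume := by
  rw [integrableOn_congr_set_ae (ae_eq_below_union he hinv)]
  refine h1.union ?_
  rw [← (measurePreserving_affRefl (c := c) he).integrableOn_comp_preimage
    (measurableEmbedding_affRefl he)] at h2
  simpa only [Function.comp_def, affRefl_affRefl he] using h2

theorem setIntegral_eq_below_add [NormedSpace ℝ F] {Ω : Set E3} (hΩ : IsOpen Ω)
    (he : ⟪ν, e⟫_ℝ = 1) (hinv : ∀ x ∈ Ω, affRefl ν e c x ∈ Ω) {f : E3 → F}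
    (hf : IntegrableOn f Ω volume) :
    ∫ x in Ω, f x = (∫ x in below Ω ν c, f x) + ∫ x in below Ω ν c, f (affRefl ν e c x) := by
  have hm : MeasurableSet (affRefl ν e c ⁻¹' below Ω ν c) :=
    continuous_affRefl.measurable (isOpen_below hΩ).measurableSet
  have hae := ae_eq_below_union he hinv
  have hf' := hf
  rw [integrableOn_congr_set_ae hae] at hf'
  rw [setIntegral_congr_set hae, setIntegral_union (disjoint_below_preimage he) hm
    (hf'.mono_set subset_union_left) (hf'.mono_set subset_union_right)]
  congr 1
  have := (measurePreserving_affRefl (c := c) he).setIntegral_preimage_emb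
    (measurableEmbedding_affRefl he) (fun x => f (affRefl ν e c x)) (below Ω ν c)
  simpa only [affRefl_affRefl he] using this

end Refl

/-! ### Boundary layers along a plane -/

/-- A smooth cutoff which vanishes near and above the plane `⟪ν, x⟫ = c` and tends to one
below it. -/
def layer (ν : E3) (c : ℝ) (n : ℕ) (x : E3) : ℝ :=
  Real.smoothTransition (n * (c - ⟪ν, x⟫_ℝ) - 1)

/-- The derivative of `layer` across the plane, up to sign. -/
def layerDeriv (ν : E3) (c : ℝ) (n : ℕ) (x : E3) : ℝ :=
  n * deriv Real.smoothTransition (n * (c - ⟪ν, x⟫_ℝ) - 1)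

section Layer

variable {ν e : E3} {c : ℝ}

theorem contDiff_layer (n : ℕ) : ContDiff ℝ ∞ (layer ν c n) := by
  have h : ContDiff ℝ ∞ fun x : E3 => (n : ℝ) * (c - ⟪ν, x⟫_ℝ) - 1 :=
    (contDiff_const.mul (contDiff_const.sub (innerSL ℝ ν).contDiff)).sub contDiff_const
  exact (Real.smoothTransition.contDiff (n := ⊤)).comp h

theorem fderiv_layer (n : ℕ) (x v : E3) :
    fderiv ℝ (layer ν c n) x v = -(⟪ν, v⟫_ℝ * layerDeriv ν c n x) := by
  have h1 : HasDerivAt Real.smoothTransition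
      (deriv Real.smoothTransition (n * (c - ⟪ν, x⟫_ℝ) - 1)) (n * (c - ⟪ν, x⟫_ℝ) - 1) :=
    ((Real.smoothTransition.contDiff (n := 1)).differentiable (by simp) _).hasDerivAt
  have h2 : HasFDerivAt (fun x : E3 => (n : ℝ) * (c - ⟪ν, x⟫_ℝ) - 1)
      ((n : ℝ) • -(innerSL ℝ ν)) x :=
    (((innerSL ℝ ν).hasFDerivAt.const_sub c).const_mul (n : ℝ)).sub_const 1
  have h3 := (h1.comp_hasFDerivAt x h2).fderiv
  have h4 : fderiv ℝ (layer ν c n) x = _ := h3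
  rw [h4, layerDeriv]
  simp
  ring

theorem layerDeriv_nonneg (n : ℕ) (x : E3) : 0 ≤ layerDeriv ν c n x :=
  mul_nonneg (by positivity) Real.smoothTransition.monotone.deriv_nonneg

theorem continuous_layerDeriv (n : ℕ) : Continuous (layerDeriv ν c n) := by
  have h : Continuous (deriv Real.smoothTransition) :=
    (Real.smoothTransition.contDiff (n := 1)).continuous_deriv (by simp)
  unfold layerDeriv
  fun_prop

theorem layerDeriv_eq_zero {n : ℕ} {x : E3} (h : 2 < n * (c - ⟪ν, x⟫_ℝ)) :
    layerDeriv ν c n x = 0 := by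
  have : Real.smoothTransition =ᶠ[𝓝 (n * (c - ⟪ν, x⟫_ℝ) - 1)] fun _ => 1 := by
    filter_upwards [lt_mem_nhds (show (1 : ℝ) < n * (c - ⟪ν, x⟫_ℝ) - 1 by linarith)] with t ht
    exact Real.smoothTransition.one_of_one_le ht.le
  rw [layerDeriv, this.deriv_eq]
  simp

theorem norm_layer_le (n : ℕ) (x : E3) : ‖layer ν c n x‖ ≤ 1 := by
  rw [layer, Real.norm_of_nonneg (Real.smoothTransition.nonneg _)]
  exact Real.smoothTransition.le_one _

theorem tendsto_layer {x : E3} (hx : ⟪ν, x⟫_ℝ < c) :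
    Tendsto (fun n => layer ν c n x) atTop (𝓝 1) := by
  refine tendsto_const_nhds.congr' ?_
  have h1 : Tendsto (fun n : ℕ => (n : ℝ) * (c - ⟪ν, x⟫_ℝ)) atTop atTop :=
    tendsto_natCast_atTop_atTop.atTop_mul_const (by linarith)
  filter_upwards [h1.eventually_ge_atTop 2] with n hn
  exact (Real.smoothTransition.one_of_one_le (by linarith)).symm

/-- The shift by `-1` in `layer` keeps its support at positive distance below the plane. This makes
`φ * layer` an admissible test function for a weak gradient known only on `below Ω ν c`. -/
theorem tsupport_mul_layer_subset {Ω : Set E3} {φ : E3 → ℝ} (hs : tsupport φ ⊆ Ω) {n : ℕ}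
    (hn : n ≠ 0) : tsupport (fun x => φ x * layer ν c n x) ⊆ below Ω ν c := by
  have hn' : (0 : ℝ) < n := by positivity
  have h1 : tsupport (layer ν c n) ⊆ {x | 1 ≤ n * (c - ⟪ν, x⟫_ℝ)} := by
    refine closure_minimal (fun x hx => ?_) (isClosed_le continuous_const (by fun_prop))
    by_contra h
    rw [mem_ofPred_eq, not_le] at h
    exact hx (Real.smoothTransition.zero_of_nonpos (by linarith))
  intro x hx
  refine ⟨hs (tsupport_mul_subset_left hx), ?_⟩
  have h2 : 1 ≤ n * (c - ⟪ν, x⟫_ℝ) := h1 (tsupport_mul_subset_right hx)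
  rw [mem_ofPred_eq]
  by_contra h3
  nlinarith

variable {F : Type*} [NormedAddCommGroup F] [NormedSpace ℝ F]

theorem integrableOn_smul_of_hasCompactSupport {Ω : Set E3} {f : E3 → F}
    (hf : IntegrableOn f Ω volume) {g : E3 → ℝ} (hg : Continuous g) (hc : HasCompactSupport g) :
    IntegrableOn (fun x => g x • f x) Ω volume :=
  (Integrable.locallyIntegrable hf).integrable_smul_left_of_hasCompactSupport hg hc

/-- The layers carry bounded mass on compact sets. -/
theorem exists_integral_layerDeriv_mul_le (he : ⟪ν, e⟫_ℝ = 1) {β : E3 → ℝ} (hβ : ContDiff ℝ ∞ β)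
    (hβc : HasCompactSupport β) :
    ∃ C, 0 ≤ C ∧ ∀ n, ∫ x, layerDeriv ν c n x * β x ≤ C := by
  -- Since `⟪ν, e⟫ = 1`, `layerDeriv` is minus the derivative of `layer` along `e`. Integrating by
  -- parts moves that derivative onto `β`, and `layer` is at most one, so the bound does not depend
  -- on `n`.
  refine ⟨∫ x, ‖fderiv ℝ β x e‖, integral_nonneg fun x => norm_nonneg _, fun n => ?_⟩
  have hk := contDiff_layer (ν := ν) (c := c) n
  have hcf : Continuous fun x => fderiv ℝ β x e :=
    (hβ.continuous_fderiv (by simp)).clm_apply continuous_const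
  have hcfc := hasCompactSupport_fderiv_apply hβc e
  have hkf : Continuous fun x => fderiv ℝ (layer ν c n) x e :=
    (hk.continuous_fderiv (by simp)).clm_apply continuous_const
  have key := integral_mul_fderiv_eq_neg_fderiv_mul_of_integrable (μ := (volume : Measure E3))
    (f := layer ν c n) (g := β) (v := e)
    ((hkf.mul hβ.continuous).integrable_of_hasCompactSupport hβc.mul_left)
    ((hk.continuous.mul hcf).integrable_of_hasCompactSupport hcfc.mul_left)
    ((hk.continuous.mul hβ.continuous).integrable_of_hasCompactSupport hβc.mul_left)
    (fun x _ => hk.differentiable (by simp) x) (fun x _ => hβ.differentiable (by simp) x)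
  have e1 : ∀ x, layerDeriv ν c n x * β x = -(fderiv ℝ (layer ν c n) x e * β x) := by
    intro x
    rw [fderiv_layer, he]
    ring
  simp_rw [e1]
  rw [integral_neg, ← key]
  refine integral_mono
    ((hk.continuous.mul hcf).integrable_of_hasCompactSupport hcfc.mul_left)
    (hcf.norm.integrable_of_hasCompactSupport hcfc.norm) fun x => ?_
  refine (le_abs_self _).trans ?_
  rw [abs_mul]
  exact mul_le_of_le_one_left (abs_nonneg _) (norm_layer_le n x)

/-- The layers annihilate, in the limit, continuous functions which vanish on the plane. -/
theorem tendsto_integral_layerDeriv_smul {Ω : Set E3} (hΩ : IsOpen Ω) (he : ⟪ν, e⟫_ℝ = 1)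
    {B : E3 → F} (hB : ContinuousOn B (Ω ∩ {x | ⟪ν, x⟫_ℝ ≤ c})) {K : Set E3} (hK : IsCompact K)
    (hKΩ : K ⊆ Ω) (hBK : ∀ x ∉ K, B x = 0) (hB0 : ∀ x ∈ Ω, ⟪ν, x⟫_ℝ = c → B x = 0) :
    Tendsto (fun n => ∫ x in below Ω ν c, layerDeriv ν c n x • B x) atTop (𝓝 0) := by
  obtain ⟨R, hR, hKR⟩ := hK.isBounded.subset_closedBall_lt 0 (0 : E3)
  let β : ContDiffBump (0 : E3) := ⟨R, R + 1, hR, by linarith⟩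
  have hβ : ContDiff ℝ ∞ β := β.contDiff
  have hβc : HasCompactSupport β := β.hasCompactSupport
  obtain ⟨C, hC0, hC⟩ := exists_integral_layerDeriv_mul_le (c := c) he hβ hβc
  rw [Metric.tendsto_atTop]
  intro ε hε
  let κ := ε / (2 * (C + 1))
  have hκ : 0 < κ := by positivity
  have hK' : IsCompact (K ∩ {x | ⟪ν, x⟫_ℝ ≤ c}) :=
    hK.inter_right (isClosed_le (by fun_prop) continuous_const)
  have hBn : ContinuousOn (fun x => ‖B x‖) (K ∩ {x | ⟪ν, x⟫_ℝ ≤ c}) :=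
    (hB.mono (inter_subset_inter_left _ hKΩ)).norm
  have hS : IsCompact ((K ∩ {x | ⟪ν, x⟫_ℝ ≤ c}) ∩ (fun x => ‖B x‖) ⁻¹' Ici κ) :=
    hK'.of_isClosed_subset (hBn.preimage_isClosed_of_isClosed hK'.isClosed isClosed_Ici)
      inter_subset_left
  -- By compactness the part of `K` on or below the plane where `‖B‖ ≥ κ` stays at a positive height
  -- `η` under the plane. Once `n * η > 2` the layer no longer meets it, and elsewhere `κ` bounds
  -- the integrand.
  have hη : ∃ η > 0, ∀ x ∈ K, ⟪ν, x⟫_ℝ ≤ c → κ ≤ ‖B x‖ → η ≤ c - ⟪ν, x⟫_ℝ := by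
    rcases ((K ∩ {x | ⟪ν, x⟫_ℝ ≤ c}) ∩ (fun x => ‖B x‖) ⁻¹' Ici κ).eq_empty_or_nonempty with h | h
    · refine ⟨1, one_pos, fun x h1 h2 h3 => ?_⟩
      have : x ∈ ((K ∩ {x | ⟪ν, x⟫_ℝ ≤ c}) ∩ (fun x => ‖B x‖) ⁻¹' Ici κ) := ⟨⟨h1, h2⟩, h3⟩
      rw [h] at this
      exact this.elim
    · obtain ⟨y, hy, hmin⟩ := hS.exists_isMinOn h
        (f := fun x => c - ⟪ν, x⟫_ℝ) (by fun_prop)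
      refine ⟨c - ⟪ν, y⟫_ℝ, ?_, fun x h1 h2 h3 => hmin ⟨⟨h1, h2⟩, h3⟩⟩
      have h1 : ⟪ν, y⟫_ℝ ≤ c := hy.1.2
      rcases h1.lt_or_eq with h2 | h2
      · exact sub_pos.2 h2
      · have h3 : κ ≤ ‖B y‖ := hy.2
        rw [hB0 y (hKΩ hy.1.1) h2, norm_zero] at h3
        exact absurd h3 (not_le.2 hκ)
  obtain ⟨η, hη0, hη⟩ := hη
  obtain ⟨N, hN⟩ := exists_nat_gt (2 / η)
  refine ⟨N, fun n hn => ?_⟩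
  have hnη : 2 < n * η := by
    have : (N : ℝ) ≤ n := by exact_mod_cast hn
    exact (div_lt_iff₀ hη0).1 (hN.trans_le this)
  rw [dist_zero_right]
  have hmaj : Integrable (fun x => κ * (layerDeriv ν c n x * β x)) volume :=
    (((continuous_layerDeriv n).mul hβ.continuous).integrable_of_hasCompactSupport
      hβc.mul_left).const_mul κ
  calc ‖∫ x in below Ω ν c, layerDeriv ν c n x • B x‖
      ≤ ∫ x in below Ω ν c, ‖layerDeriv ν c n x • B x‖ := norm_integral_le_integral_norm _
    _ ≤ ∫ x in below Ω ν c, κ * (layerDeriv ν c n x * β x) := by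
        refine integral_mono_of_nonneg (Eventually.of_forall fun x => norm_nonneg _)
          hmaj.integrableOn ?_
        refine (ae_restrict_iff' (isOpen_below hΩ).measurableSet).2 (Eventually.of_forall ?_)
        rintro x ⟨hxΩ, hx⟩
        simp only
        rw [norm_smul, Real.norm_of_nonneg (layerDeriv_nonneg n x)]
        by_cases hxK : x ∈ K
        · rw [β.one_of_mem_closedBall (hKR hxK), mul_one, mul_comm κ]
          by_cases hBx : κ ≤ ‖B x‖
          · have := hη x hxK (le_of_lt hx) hBx
            rw [layerDeriv_eq_zero]
            · simp
            · refine hnη.trans_le ?_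
              gcongr
          · exact mul_le_mul_of_nonneg_left (not_le.1 hBx).le (layerDeriv_nonneg n x)
        · rw [hBK x hxK, norm_zero, mul_zero]
          exact mul_nonneg hκ.le (mul_nonneg (layerDeriv_nonneg n x) β.nonneg)
    _ ≤ ∫ x, κ * (layerDeriv ν c n x * β x) :=
        setIntegral_le_integral hmaj (Eventually.of_forall fun x =>
          mul_nonneg hκ.le (mul_nonneg (layerDeriv_nonneg n x) β.nonneg))
    _ ≤ κ * C := by
        rw [integral_const_mul]
        exact mul_le_mul_of_nonneg_left (hC n) hκ.le
    _ < ε := by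
        have : κ * (2 * (C + 1)) = ε := div_mul_cancel₀ _ (by positivity)
        nlinarith

/-- This replaces a boundary trace. Testing with `φ * layer` turns the failure of integration by
parts for `φ` into a flux through thin layers, and dominated convergence removes the cutoff from the
remaining terms. -/
theorem tendsto_layerDeriv_trace {Ω : Set E3} (hΩ : IsOpen Ω) {u : E3 → E3}
    {G : E3 → (E3 →L[ℝ] E3)} (hw : IsWeakGradient (below Ω ν c) u G)
    (hu : IntegrableOn u (below Ω ν c) volume) (hG : IntegrableOn G (below Ω ν c) volume)
    {φ : E3 → ℝ} (hφ : ContDiff ℝ ∞ φ) (hc : HasCompactSupport φ) (hs : tsupport φ ⊆ Ω) (v : E3) :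
    Tendsto (fun n => ⟪ν, v⟫_ℝ • ∫ x in below Ω ν c, layerDeriv ν c n x • φ x • u x) atTop
      (𝓝 (∫ x in below Ω ν c, ((fderiv ℝ φ x v) • u x + φ x • G x v))) := by
  have hcf : Continuous fun x => fderiv ℝ φ x v :=
    (hφ.continuous_fderiv (by simp)).clm_apply continuous_const
  have hcfc := hasCompactSupport_fderiv_apply hc v
  have hGv : IntegrableOn (fun x => G x v) (below Ω ν c) volume := hG.apply_continuousLinearMap v
  have hi : IntegrableOn (fun x => (fderiv ℝ φ x v) • u x + φ x • G x v) (below Ω ν c) volume :=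
    (integrableOn_smul_of_hasCompactSupport hu hcf hcfc).add
      (integrableOn_smul_of_hasCompactSupport hGv hφ.continuous hc)
  have hlim : Tendsto (fun n => ∫ x in below Ω ν c,
      layer ν c n x • ((fderiv ℝ φ x v) • u x + φ x • G x v)) atTop
      (𝓝 (∫ x in below Ω ν c, ((fderiv ℝ φ x v) • u x + φ x • G x v))) := by
    refine tendsto_integral_of_dominated_convergence
      (fun x => ‖(fderiv ℝ φ x v) • u x + φ x • G x v‖) (fun n => ?_) hi.norm (fun n => ?_) ?_
    · exact (contDiff_layer n).continuous.aestronglyMeasurable.smul hi.aestronglyMeasurable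
    · refine Eventually.of_forall fun x => ?_
      rw [norm_smul]
      exact mul_le_of_le_one_left (norm_nonneg _) (norm_layer_le n x)
    · refine (ae_restrict_iff' (isOpen_below hΩ).measurableSet).2 (Eventually.of_forall ?_)
      rintro x ⟨_, hx⟩
      simpa using (tendsto_layer hx).smul_const ((fderiv ℝ φ x v) • u x + φ x • G x v)
  refine hlim.congr' ?_
  filter_upwards [eventually_ne_atTop 0] with n hn
  have hk := contDiff_layer (ν := ν) (c := c) n
  have hps := tsupport_mul_layer_subset (ν := ν) (c := c) hs hn
  have key := hw.2.2 (fun x => φ x * layer ν c n x) (hφ.mul hk) hc.mul_right hps v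
  have i1 : IntegrableOn (fun x => (fderiv ℝ φ x v * layer ν c n x) • u x) (below Ω ν c) volume :=
    integrableOn_smul_of_hasCompactSupport hu (hcf.mul hk.continuous) hcfc.mul_right
  have i2 : IntegrableOn (fun x => (φ x * layer ν c n x) • G x v) (below Ω ν c) volume :=
    integrableOn_smul_of_hasCompactSupport hGv (hφ.continuous.mul hk.continuous) hc.mul_right
  have i3 : IntegrableOn (fun x => ⟪ν, v⟫_ℝ • layerDeriv ν c n x • φ x • u x)
      (below Ω ν c) volume := by
    have : IntegrableOn (fun x => (layerDeriv ν c n x * φ x) • u x) (below Ω ν c) volume :=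
      integrableOn_smul_of_hasCompactSupport hu
        ((continuous_layerDeriv n).mul hφ.continuous) hc.mul_left
    simp only [mul_smul] at this
    exact Integrable.smul ⟪ν, v⟫_ℝ this
  have e1 : ∀ x, fderiv ℝ (fun x => φ x * layer ν c n x) x v • u x
      = (fderiv ℝ φ x v * layer ν c n x) • u x - ⟪ν, v⟫_ℝ • layerDeriv ν c n x • φ x • u x := by
    intro x
    rw [fderiv_fun_mul (hφ.differentiable (by simp) x) (hk.differentiable (by simp) x)]
    simp only [add_apply, smul_apply, smul_eq_mul,
      fderiv_layer, smul_smul, ← sub_smul]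
    congr 1
    ring
  simp_rw [e1] at key
  rw [integral_sub i1 i3] at key
  have e2 : ∀ x, layer ν c n x • ((fderiv ℝ φ x v) • u x + φ x • G x v)
      = (fderiv ℝ φ x v * layer ν c n x) • u x + (φ x * layer ν c n x) • G x v := by
    intro x
    rw [smul_add, smul_smul, smul_smul, mul_comm, mul_comm (φ x)]
  simp_rw [e2]
  rw [integral_add i1 i2, ← integral_smul, ← neg_eq_iff_eq_neg.2 key]
  abel

end Layer

/-! ### Extension by reflection -/

section Reflect

variable {ν e : E3} {c : ℝ}

/-- The extension of a vector field across a plane by reflection. -/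
def reflField (ν e : E3) (c : ℝ) (u : E3 → E3) (x : E3) : E3 :=
  if ⟪ν, x⟫_ℝ ≤ c then u x else linRefl ν e (u (affRefl ν e c x))

/-- The extension of a gradient across a plane by reflection. -/
def reflGrad (ν e : E3) (c : ℝ) (G : E3 → (E3 →L[ℝ] E3)) (x : E3) : E3 →L[ℝ] E3 :=
  if ⟪ν, x⟫_ℝ ≤ c then G x else
    (linRefl ν e).comp ((G (affRefl ν e c x)).comp (linRefl ν e))

theorem reflField_of_le {u : E3 → E3} {x : E3} (h : ⟪ν, x⟫_ℝ ≤ c) :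
    reflField ν e c u x = u x := if_pos h

theorem reflGrad_of_le {G : E3 → (E3 →L[ℝ] E3)} {x : E3} (h : ⟪ν, x⟫_ℝ ≤ c) :
    reflGrad ν e c G x = G x := if_pos h

theorem reflField_affRefl (he : ⟪ν, e⟫_ℝ = 1) {u : E3 → E3} {x : E3} (h : ⟪ν, x⟫_ℝ < c) :
    reflField ν e c u (affRefl ν e c x) = linRefl ν e (u x) := by
  rw [reflField, if_neg, affRefl_affRefl he]
  rw [inner_affRefl he]
  linarith

theorem reflGrad_affRefl (he : ⟪ν, e⟫_ℝ = 1) {G : E3 → (E3 →L[ℝ] E3)} {x : E3}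
    (h : ⟪ν, x⟫_ℝ < c) :
    reflGrad ν e c G (affRefl ν e c x) = (linRefl ν e).comp ((G x).comp (linRefl ν e)) := by
  rw [reflGrad, if_neg, affRefl_affRefl he]
  rw [inner_affRefl he]
  linarith

theorem integrableOn_reflField {Ω : Set E3} (hΩ : IsOpen Ω) (he : ⟪ν, e⟫_ℝ = 1)
    (hinv : ∀ x ∈ Ω, affRefl ν e c x ∈ Ω) {u : E3 → E3}
    (hu : IntegrableOn u (below Ω ν c) volume) :
    IntegrableOn (reflField ν e c u) Ω volume := by
  have hm : MeasurableSet (below Ω ν c) := (isOpen_below hΩ).measurableSet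
  refine integrableOn_of_below (c := c) he hinv ?_ ?_
  · exact hu.congr_fun (fun x hx => (reflField_of_le (le_of_lt hx.2)).symm) hm
  · exact IntegrableOn.congr_fun ((linRefl ν e).integrable_comp hu)
      (fun x hx => (reflField_affRefl he hx.2).symm) hm

theorem integrableOn_reflGrad {Ω : Set E3} (hΩ : IsOpen Ω) (he : ⟪ν, e⟫_ℝ = 1)
    (hinv : ∀ x ∈ Ω, affRefl ν e c x ∈ Ω) {G : E3 → (E3 →L[ℝ] E3)}
    (hG : IntegrableOn G (below Ω ν c) volume) :
    IntegrableOn (reflGrad ν e c G) Ω volume := by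
  have hm : MeasurableSet (below Ω ν c) := (isOpen_below hΩ).measurableSet
  refine integrableOn_of_below (c := c) he hinv ?_ ?_
  · exact hG.congr_fun (fun x hx => (reflGrad_of_le (le_of_lt hx.2)).symm) hm
  · have h1 := ((ContinuousLinearMap.compL ℝ E3 E3 E3 (linRefl ν e)).comp
      ((ContinuousLinearMap.compL ℝ E3 E3 E3).flip (linRefl ν e))).integrable_comp hG
    exact IntegrableOn.congr_fun h1 (fun x hx => (reflGrad_affRefl he hx.2).symm) hm

/-- The reflected extension of a continuous field tangent to a plane has the reflected weak
gradient. -/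
theorem IsWeakGradient.reflect {Ω : Set E3} (hΩ : IsOpen Ω) (he : ⟪ν, e⟫_ℝ = 1)
    (hinv : ∀ x ∈ Ω, affRefl ν e c x ∈ Ω) {u : E3 → E3} {G : E3 → (E3 →L[ℝ] E3)}
    (hw : IsWeakGradient (below Ω ν c) u G) (huc : ContinuousOn u (Ω ∩ {x | ⟪ν, x⟫_ℝ ≤ c}))
    (hu : IntegrableOn u (below Ω ν c) volume) (hG : IntegrableOn G (below Ω ν c) volume)
    (ht : ∀ x ∈ Ω, ⟪ν, x⟫_ℝ = c → ⟪ν, u x⟫_ℝ = 0) :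
    IsWeakGradient Ω (reflField ν e c u) (reflGrad ν e c G) := by
  have hm : MeasurableSet (below Ω ν c) := (isOpen_below hΩ).measurableSet
  have hui := integrableOn_reflField hΩ he hinv hu
  have hGi := integrableOn_reflGrad hΩ he hinv hG
  refine ⟨hui.locallyIntegrableOn, hGi.locallyIntegrableOn, fun φ hφ hc hs v => ?_⟩
  let S := linRefl ν e
  let ψ : E3 → ℝ := fun x => φ (affRefl ν e c x)
  have hψ : ContDiff ℝ ∞ ψ := hφ.comp contDiff_affRefl
  have hψc : HasCompactSupport ψ := hc.comp_homeomorph (affReflHomeo c he)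
  have hψs : tsupport ψ ⊆ Ω := by
    refine (tsupport_comp_subset_preimage φ (continuous_affRefl (ν := ν) (e := e) (c := c))).trans ?_
    intro x hx
    have := hinv _ (hs hx)
    rwa [affRefl_affRefl he] at this
  have hψd : ∀ x w, fderiv ℝ ψ x w = fderiv ℝ φ (affRefl ν e c x) (S w) := by
    intro x w
    have h1 : HasFDerivAt ψ _ x :=
      (hφ.differentiable (by simp) (affRefl ν e c x)).hasFDerivAt.comp x (hasFDerivAt_affRefl x)
    rw [h1.fderiv]
    rfl
  have hcf : Continuous fun x => fderiv ℝ φ x v :=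
    (hφ.continuous_fderiv (by simp)).clm_apply continuous_const
  have hGv : IntegrableOn (fun x => reflGrad ν e c G x v) Ω volume :=
    hGi.apply_continuousLinearMap v
  have i1 := integrableOn_smul_of_hasCompactSupport hui hcf (hasCompactSupport_fderiv_apply hc v)
  have i2 := integrableOn_smul_of_hasCompactSupport hGv hφ.continuous hc
  rw [eq_neg_iff_add_eq_zero, ← integral_add i1 i2]
  refine (setIntegral_eq_below_add hΩ he hinv (i1.add i2)).trans ?_
  simp only [Pi.add_apply]
  have e1 : ∫ x in below Ω ν c, ((fderiv ℝ φ x v) • reflField ν e c u x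
      + φ x • reflGrad ν e c G x v)
      = ∫ x in below Ω ν c, ((fderiv ℝ φ x v) • u x + φ x • G x v) := by
    refine setIntegral_congr_fun hm fun x hx => ?_
    rw [reflField_of_le (le_of_lt hx.2), reflGrad_of_le (le_of_lt hx.2)]
  -- After the change of variables the upper half contributes the same functional on the lower half,
  -- with the test function `ψ` and direction `S v`, followed by `S`.
  have e2 : ∫ x in below Ω ν c, ((fderiv ℝ φ (affRefl ν e c x) v)
        • reflField ν e c u (affRefl ν e c x)
      + φ (affRefl ν e c x) • reflGrad ν e c G (affRefl ν e c x) v)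
      = S (∫ x in below Ω ν c, ((fderiv ℝ ψ x (S v)) • u x + ψ x • G x (S v))) := by
    have hcψ : Continuous fun x => fderiv ℝ ψ x (S v) :=
      (hψ.continuous_fderiv (by simp)).clm_apply continuous_const
    rw [← ContinuousLinearMap.integral_comp_comm]
    · refine setIntegral_congr_fun hm fun x hx => ?_
      rw [reflField_affRefl he hx.2, reflGrad_affRefl he hx.2, hψd, linRefl_linRefl he]
      simp [S, ψ]
    · exact (integrableOn_smul_of_hasCompactSupport hu hcψ
        (hasCompactSupport_fderiv_apply hψc (S v))).add
        (integrableOn_smul_of_hasCompactSupport (hG.apply_continuousLinearMap (S v))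
          hψ.continuous hψc)
  rw [e1, e2]
  have t1 := tendsto_layerDeriv_trace hΩ hw hu hG hφ hc hs v
  have t2 := (S.continuous.tendsto _).comp
    (tendsto_layerDeriv_trace hΩ hw hu hG hψ hψc hψs (S v))
  have t3 := t1.add t2
  -- Because `⟪ν, S v⟫ = -⟪ν, v⟫`, the two layer fluxes combine into that of `B`. On the plane `ψ =
  -- φ`, and `S (u x) = u x` by tangency, so `B` vanishes there and the total flux tends to zero.
  let B : E3 → E3 := fun x => φ x • u x - ψ x • S (u x)
  have hB : ContinuousOn B (Ω ∩ {x | ⟪ν, x⟫_ℝ ≤ c}) :=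
    (hφ.continuous.continuousOn.smul huc).sub
      (hψ.continuous.continuousOn.smul (S.continuous.comp_continuousOn huc))
  have t4 := tendsto_integral_layerDeriv_smul (c := c) hΩ he hB (hc.isCompact.union hψc.isCompact)
    (union_subset hs hψs)
    (fun x hx => by
      rw [mem_union, not_or] at hx
      simp [B, image_eq_zero_of_notMem_tsupport hx.1, image_eq_zero_of_notMem_tsupport hx.2])
    (fun x hx h => by
      simp [B, ψ, S, affRefl_eq_self h, linRefl_eq_self (ht x hx h)])
  have t5 := t4.const_smul ⟪ν, v⟫_ℝ
  rw [smul_zero] at t5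
  refine tendsto_nhds_unique t3 (t5.congr fun n => ?_)
  have j1 : IntegrableOn (fun x => (layerDeriv ν c n x * φ x) • u x) (below Ω ν c) volume :=
    integrableOn_smul_of_hasCompactSupport hu
      ((continuous_layerDeriv n).mul hφ.continuous) hc.mul_left
  have j2 : IntegrableOn (fun x => (layerDeriv ν c n x * ψ x) • u x) (below Ω ν c) volume :=
    integrableOn_smul_of_hasCompactSupport hu
      ((continuous_layerDeriv n).mul hψ.continuous) hψc.mul_left
  simp only [mul_smul] at j1 j2
  have j3 : IntegrableOn (fun x => layerDeriv ν c n x • ψ x • S (u x)) (below Ω ν c) volume := by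
    simpa [IntegrableOn] using S.integrable_comp j2
  simp only [Function.comp_apply, B]
  simp_rw [smul_sub]
  rw [integral_sub j1 j3, inner_linRefl he, neg_smul, map_neg, map_smul,
    ← ContinuousLinearMap.integral_comp_comm _ j2]
  simp [S, sub_eq_add_neg]

end Reflect

/-! ### Approximation in wedges -/

/-- The closed wedge cut out by the half-spaces `⟪ν, x⟫ ≤ c` for `(ν, e, c)` in a list. -/
def wedge (N : List (E3 × E3 × ℝ)) : Set E3 := {x | ∀ a ∈ N, ⟪a.1, x⟫_ℝ ≤ a.2.2}

/-- The open wedge cut out by the half-spaces `⟪ν, x⟫ < c` for `(ν, e, c)` in a list. -/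
def openWedge (N : List (E3 × E3 × ℝ)) : Set E3 := {x | ∀ a ∈ N, ⟪a.1, x⟫_ℝ < a.2.2}

/-- The directions `e` are normalized and triangular with respect to the normals `ν`. -/
def IsAdapted (N : List (E3 × E3 × ℝ)) : Prop :=
  N.Pairwise (fun a b => ⟪b.1, a.2.1⟫_ℝ = 0) ∧ ∀ a ∈ N, ⟪a.1, a.2.1⟫_ℝ = 1

theorem isClosed_wedge (N : List (E3 × E3 × ℝ)) : IsClosed (wedge N) := by
  have : wedge N = ⋂ a ∈ N, {x | ⟪a.1, x⟫_ℝ ≤ a.2.2} := by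
    ext x
    simp [wedge]
  rw [this]
  exact isClosed_biInter fun a _ => isClosed_le (by fun_prop) continuous_const

theorem isOpen_openWedge (N : List (E3 × E3 × ℝ)) : IsOpen (openWedge N) := by
  have : openWedge N = ⋂ a ∈ N.toFinset, {x | ⟪a.1, x⟫_ℝ < a.2.2} := by
    ext x
    simp [openWedge]
  rw [this]
  exact isOpen_biInter_finset fun a _ => isOpen_lt (by fun_prop) continuous_const

theorem openWedge_subset_wedge (N : List (E3 × E3 × ℝ)) : openWedge N ⊆ wedge N :=
  fun _ hx a ha => (hx a ha).le

theorem below_openWedge (a : E3 × E3 × ℝ) (N : List (E3 × E3 × ℝ)) :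
    below (openWedge N) a.1 a.2.2 = openWedge (a :: N) := by
  ext x
  simp [below, openWedge, and_comm]

theorem wedge_cons (a : E3 × E3 × ℝ) (N : List (E3 × E3 × ℝ)) :
    wedge (a :: N) = wedge N ∩ {x | ⟪a.1, x⟫_ℝ ≤ a.2.2} := by
  ext x
  simp [wedge, and_comm]

theorem inner_affRefl_of_inner_eq_zero {ν e : E3} {c : ℝ} {μ : E3} (h : ⟪μ, e⟫_ℝ = 0) (x : E3) :
    ⟪μ, affRefl ν e c x⟫_ℝ = ⟪μ, x⟫_ℝ := by
  rw [affRefl, inner_sub_right, inner_smul_right, h]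
  ring

theorem inner_linRefl_of_inner_eq_zero {ν e : E3} {μ : E3} (h : ⟪μ, e⟫_ℝ = 0) (x : E3) :
    ⟪μ, linRefl ν e x⟫_ℝ = ⟪μ, x⟫_ℝ := by
  rw [linRefl_apply, inner_sub_right, inner_smul_right, h]
  ring

section Refl

variable {ν e : E3} {c : ℝ}

/-- The two closed pieces overlap in the plane, where the point is fixed by the affine reflection
and the tangent vector by the linear one. -/
theorem continuousOn_reflField {W : Set E3} (hW : IsClosed W) (he : ⟪ν, e⟫_ℝ = 1)
    (hinv : ∀ x ∈ W, affRefl ν e c x ∈ W) {u : E3 → E3}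
    (hu : ContinuousOn u (W ∩ {x | ⟪ν, x⟫_ℝ ≤ c}))
    (ht : ∀ x ∈ W, ⟪ν, x⟫_ℝ = c → ⟪ν, u x⟫_ℝ = 0) :
    ContinuousOn (reflField ν e c u) W := by
  have hcov : W = (W ∩ {x | ⟪ν, x⟫_ℝ ≤ c}) ∪ (W ∩ {x | c ≤ ⟪ν, x⟫_ℝ}) := by
    ext x
    simp only [mem_union, mem_inter_iff, mem_ofPred_eq, ← and_or_left, le_total, and_true]
  rw [hcov]
  refine ContinuousOn.union_of_isClosed ?_ ?_
    (hW.inter (isClosed_le (by fun_prop) continuous_const))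
    (hW.inter (isClosed_le continuous_const (by fun_prop)))
  · exact hu.congr fun x hx => reflField_of_le hx.2
  · have h1 : ContinuousOn (fun x => linRefl ν e (u (affRefl ν e c x)))
        (W ∩ {x | c ≤ ⟪ν, x⟫_ℝ}) := by
      refine (linRefl ν e).continuous.comp_continuousOn
        (hu.comp continuous_affRefl.continuousOn fun x hx => ⟨hinv x hx.1, ?_⟩)
      rw [mem_ofPred_eq, inner_affRefl he]
      have : c ≤ ⟪ν, x⟫_ℝ := hx.2
      linarith
    refine h1.congr fun x hx => ?_
    have h2 : c ≤ ⟪ν, x⟫_ℝ := hx.2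
    rcases h2.lt_or_eq with h3 | h3
    · exact if_neg (not_le.2 h3)
    · simp only
      rw [reflField_of_le h3.ge, affRefl_eq_self h3.symm, linRefl_eq_self (ht x hx.1 h3.symm)]

theorem norm_conj_le (S A : E3 →L[ℝ] E3) : ‖S.comp (A.comp S)‖ ≤ ‖S‖ ^ 2 * ‖A‖ := by
  refine (S.opNorm_comp_le _).trans ?_
  calc ‖S‖ * ‖A.comp S‖ ≤ ‖S‖ * (‖A‖ * ‖S‖) := by
        gcongr
        exact A.opNorm_comp_le S
    _ = ‖S‖ ^ 2 * ‖A‖ := by ring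

theorem memLp_reflGrad {Ω : Set E3} (hΩ : IsOpen Ω) (he : ⟪ν, e⟫_ℝ = 1)
    (hinv : ∀ x ∈ Ω, affRefl ν e c x ∈ Ω) {G : E3 → (E3 →L[ℝ] E3)}
    (hG : IntegrableOn G (below Ω ν c) volume) (hG2 : MemLp G 2 (volume.restrict (below Ω ν c))) :
    MemLp (reflGrad ν e c G) 2 (volume.restrict Ω) := by
  have hm : MeasurableSet (below Ω ν c) := (isOpen_below hΩ).measurableSet
  have h1 := (memLp_two_iff_integrable_sq_norm hG2.aestronglyMeasurable).1 hG2
  rw [memLp_two_iff_integrable_sq_norm (integrableOn_reflGrad hΩ he hinv hG).aestronglyMeasurable]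
  refine integrableOn_of_below (c := c) he hinv ?_ ?_
  · refine IntegrableOn.congr_fun h1 (fun x hx => ?_) hm
    rw [reflGrad_of_le (le_of_lt hx.2)]
  · have hc : Continuous fun A : E3 →L[ℝ] E3 => (linRefl ν e).comp (A.comp (linRefl ν e)) :=
      ((ContinuousLinearMap.compL ℝ E3 E3 E3 (linRefl ν e)).comp
      ((ContinuousLinearMap.compL ℝ E3 E3 E3).flip (linRefl ν e))).continuous
    have h2 : MemLp (fun x => (linRefl ν e).comp ((G x).comp (linRefl ν e))) 2
        (volume.restrict (below Ω ν c)) :=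
      hG2.of_le_mul (hc.comp_aestronglyMeasurable hG2.aestronglyMeasurable)
        (Eventually.of_forall fun x => norm_conj_le _ _)
    have h3 := (memLp_two_iff_integrable_sq_norm h2.aestronglyMeasurable).1 h2
    refine IntegrableOn.congr_fun h3 (fun x hx => ?_) hm
    simp only
    rw [reflGrad_affRefl he hx.2]

/-- The average of a field and of its reflection. -/
def symmetrize (ν e : E3) (c : ℝ) (v : E3 → E3) (x : E3) : E3 :=
  (2⁻¹ : ℝ) • (v x + linRefl ν e (v (affRefl ν e c x)))

theorem contDiff_symmetrize {v : E3 → E3} (hv : ContDiff ℝ ∞ v) :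
    ContDiff ℝ ∞ (symmetrize ν e c v) :=
  (hv.add ((linRefl ν e).contDiff.comp (hv.comp contDiff_affRefl))).const_smul (2⁻¹ : ℝ)

theorem fderiv_symmetrize {v : E3 → E3} (hv : ContDiff ℝ ∞ v) (x : E3) :
    fderiv ℝ (symmetrize ν e c v) x = (2⁻¹ : ℝ) • (fderiv ℝ v x
      + (linRefl ν e).comp ((fderiv ℝ v (affRefl ν e c x)).comp (linRefl ν e))) := by
  have hd := hv.differentiable (by simp)
  exact (((hd x).hasFDerivAt.add ((linRefl ν e).hasFDerivAt.comp x
    ((hd _).hasFDerivAt.comp x (hasFDerivAt_affRefl x)))).const_smul (2⁻¹ : ℝ)).fderiv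

theorem inner_symmetrize_self (he : ⟪ν, e⟫_ℝ = 1) (v : E3 → E3) {x : E3} (hx : ⟪ν, x⟫_ℝ = c) :
    ⟪ν, symmetrize ν e c v x⟫_ℝ = 0 := by
  rw [symmetrize, affRefl_eq_self hx, inner_smul_right, inner_add_right, inner_linRefl he]
  simp

/-- The reflected field is invariant under the averaging, so the error is the average of the error
at `x` and the reflected error at the mirror point. -/
theorem norm_symmetrize_sub_le (he : ⟪ν, e⟫_ℝ = 1) {u v : E3 → E3} {x : E3}
    (hx : ⟪ν, x⟫_ℝ ≤ c) (ht : ⟪ν, x⟫_ℝ = c → ⟪ν, u x⟫_ℝ = 0) {δ : ℝ}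
    (h1 : ‖v x - reflField ν e c u x‖ ≤ δ)
    (h2 : ‖v (affRefl ν e c x) - reflField ν e c u (affRefl ν e c x)‖ ≤ δ) :
    ‖symmetrize ν e c v x - u x‖ ≤ (1 + ‖linRefl ν e‖) * δ := by
  have hr : linRefl ν e (reflField ν e c u (affRefl ν e c x)) = u x := by
    rcases hx.lt_or_eq with h | h
    · rw [reflField_affRefl he h, linRefl_linRefl he]
    · rw [affRefl_eq_self h, reflField_of_le hx, linRefl_eq_self (ht h)]
  rw [reflField_of_le hx] at h1
  have hδ : 0 ≤ δ := (norm_nonneg _).trans h1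
  have e1 : symmetrize ν e c v x - u x = (2⁻¹ : ℝ) • ((v x - u x)
      + linRefl ν e (v (affRefl ν e c x) - reflField ν e c u (affRefl ν e c x))) := by
    rw [map_sub, hr, symmetrize]
    module
  rw [e1, norm_smul]
  have h3 := (norm_add_le (v x - u x)
    (linRefl ν e (v (affRefl ν e c x) - reflField ν e c u (affRefl ν e c x))))
  have h4 := (linRefl ν e).le_opNorm
    (v (affRefl ν e c x) - reflField ν e c u (affRefl ν e c x))
  have h5 := mul_le_mul_of_nonneg_left h2 (norm_nonneg (linRefl ν e))
  have h6 : ‖(2⁻¹ : ℝ)‖ = 2⁻¹ := by norm_num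
  rw [h6]
  have h7 : 0 ≤ ‖linRefl ν e‖ * δ := by positivity
  nlinarith

/-- The reflected gradient is invariant under the averaging. Thus the error is the mean of `E` and
its conjugate at the mirror point; conjugation costs at most `‖linRefl ν e‖ ^ 2`, and the reflection
preserves volume. -/
theorem eLpNorm_fderiv_symmetrize_sub_le {Ω : Set E3} (hΩ : IsOpen Ω) (he : ⟪ν, e⟫_ℝ = 1)
    (hinv : ∀ x ∈ Ω, affRefl ν e c x ∈ Ω) {v : E3 → E3} (hv : ContDiff ℝ ∞ v)
    {G : E3 → (E3 →L[ℝ] E3)} (hG : MemLp (reflGrad ν e c G) 2 (volume.restrict Ω)) :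
    eLpNorm (fun x => fderiv ℝ (symmetrize ν e c v) x - G x) 2 (volume.restrict (below Ω ν c)) ≤
      ENNReal.ofReal (1 + ‖linRefl ν e‖ ^ 2) *
        eLpNorm (fun x => fderiv ℝ v x - reflGrad ν e c G x) 2 (volume.restrict Ω) := by
  have hm : MeasurableSet (below Ω ν c) := (isOpen_below hΩ).measurableSet
  let S := linRefl ν e
  let E : E3 → (E3 →L[ℝ] E3) := fun x => fderiv ℝ v x - reflGrad ν e c G x
  have hE : AEStronglyMeasurable E (volume.restrict Ω) :=
    ((hv.continuous_fderiv (by simp)).aestronglyMeasurable).sub hG.aestronglyMeasurable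
  have hpre : affRefl ν e c ⁻¹' (affRefl ν e c ⁻¹' below Ω ν c) = below Ω ν c := by
    ext x
    simp [affRefl_affRefl he]
  have hsub : affRefl ν e c ⁻¹' below Ω ν c ⊆ Ω := by
    intro x hx
    have := hinv _ hx.1
    rwa [affRefl_affRefl he] at this
  have hmp : MeasurePreserving (affRefl ν e c) (volume.restrict (below Ω ν c))
      (volume.restrict (affRefl ν e c ⁻¹' below Ω ν c)) := by
    have := (measurePreserving_affRefl (c := c) he).restrict_preimage
      (continuous_affRefl (ν := ν) (e := e) (c := c) |>.measurable hm)
    rwa [hpre] at this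
  have hE1 : AEStronglyMeasurable E (volume.restrict (below Ω ν c)) :=
    hE.mono_measure (Measure.restrict_mono inter_subset_left le_rfl)
  have hE2 : AEStronglyMeasurable E (volume.restrict (affRefl ν e c ⁻¹' below Ω ν c)) :=
    hE.mono_measure (Measure.restrict_mono hsub le_rfl)
  have hE3 : AEStronglyMeasurable (E ∘ affRefl ν e c) (volume.restrict (below Ω ν c)) :=
    hE2.comp_measurePreserving hmp
  have hc : Continuous fun A : E3 →L[ℝ] E3 => S.comp (A.comp S) :=
    ((ContinuousLinearMap.compL ℝ E3 E3 E3 S).comp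
      ((ContinuousLinearMap.compL ℝ E3 E3 E3).flip S)).continuous
  have hE4 : AEStronglyMeasurable (fun x => S.comp ((E (affRefl ν e c x)).comp S))
      (volume.restrict (below Ω ν c)) := hc.comp_aestronglyMeasurable hE3
  have b1 : eLpNorm E 2 (volume.restrict (below Ω ν c)) ≤ eLpNorm E 2 (volume.restrict Ω) :=
    eLpNorm_mono_measure _ (Measure.restrict_mono inter_subset_left le_rfl)
  have b2 : eLpNorm (fun x => S.comp ((E (affRefl ν e c x)).comp S)) 2
      (volume.restrict (below Ω ν c))
      ≤ ENNReal.ofReal (‖S‖ ^ 2) * eLpNorm E 2 (volume.restrict Ω) := by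
    refine (eLpNorm_le_mul_eLpNorm_of_ae_le_mul (g := E ∘ affRefl ν e c)
      (Eventually.of_forall fun x => norm_conj_le _ _) 2).trans ?_
    gcongr
    rw [eLpNorm_comp_measurePreserving hE2 hmp]
    exact eLpNorm_mono_measure _ (Measure.restrict_mono hsub le_rfl)
  have e1 : ∀ᵐ x ∂volume.restrict (below Ω ν c), fderiv ℝ (symmetrize ν e c v) x - G x
      = ((2⁻¹ : ℝ) • (E + fun x => S.comp ((E (affRefl ν e c x)).comp S))) x := by
    refine (ae_restrict_iff' hm).2 (Eventually.of_forall fun x hx => ?_)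
    rw [fderiv_symmetrize hv]
    simp only [E, Pi.smul_apply, Pi.add_apply]
    rw [reflGrad_of_le (le_of_lt hx.2), reflGrad_affRefl he hx.2]
    ext1 w
    simp only [S, sub_apply, smul_apply, add_apply, ContinuousLinearMap.comp_apply, map_sub,
      linRefl_linRefl he]
    module
  rw [eLpNorm_congr_ae e1]
  calc _ ≤ ‖(2⁻¹ : ℝ)‖ₑ * eLpNorm (E + fun x => S.comp ((E (affRefl ν e c x)).comp S)) 2
          (volume.restrict (below Ω ν c)) := eLpNorm_const_smul_le
    _ ≤ 1 * (eLpNorm E 2 (volume.restrict Ω)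
          + ENNReal.ofReal (‖S‖ ^ 2) * eLpNorm E 2 (volume.restrict Ω)) := by
        gcongr
        · rw [Real.enorm_of_nonneg (by norm_num)]
          exact ENNReal.ofReal_le_one.2 (by norm_num)
        · exact (eLpNorm_add_le hE1 hE4 (by norm_num)).trans (add_le_add b1 b2)
    _ = _ := by
        rw [ENNReal.ofReal_add zero_le_one (by positivity), ENNReal.ofReal_one]
        ring

end Refl

/-- Approximation of a compactly supported field tangent to the planes of a wedge by smooth
tangent fields, uniformly and in energy. -/
theorem exists_smooth_approx_wedge (N : List (E3 × E3 × ℝ)) (hN : IsAdapted N) {u : E3 → E3}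
    {G : E3 → (E3 →L[ℝ] E3)} (huc : ContinuousOn u (wedge N)) {K : Set E3} (hK : IsCompact K)
    (huK : ∀ x ∉ K, u x = 0) (hw : IsWeakGradient (openWedge N) u G)
    (hG : IntegrableOn G (openWedge N) volume) (hG2 : MemLp G 2 (volume.restrict (openWedge N)))
    (ht : ∀ a ∈ N, ∀ x ∈ wedge N, ⟪a.1, x⟫_ℝ = a.2.2 → ⟪a.1, u x⟫_ℝ = 0) {δ : ℝ} (hδ : 0 < δ) :
    ∃ v : E3 → E3, ContDiff ℝ ∞ v ∧ (∀ a ∈ N, ∀ x, ⟪a.1, x⟫_ℝ = a.2.2 → ⟪a.1, v x⟫_ℝ = 0) ∧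
      (∀ x ∈ wedge N, ‖v x - u x‖ ≤ δ) ∧
      eLpNorm (fun x => fderiv ℝ v x - G x) 2 (volume.restrict (openWedge N))
        ≤ ENNReal.ofReal δ := by
  induction N generalizing u G K δ with
  | nil =>
    have h1 : wedge [] = univ := by simp [wedge]
    have h2 : openWedge [] = univ := by simp [openWedge]
    rw [h2] at hw hG2
    rw [h1] at huc
    rw [Measure.restrict_univ] at hG2
    obtain ⟨v, hv1, hv2, hv3⟩ := exists_smooth_approx (continuousOn_univ.1 huc)
      (HasCompactSupport.intro hK huK) hw hG2 hδ
    refine ⟨v, hv1, by simp, fun x _ => hv2 x, ?_⟩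
    rwa [h2, Measure.restrict_univ]
  | cons a N ih =>
    have hp := List.pairwise_cons.1 hN.1
    have he : ⟪a.1, a.2.1⟫_ℝ = 1 := hN.2 a (by simp)
    have hN' : IsAdapted N := ⟨hp.2, fun b hb => hN.2 b (by simp [hb])⟩
    -- The direction of the head is parallel to all planes in the tail, so reflecting across the
    -- head plane leaves the tail wedge invariant. This is the use of the triangular condition.
    have hi1 : ∀ x ∈ wedge N, affRefl a.1 a.2.1 a.2.2 x ∈ wedge N := fun x hx b hb => by
      rw [inner_affRefl_of_inner_eq_zero (hp.1 b hb)]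
      exact hx b hb
    have hi2 : ∀ x ∈ openWedge N, affRefl a.1 a.2.1 a.2.2 x ∈ openWedge N := fun x hx b hb => by
      rw [inner_affRefl_of_inner_eq_zero (hp.1 b hb)]
      exact hx b hb
    have hΩ := isOpen_openWedge N
    have hta : ∀ x ∈ wedge N, ⟪a.1, x⟫_ℝ = a.2.2 → ⟪a.1, u x⟫_ℝ = 0 := fun x hx h =>
      ht a (by simp) x (by rw [wedge_cons]; exact ⟨hx, h.le⟩) h
    have hui : IntegrableOn u (openWedge (a :: N)) volume := by
      have h1 : IntegrableOn u (wedge (a :: N) ∩ K) volume :=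
        (huc.mono inter_subset_left).integrableOn_compact (hK.inter_left (isClosed_wedge _))
      refine IntegrableOn.mono_set (t := wedge (a :: N)) ?_ (openWedge_subset_wedge _)
      exact h1.of_forall_sdiff_eq_zero (isClosed_wedge _).measurableSet
        fun x hx => huK x fun h => hx.2 ⟨hx.1, h⟩
    rw [← below_openWedge] at hw hG hG2 hui
    rw [wedge_cons] at huc
    have hGr := memLp_reflGrad hΩ he hi2 hG hG2
    let S := linRefl a.1 a.2.1
    -- The denominator dominates both symmetrization losses: `1 + ‖S‖` for the uniform error and `1
    -- + ‖S‖ ^ 2` for the gradient.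
    let δ' := δ / (1 + ‖S‖ + ‖S‖ ^ 2)
    have hδ' : 0 < δ' := by positivity
    have hδ'1 : (1 + ‖S‖) * δ' ≤ δ := by
      have : (1 + ‖S‖ + ‖S‖ ^ 2) * δ' = δ := mul_div_cancel₀ _ (by positivity)
      nlinarith [mul_nonneg (sq_nonneg ‖S‖) hδ'.le]
    have hδ'2 : (1 + ‖S‖ ^ 2) * δ' ≤ δ := by
      have : (1 + ‖S‖ + ‖S‖ ^ 2) * δ' = δ := mul_div_cancel₀ _ (by positivity)
      nlinarith [mul_nonneg (norm_nonneg S) hδ'.le]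
    obtain ⟨v, hv1, hv2, hv3, hv4⟩ := ih hN'
      (u := reflField a.1 a.2.1 a.2.2 u) (G := reflGrad a.1 a.2.1 a.2.2 G)
      (continuousOn_reflField (isClosed_wedge N) he hi1 huc hta)
      (K := K ∪ affReflHomeo a.2.2 he ⁻¹' K) (hK.union
        ((affReflHomeo a.2.2 he).isCompact_preimage.2 hK))
      (fun x hx => by
        rw [mem_union, not_or] at hx
        have h2 : u (affRefl a.1 a.2.1 a.2.2 x) = 0 := huK _ hx.2
        rw [reflField]
        split_ifs
        · exact huK x hx.1
        · rw [h2, map_zero])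
      (hw.reflect hΩ he hi2 (huc.mono (inter_subset_inter_left _ (openWedge_subset_wedge N)))
        hui hG fun x hx => hta x (openWedge_subset_wedge N hx))
      (integrableOn_reflGrad hΩ he hi2 hG) hGr
      (fun b hb x hx h => by
        rw [reflField]
        split_ifs with hle
        · exact ht b (by simp [hb]) x (by rw [wedge_cons]; exact ⟨hx, hle⟩) h
        · rw [inner_linRefl_of_inner_eq_zero (hp.1 b hb)]
          refine ht b (by simp [hb]) _ ?_ ?_
          · rw [wedge_cons]
            refine ⟨hi1 x hx, ?_⟩
            rw [mem_ofPred_eq, inner_affRefl he]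
            linarith
          · rw [inner_affRefl_of_inner_eq_zero (hp.1 b hb), h]) hδ'
    refine ⟨symmetrize a.1 a.2.1 a.2.2 v, contDiff_symmetrize hv1, ?_, ?_, ?_⟩
    · intro b hb x hx
      rcases List.mem_cons.1 hb with rfl | hb
      · exact inner_symmetrize_self he v hx
      -- The tail planes are invariant under the head reflection, and so is the component of a
      -- vector along a tail normal; averaging therefore keeps the tangency already obtained.
      · rw [symmetrize, inner_smul_right, inner_add_right,
          inner_linRefl_of_inner_eq_zero (hp.1 b hb), hv2 b hb x hx, hv2 b hb]
        · simp
        · rw [inner_affRefl_of_inner_eq_zero (hp.1 b hb), hx]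
    · intro x hx
      rw [wedge_cons] at hx
      exact (norm_symmetrize_sub_le he hx.2 (hta x hx.1) (hv3 x hx.1)
        (hv3 _ (hi1 x hx.1))).trans hδ'1
    · rw [← below_openWedge]
      refine (eLpNorm_fderiv_symmetrize_sub_le hΩ he hi2 hv1 hGr).trans ?_
      refine (mul_le_mul_right hv4 _).trans ?_
      rw [← ENNReal.ofReal_mul (by positivity)]
      exact ENNReal.ofReal_le_ofReal hδ'2

/-! ### Finitely generated cones and half-spaces -/

/-- The cone generated by a finite family of vectors. -/
def genCone {ι V : Type*} [AddCommGroup V] [Module ℝ V] (f : ι → V) (s : Finset ι) : Set V :=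
  {z | ∃ w : ι → ℝ, (∀ i ∈ s, 0 ≤ w i) ∧ ∑ i ∈ s, w i • f i = z}

theorem exists_between_of_finite {L U : Set ℝ} (hL : L.Finite) (hL0 : L.Nonempty)
    (h : ∀ l ∈ L, ∀ u ∈ U, l ≤ u) : ∃ t, (∀ l ∈ L, l ≤ t) ∧ ∀ u ∈ U, t ≤ u := by
  obtain ⟨t, ht, hmax⟩ := Set.exists_max_image L id hL hL0
  exact ⟨t, hmax, fun u hu => h t ht u hu⟩

section Cone

variable {ι V : Type*} [AddCommGroup V] [Module ℝ V]

theorem mem_genCone_insert [DecidableEq ι] {f : ι → V} {s : Finset ι} {i : ι} (hi : i ∉ s)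
    {z : V} : z ∈ genCone f (insert i s) ↔ ∃ t : ℝ, 0 ≤ t ∧ z - t • f i ∈ genCone f s := by
  constructor
  · rintro ⟨w, hw, rfl⟩
    refine ⟨w i, hw i (by simp), w, fun j hj => hw j (by simp [hj]), ?_⟩
    rw [Finset.sum_insert hi]
    abel
  · rintro ⟨t, ht, w, hw, h⟩
    have hne : ∀ j ∈ s, j ≠ i := fun j hj hji => hi (hji ▸ hj)
    refine ⟨fun j => if j = i then t else w j, fun j hj => ?_, ?_⟩
    · by_cases hji : j = i
      · simp [hji, ht]
      · simpa [hji] using hw j (by simpa [hji] using hj)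
    · rw [Finset.sum_insert hi]
      have : ∑ x ∈ s, (if x = i then t else w x) • f x = ∑ x ∈ s, w x • f x :=
        Finset.sum_congr rfl fun j hj => by rw [if_neg (hne j hj)]
      rw [this, h]
      simp

/-- One step of Fourier-Motzkin elimination. -/
theorem exists_finite_halfspaces_add_ray {A : Set (V →ₗ[ℝ] ℝ)} (hA : A.Finite) (g : V) :
    ∃ A' : Set (V →ₗ[ℝ] ℝ), A'.Finite ∧
      ∀ z, (∃ t : ℝ, 0 ≤ t ∧ ∀ a ∈ A, a (z - t • g) ≤ 0) ↔ ∀ a ∈ A', a z ≤ 0 := by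
  -- A constraint with `a g > 0` bounds `t` from below by `a z / a g`, one with `a g < 0` bounds it
  -- from above. The combinations say that lower bounds do not exceed upper ones; the constraints
  -- with `a g ≤ 0` themselves account for `t ≥ 0` and for those independent of `t`.
  refine ⟨{a ∈ A | a g ≤ 0} ∪ Set.image2 (fun a b => a g • b - b g • a)
    {a ∈ A | 0 < a g} {a ∈ A | a g < 0}, (hA.subset (sep_subset _ _)).union
    ((hA.subset (sep_subset _ _)).image2 _ (hA.subset (sep_subset _ _))), fun z => ⟨?_, ?_⟩⟩
  · rintro ⟨t, ht, h⟩ a' (⟨ha, hag⟩ | ⟨a, ⟨ha, hag⟩, b, ⟨hb, hbg⟩, rfl⟩)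
    · have := h a' ha
      rw [map_sub, map_smul, smul_eq_mul] at this
      nlinarith
    · have h1 := h a ha
      have h2 := h b hb
      rw [map_sub, map_smul, smul_eq_mul] at h1 h2
      simp only [LinearMap.sub_apply, LinearMap.smul_apply, smul_eq_mul]
      nlinarith
  · intro h
    obtain ⟨t, ht1, ht2⟩ := exists_between_of_finite
      (L := insert 0 ((fun a : V →ₗ[ℝ] ℝ => a z / a g) '' {a ∈ A | 0 < a g}))
      (U := (fun a : V →ₗ[ℝ] ℝ => a z / a g) '' {a ∈ A | a g < 0})
      (((hA.subset (sep_subset _ _)).image _).insert 0) (insert_nonempty _ _) (by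
        rintro l (rfl | ⟨a, ⟨ha, hag⟩, rfl⟩) u ⟨b, ⟨hb, hbg⟩, rfl⟩
        · exact div_nonneg_of_nonpos (h b (Or.inl ⟨hb, hbg.le⟩)) hbg.le
        · have := h _ (Or.inr ⟨a, ⟨ha, hag⟩, b, ⟨hb, hbg⟩, rfl⟩)
          simp only [LinearMap.sub_apply, LinearMap.smul_apply, smul_eq_mul] at this
          simp only
          rw [div_le_iff₀ hag, div_mul_eq_mul_div, le_div_iff_of_neg hbg]
          linarith)
    refine ⟨t, ht1 0 (by simp), fun a ha => ?_⟩
    rw [map_sub, map_smul, smul_eq_mul]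
    rcases lt_trichotomy (a g) 0 with hag | hag | hag
    · have := ht2 _ ⟨a, ⟨ha, hag⟩, rfl⟩
      simp only at this
      rw [le_div_iff_of_neg hag] at this
      linarith
    · have := h a (Or.inl ⟨ha, hag.le⟩)
      rw [hag]
      linarith
    · have := ht1 _ (Or.inr ⟨a, ⟨ha, hag⟩, rfl⟩)
      simp only at this
      rw [div_le_iff₀ hag] at this
      linarith

/-- A finitely generated cone is a finite intersection of half-spaces. -/
theorem exists_finite_halfspaces_genCone [FiniteDimensional ℝ V] (f : ι → V) (s : Finset ι) :
    ∃ A : Set (V →ₗ[ℝ] ℝ), A.Finite ∧ ∀ z, z ∈ genCone f s ↔ ∀ a ∈ A, a z ≤ 0 := by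
  classical
  induction s using Finset.induction_on with
  | empty =>
    let b := Module.finBasis ℝ V
    refine ⟨range (fun i => b.coord i) ∪ range (fun i => -b.coord i),
      (finite_range _).union (finite_range _), fun z => ⟨?_, fun h => ?_⟩⟩
    · rintro ⟨w, -, rfl⟩
      simp
    · have hz : z = 0 := b.ext_elem fun i => by
        have h1 := h _ (Or.inl ⟨i, rfl⟩)
        have h2 := h _ (Or.inr ⟨i, rfl⟩)
        simp only [LinearMap.neg_apply, Module.Basis.coord_apply] at h1 h2
        rw [map_zero, Finsupp.zero_apply]
        linarith
      exact ⟨0, by simp, by simp [hz]⟩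
  | insert i s hi ih =>
    obtain ⟨A, hA, h⟩ := ih
    obtain ⟨A', hA', h'⟩ := exists_finite_halfspaces_add_ray hA (f i)
    refine ⟨A', hA', fun z => ?_⟩
    rw [mem_genCone_insert hi, ← h']
    simp only [h]

end Cone

/-- The convex hull of a finite set is a finite intersection of half-spaces. -/
theorem exists_finite_halfspaces_convexHull (s : Finset E3) :
    ∃ A : Set (E3 × ℝ), A.Finite ∧
      convexHull ℝ (s : Set E3) = {x | ∀ a ∈ A, ⟪a.1, x⟫_ℝ ≤ a.2} := by
  classical
  obtain ⟨A, hA, h⟩ := exists_finite_halfspaces_genCone (fun y : E3 => (y, (1 : ℝ))) s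
  let fn : ((E3 × ℝ) →ₗ[ℝ] ℝ) → E3 × ℝ := fun a =>
    ((InnerProductSpace.toDual ℝ E3).symm
      (LinearMap.toContinuousLinearMap (a ∘ₗ LinearMap.inl ℝ E3 ℝ)), -a (0, 1))
  refine ⟨fn '' A, hA.image _, ?_⟩
  ext x
  -- Homogenization: at height one, the last coordinate of a conic combination says that the weights
  -- sum to one.
  have h1 : x ∈ convexHull ℝ (s : Set E3) ↔
      (x, (1 : ℝ)) ∈ genCone (fun y : E3 => (y, (1 : ℝ))) s := by
    rw [Finset.mem_convexHull']
    simp only [genCone, mem_ofPred_eq]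
    refine exists_congr fun w => and_congr_right fun _ => ?_
    rw [Prod.ext_iff, Prod.fst_sum, Prod.snd_sum]
    simp [and_comm]
  rw [h1, h]
  simp only [mem_ofPred_eq, forall_mem_image]
  refine forall₂_congr fun a _ => ?_
  have h2 : ⟪(fn a).1, x⟫_ℝ = a (x, 0) := by
    simp [fn]
  have h3 : a (x, 1) = a (x, 0) + a (0, 1) := by
    rw [← map_add]
    simp
  rw [h2, h3]
  simp only [fn]
  constructor <;> intro <;> linarith

/-! ### Local structure of a polyhedron away from its vertices -/

/-- In three dimensions, vectors orthogonal to two independent vectors are determined by one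
coordinate. -/
theorem exists_cross_direction {d q : E3} (h : LinearIndependent ℝ ![d, q]) :
    ∃ τ : E3, ∀ w : E3, ⟪d, w⟫_ℝ = 0 → ⟪q, w⟫_ℝ = 0 → ⟪τ, w⟫_ℝ = 0 → w = 0 := by
  let K := Submodule.span ℝ (range ![d, q])
  have hK : Module.finrank ℝ K = 2 := by simpa using finrank_span_eq_card h
  have hKo : Module.finrank ℝ Kᗮ = 1 := by
    have := K.finrank_add_finrank_orthogonal
    rw [hK, finrank_euclideanSpace, Fintype.card_fin] at this
    omega
  obtain ⟨τ, hτ, hspan⟩ := finrank_eq_one_iff'.1 hKo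
  refine ⟨τ, fun w hd hq hw => ?_⟩
  have hwK : w ∈ Kᗮ := by
    rw [Submodule.mem_orthogonal]
    intro k hk
    induction hk using Submodule.span_induction with
    | mem x hx =>
      obtain ⟨i, rfl⟩ := hx
      fin_cases i
      · exact hd
      · exact hq
    | zero => simp
    | add x y _ _ hx hy => rw [inner_add_left, hx, hy, add_zero]
    | smul a x _ hx => rw [inner_smul_left, hx, mul_zero]
  obtain ⟨c, hc⟩ := hspan ⟨w, hwK⟩
  have hc' : c • (τ : E3) = w := congrArg Subtype.val hc
  rw [← hc', inner_smul_right] at hw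
  have hτ' : (τ : E3) ≠ 0 := fun h => hτ (Subtype.ext h)
  rcases mul_eq_zero.1 hw with h | h
  · rw [← hc', h, zero_smul]
  · exact absurd (inner_self_eq_zero.1 h) hτ'

/-- Among finitely many normals orthogonal to a line and normalized by an interior direction, two
of them span the others convexly. -/
theorem exists_extreme_pair {I : Set E3} (hI : I.Finite) (hI0 : I.Nonempty) {d q : E3} (hd : d ≠ 0)
    (h1 : ∀ μ ∈ I, ⟪d, μ⟫_ℝ = 0) (h2 : ∀ μ ∈ I, ⟪q, μ⟫_ℝ = -1) :
    ∃ μ₁ ∈ I, ∃ μ₂ ∈ I, ∀ μ ∈ I, ∃ a b : ℝ, 0 ≤ a ∧ 0 ≤ b ∧ a + b = 1 ∧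
      μ = a • μ₁ + b • μ₂ := by
  obtain ⟨μ₀, hμ₀⟩ := hI0
  have hli : LinearIndependent ℝ ![d, q] := by
    rw [LinearIndependent.pair_iff]
    intro s t hst
    have h3 : ⟪s • d + t • q, μ₀⟫_ℝ = 0 := by rw [hst, inner_zero_left]
    rw [inner_add_left, real_inner_smul_left, real_inner_smul_left, h1 _ hμ₀, h2 _ hμ₀] at h3
    have ht : t = 0 := by linarith
    rw [ht, zero_smul, add_zero] at hst
    exact ⟨(smul_eq_zero.1 hst).resolve_right hd, ht⟩
  obtain ⟨τ, hτ⟩ := exists_cross_direction hli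
  obtain ⟨μ₁, hμ₁, hmin⟩ := Set.exists_min_image I (fun μ => ⟪τ, μ⟫_ℝ) hI ⟨μ₀, hμ₀⟩
  obtain ⟨μ₂, hμ₂, hmax⟩ := Set.exists_max_image I (fun μ => ⟪τ, μ⟫_ℝ) hI ⟨μ₀, hμ₀⟩
  refine ⟨μ₁, hμ₁, μ₂, hμ₂, fun μ hμ => ?_⟩
  have hmem : ⟪τ, μ⟫_ℝ ∈ segment ℝ ⟪τ, μ₁⟫_ℝ ⟪τ, μ₂⟫_ℝ := by
    rw [segment_eq_Icc ((hmin μ hμ).trans (hmax μ hμ))]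
    exact ⟨hmin μ hμ, hmax μ hμ⟩
  obtain ⟨a, b, ha, hb, hab, h⟩ := hmem
  refine ⟨a, b, ha, hb, hab, ?_⟩
  rw [← sub_eq_zero]
  refine hτ _ ?_ ?_ ?_
  · rw [inner_sub_right, inner_add_right, inner_smul_right, inner_smul_right, h1 _ hμ, h1 _ hμ₁,
      h1 _ hμ₂]
    ring
  · rw [inner_sub_right, inner_add_right, inner_smul_right, inner_smul_right, h2 _ hμ, h2 _ hμ₁,
      h2 _ hμ₂]
    linarith
  · rw [inner_sub_right, inner_add_right, inner_smul_right, inner_smul_right, ← h]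
    simp

/-- A small disc in the supporting plane already spans every direction orthogonal to `ν`, which
gives dimension two. -/
theorem isFace_of_local {Pbar : Set E3} {ν : E3} {c : ℝ} (hν : ‖ν‖ = 1)
    (hle : ∀ x ∈ Pbar, ⟪ν, x⟫_ℝ ≤ c) {y : E3} (hy : ⟪ν, y⟫_ℝ = c) {ρ : ℝ} (hρ : 0 < ρ)
    (h : ∀ w, ⟪ν, w⟫_ℝ = 0 → ‖w‖ < ρ → y + w ∈ Pbar) :
    IsFace Pbar {x | x ∈ Pbar ∧ ⟪ν, x⟫_ℝ = c} ν := by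
  refine ⟨hν, ⟨c, hle, rfl⟩, ?_⟩
  have hν0 : ν ≠ 0 := fun h => by simp [h] at hν
  have hspan : vectorSpan ℝ {x | x ∈ Pbar ∧ ⟪ν, x⟫_ℝ = c} = (Submodule.span ℝ {ν})ᗮ := by
    refine le_antisymm ?_ ?_
    · rw [vectorSpan, Submodule.span_le]
      rintro _ ⟨a, ⟨_, ha⟩, b, ⟨_, hb⟩, rfl⟩
      rw [SetLike.mem_coe, Submodule.mem_orthogonal_singleton_iff_inner_right]
      simp only [vsub_eq_sub]
      rw [inner_sub_right, ha, hb, sub_self]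
    · intro w hw
      rw [Submodule.mem_orthogonal_singleton_iff_inner_right] at hw
      let s := ρ / (2 * (‖w‖ + 1))
      have hs : 0 < s := by positivity
      have hsw : ‖s • w‖ < ρ := by
        rw [norm_smul, Real.norm_of_nonneg hs.le]
        have : s * (2 * (‖w‖ + 1)) = ρ := div_mul_cancel₀ _ (by positivity)
        nlinarith [norm_nonneg w]
      have m1 : y + s • w ∈ {x | x ∈ Pbar ∧ ⟪ν, x⟫_ℝ = c} := by
        refine ⟨h _ (by rw [inner_smul_right, hw, mul_zero]) hsw, ?_⟩
        rw [inner_add_right, inner_smul_right, hw, hy]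
        ring
      have m2 : y ∈ {x | x ∈ Pbar ∧ ⟪ν, x⟫_ℝ = c} :=
        ⟨by simpa using h 0 (by simp) (by simpa using hρ), hy⟩
      have m3 := vsub_mem_vectorSpan ℝ m1 m2
      have m4 : s • w ∈ vectorSpan ℝ {x | x ∈ Pbar ∧ ⟪ν, x⟫_ℝ = c} := by simpa using m3
      have m5 := Submodule.smul_mem _ s⁻¹ m4
      rwa [smul_smul, inv_mul_cancel₀ hs.ne', one_smul] at m5
  rw [hspan]
  have : Fact (Module.finrank ℝ E3 = 2 + 1) := ⟨by simp⟩
  exact Submodule.finrank_orthogonal_span_singleton hν0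

/-- A wedge vertex-free description of a neighbourhood yields faces. -/
theorem isFace_of_wedge {Pbar : Set E3} {p : E3} {r : ℝ}
    {N : List (E3 × E3 × ℝ)} (hloc : Pbar ∩ Metric.ball p r = wedge N ∩ Metric.ball p r)
    {a : E3 × E3 × ℝ} (ha : ‖a.1‖ = 1) (hle : ∀ x ∈ Pbar, ⟪a.1, x⟫_ℝ ≤ a.2.2)
    {y : E3} (hyp : y ∈ Metric.ball p r) (hy : ⟪a.1, y⟫_ℝ = a.2.2)
    (hyN : ∀ b ∈ N, b ≠ a → ⟪b.1, y⟫_ℝ < b.2.2) :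
    IsFace Pbar {x | x ∈ Pbar ∧ ⟪a.1, x⟫_ℝ = a.2.2} a.1 := by
  classical
  have hopen : IsOpen ({x | ∀ b ∈ N.toFinset, b ≠ a → ⟪b.1, x⟫_ℝ < b.2.2} ∩ Metric.ball p r) := by
    refine IsOpen.inter ?_ Metric.isOpen_ball
    have : {x : E3 | ∀ b ∈ N.toFinset, b ≠ a → ⟪b.1, x⟫_ℝ < b.2.2}
        = ⋂ b ∈ N.toFinset.filter (· ≠ a), {x | ⟪b.1, x⟫_ℝ < b.2.2} := by
      ext x
      simp
    rw [this]
    exact isOpen_biInter_finset fun b _ => isOpen_lt (by fun_prop) continuous_const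
  obtain ⟨ρ, hρ, hsub⟩ := Metric.isOpen_iff.1 hopen y ⟨by simpa using hyN, hyp⟩
  refine isFace_of_local ha hle hy hρ fun w hw hwρ => ?_
  have hm := hsub (show y + w ∈ Metric.ball y ρ by simpa using hwρ)
  have : y + w ∈ wedge N ∩ Metric.ball p r := by
    refine ⟨fun b hb => ?_, hm.2⟩
    by_cases hba : b = a
    · rw [hba, inner_add_right, hw, hy, add_zero]
    · exact (hm.1 b (by simpa using hb) hba).le
  rw [← hloc] at this
  exact this.1

/-- A point with a wedge neighbourhood cut by at most two independent normals. -/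
theorem exists_adapted_of_pair {Pbar : Set E3} {p : E3} {r : ℝ} (hr : 0 < r) {μ₁ μ₂ q : E3}
    (h1 : ⟪q, μ₁⟫_ℝ = -1) (h2 : ⟪q, μ₂⟫_ℝ = -1)
    (hle1 : ∀ x ∈ Pbar, ⟪μ₁, x - p⟫_ℝ ≤ 0) (hle2 : ∀ x ∈ Pbar, ⟪μ₂, x - p⟫_ℝ ≤ 0)
    (hloc : ∀ x ∈ Metric.ball p r, ⟪μ₁, x - p⟫_ℝ ≤ 0 → ⟪μ₂, x - p⟫_ℝ ≤ 0 → x ∈ Pbar) :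
    ∃ N : List (E3 × E3 × ℝ), IsAdapted N ∧
      Pbar ∩ Metric.ball p r = wedge N ∩ Metric.ball p r ∧
      ∀ a ∈ N, IsFace Pbar {x | x ∈ Pbar ∧ ⟪a.1, x⟫_ℝ = a.2.2} a.1 := by
  have aux : ∀ μ : E3, ⟪q, μ⟫_ℝ = -1 → 0 < ‖μ‖ := fun μ h => by
    rw [norm_pos_iff]
    rintro rfl
    simp at h
  have n1 := aux μ₁ h1
  have n2 := aux μ₂ h2
  obtain ⟨ν, hνd⟩ : ∃ ν : E3 → E3, ∀ μ, ν μ = ‖μ‖⁻¹ • μ := ⟨_, fun _ => rfl⟩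
  have hν : ∀ μ, 0 < ‖μ‖ → ‖ν μ‖ = 1 := fun μ hμ => by
    rw [hνd, norm_smul, norm_inv, norm_norm, inv_mul_cancel₀ hμ.ne']
  have hνle : ∀ μ, 0 < ‖μ‖ → ∀ x, ⟪ν μ, x⟫_ℝ ≤ ⟪ν μ, p⟫_ℝ ↔ ⟪μ, x - p⟫_ℝ ≤ 0 := by
    intro μ hμ x
    rw [← sub_nonpos, ← inner_sub_right, hνd, real_inner_smul_left]
    have : 0 < ‖μ‖⁻¹ := by positivity
    constructor
    · intro h
      by_contra h3
      exact absurd (mul_pos this (not_le.1 h3)) (not_lt.2 h)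
    · intro h
      exact mul_nonpos_of_nonneg_of_nonpos this.le h
  by_cases heq : μ₁ = μ₂
  · subst heq
    have hN : Pbar ∩ Metric.ball p r = wedge [(ν μ₁, ν μ₁, ⟪ν μ₁, p⟫_ℝ)] ∩ Metric.ball p r := by
      ext x
      simp only [wedge, mem_inter_iff, mem_ofPred_eq, List.mem_singleton, forall_eq, hνle μ₁ n1]
      exact ⟨fun h => ⟨hle1 x h.1, h.2⟩, fun h => ⟨hloc x h.2 h.1 h.1, h.2⟩⟩
    refine ⟨[(ν μ₁, ν μ₁, ⟪ν μ₁, p⟫_ℝ)], ⟨by simp, ?_⟩, hN, ?_⟩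
    · simp [hν μ₁ n1]
    · simp only [List.mem_singleton, forall_eq]
      exact isFace_of_wedge hN (a := (ν μ₁, ν μ₁, ⟪ν μ₁, p⟫_ℝ)) (hν μ₁ n1)
        (fun x hx => (hνle μ₁ n1 x).2 (hle1 x hx)) (Metric.mem_ball_self hr) rfl (by simp)
  · obtain ⟨g, hs12⟩ : ∃ g, ⟪ν μ₁, ν μ₂⟫_ℝ = g := ⟨_, rfl⟩
    have hs1 : ⟪ν μ₁, ν μ₁⟫_ℝ = 1 := by rw [real_inner_self_eq_norm_sq, hν μ₁ n1]; norm_num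
    have hs2 : ⟪ν μ₂, ν μ₂⟫_ℝ = 1 := by rw [real_inner_self_eq_norm_sq, hν μ₂ n2]; norm_num
    have hs21 : ⟪ν μ₂, ν μ₁⟫_ℝ = g := by rw [real_inner_comm, hs12]
    have hq1 : ⟪q, ν μ₁⟫_ℝ = -‖μ₁‖⁻¹ := by
      rw [hνd, inner_smul_right, h1]
      ring
    have hq2 : ⟪q, ν μ₂⟫_ℝ = -‖μ₂‖⁻¹ := by
      rw [hνd, inner_smul_right, h2]
      ring
    -- Otherwise the unit normals are parallel. Opposite normals contradict the negative pairing of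
    -- both with `q`; equal ones force `μ₁ = μ₂`, because both have pairing `-1` with `q`.
    have hg : 0 < 1 - g ^ 2 := by
      let w := ν μ₁ - g • ν μ₂
      have hw : ⟪w, w⟫_ℝ = 1 - g ^ 2 := by
        simp only [w]
        rw [inner_sub_left, inner_sub_right, inner_sub_right, real_inner_smul_left,
          real_inner_smul_left, inner_smul_right, inner_smul_right, hs1, hs2, hs21, hs12]
        ring
      rw [← hw]
      refine lt_of_le_of_ne real_inner_self_nonneg fun h0 => heq ?_
      have hw0 : w = 0 := inner_self_eq_zero.1 h0.symm
      have e1 : ν μ₁ = g • ν μ₂ := sub_eq_zero.1 hw0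
      have hgg : g ^ 2 = 1 := by rw [← h0] at hw; linarith
      have e2 : -‖μ₁‖⁻¹ = g * -‖μ₂‖⁻¹ := by rw [← hq1, ← hq2, e1, inner_smul_right]
      have hg1 : g = 1 := by
        have i1 : 0 < ‖μ₁‖⁻¹ := by positivity
        have i2 : 0 < ‖μ₂‖⁻¹ := by positivity
        have : (g - 1) * (g + 1) = 0 := by linarith
        rcases mul_eq_zero.1 this with h | h
        · linarith
        · have hg' : g = -1 := by linarith
          rw [hg'] at e2
          linarith
      rw [hg1, one_mul, neg_inj, inv_inj] at e2
      rw [hg1, one_smul] at e1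
      have e3 : ‖μ₁‖ • ν μ₁ = ‖μ₁‖ • ν μ₂ := by rw [e1]
      simp only [hνd] at e3
      rw [smul_smul, mul_inv_cancel₀ n1.ne', one_smul, e2, smul_smul, mul_inv_cancel₀ n2.ne',
        one_smul] at e3
      exact e3
    -- The component of the first normal orthogonal to the second, scaled to have inner product one
    -- with the first.
    let e₁ := (1 - g ^ 2)⁻¹ • (ν μ₁ - g • ν μ₂)
    let N : List (E3 × E3 × ℝ) := [(ν μ₁, e₁, ⟪ν μ₁, p⟫_ℝ), (ν μ₂, ν μ₂, ⟪ν μ₂, p⟫_ℝ)]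
    have hN : Pbar ∩ Metric.ball p r = wedge N ∩ Metric.ball p r := by
      ext x
      simp only [N, wedge, mem_inter_iff, mem_ofPred_eq, List.mem_cons, List.not_mem_nil, or_false,
        forall_eq_or_imp, forall_eq, hνle μ₁ n1, hνle μ₂ n2]
      exact ⟨fun h => ⟨⟨hle1 x h.1, hle2 x h.1⟩, h.2⟩,
        fun h => ⟨hloc x h.2 h.1.1 h.1.2, h.2⟩⟩
    have hnear : ∀ w : E3, ∃ s : ℝ, 0 < s ∧ p + s • w ∈ Metric.ball p r := fun w => by
      refine ⟨r / (2 * (‖w‖ + 1)), by positivity, ?_⟩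
      rw [mem_ball_iff_norm, add_sub_cancel_left, norm_smul, Real.norm_of_nonneg (by positivity)]
      have : r / (2 * (‖w‖ + 1)) * (2 * (‖w‖ + 1)) = r := div_mul_cancel₀ _ (by positivity)
      have h0 : 0 < r / (2 * (‖w‖ + 1)) := by positivity
      nlinarith [norm_nonneg w]
    refine ⟨N, ⟨?_, ?_⟩, hN, ?_⟩
    · simp only [N, List.pairwise_cons, List.mem_singleton, forall_eq, List.not_mem_nil,
        IsEmpty.forall_iff, implies_true, List.Pairwise.nil, and_true, e₁]
      rw [inner_smul_right, inner_sub_right, inner_smul_right, hs2, hs21]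
      ring
    · simp only [N, List.mem_cons, List.not_mem_nil, or_false, forall_eq_or_imp, forall_eq, e₁, hs2,
        and_true]
      rw [inner_smul_right, inner_sub_right, inner_smul_right, hs1, hs12, inv_mul_eq_one₀ hg.ne']
      ring
    · simp only [N, List.mem_cons, List.not_mem_nil, or_false, forall_eq_or_imp, forall_eq]
      constructor
      -- This vector lies in the first plane and has inner product `g ^ 2 - 1 < 0` with the second
      -- normal, so a short step along it leaves the edge and enters the first face.
      · obtain ⟨s, hs, hsb⟩ := hnear (g • ν μ₁ - ν μ₂)
        refine isFace_of_wedge hN (a := (ν μ₁, e₁, ⟪ν μ₁, p⟫_ℝ)) (hν μ₁ n1)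
          (fun x hx => (hνle μ₁ n1 x).2 (hle1 x hx)) hsb ?_ ?_
        · simp only
          rw [inner_add_right, inner_smul_right, inner_sub_right, inner_smul_right, hs1, hs12]
          ring
        · intro b hb hba
          simp only [N, List.mem_cons, List.not_mem_nil, or_false] at hb
          have hb := hb.resolve_left hba
          rw [hb]
          simp only
          rw [inner_add_right, inner_smul_right, inner_sub_right, inner_smul_right, hs2, hs21]
          nlinarith
      · obtain ⟨s, hs, hsb⟩ := hnear (g • ν μ₂ - ν μ₁)
        refine isFace_of_wedge hN (a := (ν μ₂, ν μ₂, ⟪ν μ₂, p⟫_ℝ)) (hν μ₂ n2)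
          (fun x hx => (hνle μ₂ n2 x).2 (hle2 x hx)) hsb ?_ ?_
        · simp only
          rw [inner_add_right, inner_smul_right, inner_sub_right, inner_smul_right, hs2, hs21]
          ring
        · intro b hb hba
          simp only [N, List.mem_cons, List.not_mem_nil, or_false] at hb
          have hb := hb.resolve_right hba
          rw [hb]
          simp only
          rw [inner_add_right, inner_smul_right, inner_sub_right, inner_smul_right, hs1, hs12]
          nlinarith

/-- From an interior point one can still move a little in the direction `μ`, which strictly
increases the inner product. -/
theorem inner_lt_of_mem_interior {Pbar : Set E3} {μ : E3} {b : ℝ} (hμ : μ ≠ 0)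
    (h : ∀ x ∈ Pbar, ⟪μ, x⟫_ℝ ≤ b) {x : E3} (hx : x ∈ interior Pbar) : ⟪μ, x⟫_ℝ < b := by
  have h1 : ∀ᶠ t : ℝ in 𝓝 0, x + t • μ ∈ Pbar := by
    have hc : Tendsto (fun t : ℝ => x + t • μ) (𝓝 0) (𝓝 x) := by
      have : Continuous fun t : ℝ => x + t • μ := by fun_prop
      simpa using this.tendsto 0
    exact hc (mem_interior_iff_mem_nhds.1 hx)
  obtain ⟨t, ht, ht0⟩ := ((h1.filter_mono nhdsWithin_le_nhds).and
    (self_mem_nhdsWithin : Ioi (0 : ℝ) ∈ 𝓝[>] 0)).exists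
  have h2 := h _ ht
  rw [inner_add_right, inner_smul_right, real_inner_self_eq_norm_sq] at h2
  have : 0 < t * ‖μ‖ ^ 2 := mul_pos ht0 (by positivity)
  linarith

/-- Away from its vertices, a convex polyhedron is locally a wedge bounded by faces. -/
theorem exists_local_wedge {Pbar : Set E3} (hP : IsConvexPolyhedron Pbar) {p : E3}
    (hp : p ∈ punctured Pbar) :
    ∃ r > 0, ∃ N : List (E3 × E3 × ℝ), IsAdapted N ∧
      Pbar ∩ Metric.ball p r = wedge N ∩ Metric.ball p r ∧
      (∀ a ∈ N, IsFace Pbar {x | x ∈ Pbar ∧ ⟪a.1, x⟫_ℝ = a.2.2} a.1) ∧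
      Disjoint (Metric.ball p r) (vertices Pbar) := by
  obtain ⟨⟨s, hs, hPs⟩, q₀, hq₀⟩ := hP
  obtain ⟨A, hA, hPA⟩ := exists_finite_halfspaces_convexHull hs.toFinset
  rw [hs.coe_toFinset, ← hPs] at hPA
  have hV : (vertices Pbar).Finite := by
    refine hs.subset ?_
    rw [vertices, hPs]
    exact extremePoints_convexHull_subset
  have hmem : ∀ x, x ∈ Pbar ↔ ∀ a ∈ A, ⟪a.1, x⟫_ℝ ≤ a.2 := fun x => by rw [hPA]; rfl
  -- The active constraints. A zero normal imposes a condition independent of the point, hence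
  -- harmless since `p` satisfies it.
  let Act : Set (E3 × ℝ) := {a ∈ A | a.1 ≠ 0 ∧ ⟪a.1, p⟫_ℝ = a.2}
  have hnear : ∀ᶠ x in 𝓝 p, (∀ a ∈ A, a ∉ Act → ⟪a.1, x⟫_ℝ ≤ a.2) ∧ x ∉ vertices Pbar := by
    refine Filter.Eventually.and ?_ (hV.isClosed.isOpen_compl.mem_nhds hp.2)
    rw [eventually_all_finite hA]
    intro a ha
    by_cases ha0 : a ∈ Act
    · exact Eventually.of_forall fun x h => absurd ha0 h
    · have hpa := (hmem p).1 hp.1 a ha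
      by_cases h0 : a.1 = 0
      · rw [h0, inner_zero_left] at hpa
        exact Eventually.of_forall fun x _ => by rwa [h0, inner_zero_left]
      · have hlt : ⟪a.1, p⟫_ℝ < a.2 := lt_of_le_of_ne hpa fun h => ha0 ⟨ha, h0, h⟩
        have hc : Continuous fun x : E3 => ⟪a.1, x⟫_ℝ := by fun_prop
        filter_upwards [hc.continuousAt.eventually_lt_const hlt] with x hx _ using hx.le
  obtain ⟨r, hr, hball⟩ := Metric.eventually_nhds_iff_ball.1 hnear
  refine ⟨r, hr, ?_⟩
  have hdisj : Disjoint (Metric.ball p r) (vertices Pbar) :=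
    Set.disjoint_left.2 fun x hx => (hball x hx).2
  suffices h : ∃ N : List (E3 × E3 × ℝ), IsAdapted N ∧
      Pbar ∩ Metric.ball p r = wedge N ∩ Metric.ball p r ∧
      ∀ a ∈ N, IsFace Pbar {x | x ∈ Pbar ∧ ⟪a.1, x⟫_ℝ = a.2.2} a.1 by
    obtain ⟨N, h1, h2, h3⟩ := h
    exact ⟨N, h1, h2, h3, hdisj⟩
  rcases Act.eq_empty_or_nonempty with hE | hE
  · refine ⟨[], ⟨by simp, by simp⟩, ?_, by simp⟩
    ext x
    simp only [wedge, List.not_mem_nil, IsEmpty.forall_iff, implies_true, mem_inter_iff,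
      mem_ofPred_eq, true_and, and_iff_right_iff_imp]
    intro hx
    rw [hmem]
    exact fun a ha => (hball x hx).1 a ha (by simp [hE])
  -- As `p` is not a vertex, it lies inside a nondegenerate segment of the polyhedron. An active
  -- constraint attains its maximum at `p` and so is constant along the segment; all active normals
  -- are orthogonal to its direction `d`.
  · obtain ⟨d, hd0, hd⟩ : ∃ d : E3, d ≠ 0 ∧ ∀ a ∈ Act, ⟪d, a.1⟫_ℝ = 0 := by
      have hne : ¬ p ∈ Pbar.extremePoints ℝ := hp.2
      rw [mem_extremePoints] at hne
      push Not at hne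
      obtain ⟨x₁, hx₁, x₂, hx₂, ⟨α, β, hα, hβ, hαβ, hpx⟩, hnx⟩ := hne hp.1
      have hx₁p : x₁ ≠ p := by
        intro h
        refine hnx h ?_
        have h3 : β • x₂ = β • p := by
          have : α • p + β • x₂ = α • p + β • p := by
            rw [← add_smul, hαβ, one_smul, ← hpx, h]
            rw [h] at hpx
            exact (congrArg (fun y => α • y + β • x₂) hpx).symm ▸ rfl
          exact add_left_cancel this
        exact smul_right_injective E3 hβ.ne' h3
      refine ⟨x₁ - p, sub_ne_zero.2 hx₁p, fun a ha => ?_⟩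
      have i1 := (hmem x₁).1 hx₁ a ha.1
      have i2 := (hmem x₂).1 hx₂ a ha.1
      have i3 := ha.2.2
      rw [real_inner_comm, inner_sub_right, i3]
      rw [← hpx, inner_add_right, inner_smul_right, inner_smul_right] at i3
      have : a.2 = α * a.2 + β * a.2 := by rw [← add_mul, hαβ, one_mul]
      nlinarith
    let q := q₀ - p
    have hq : ∀ a ∈ Act, ⟪q, a.1⟫_ℝ < 0 := fun a ha => by
      have := inner_lt_of_mem_interior ha.2.1 (fun x hx => (hmem x).1 hx a ha.1) hq₀
      rw [real_inner_comm]
      simp only [q]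
      rw [inner_sub_right, ha.2.2]
      linarith
    -- The vector `q` points into the interior, so each active normal can be rescaled to pairing
    -- `-1` with `q`. Together with orthogonality to `d` this puts the rescaled normals on one line.
    let f : E3 × ℝ → E3 := fun a => (-⟪q, a.1⟫_ℝ)⁻¹ • a.1
    have hf : ∀ a ∈ Act, ∀ x, ⟪f a, x - p⟫_ℝ ≤ 0 ↔ ⟪a.1, x⟫_ℝ ≤ a.2 := fun a ha x => by
      have h1 : 0 < (-⟪q, a.1⟫_ℝ)⁻¹ := inv_pos.2 (neg_pos.2 (hq a ha))
      simp only [f]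
      rw [real_inner_smul_left, inner_sub_right, ha.2.2, ← sub_nonpos (a := ⟪a.1, x⟫_ℝ)]
      constructor
      · intro h
        by_contra h3
        exact absurd (mul_pos h1 (not_le.1 h3)) (not_lt.2 h)
      · intro h
        exact mul_nonpos_of_nonneg_of_nonpos h1.le h
    have hfd : ∀ μ ∈ f '' Act, ⟪d, μ⟫_ℝ = 0 := by
      rintro _ ⟨a, ha, rfl⟩
      simp only [f]
      rw [inner_smul_right, hd a ha, mul_zero]
    have hfq : ∀ μ ∈ f '' Act, ⟪q, μ⟫_ℝ = -1 := by
      rintro _ ⟨a, ha, rfl⟩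
      simp only [f]
      rw [inner_smul_right]
      have := (hq a ha).ne
      field_simp
    obtain ⟨μ₁, hμ₁, μ₂, hμ₂, hcomb⟩ := exists_extreme_pair
      ((hA.subset (sep_subset _ _)).image f) (hE.image f) hd0 hfd hfq
    have hle : ∀ μ ∈ f '' Act, ∀ x ∈ Pbar, ⟪μ, x - p⟫_ℝ ≤ 0 := by
      rintro _ ⟨a, ha, rfl⟩ x hx
      exact (hf a ha x).2 ((hmem x).1 hx a ha.1)
    refine exists_adapted_of_pair hr (hfq _ hμ₁) (hfq _ hμ₂) (hle _ hμ₁) (hle _ hμ₂)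
      fun x hx h1 h2 => (hmem x).2 fun a ha => ?_
    by_cases haA : a ∈ Act
    · rw [← hf a haA]
      obtain ⟨α, β, hα, hβ, -, h⟩ := hcomb _ ⟨a, haA, rfl⟩
      rw [h, inner_add_left, real_inner_smul_left, real_inner_smul_left]
      nlinarith
    · exact (hball x hx).1 a ha haA

theorem interior_wedge {N : List (E3 × E3 × ℝ)} (hN : IsAdapted N) :
    interior (wedge N) = openWedge N := by
  refine Subset.antisymm (fun x hx a ha => ?_)
    (interior_maximal (openWedge_subset_wedge N) (isOpen_openWedge N))
  refine inner_lt_of_mem_interior (fun h => ?_) (fun y (hy : y ∈ wedge N) => hy a ha) hx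
  have := hN.2 a ha
  simp [h] at this

theorem interior_inter_ball_eq {Pbar : Set E3} {p : E3} {r : ℝ} {N : List (E3 × E3 × ℝ)}
    (hN : IsAdapted N) (h : Pbar ∩ Metric.ball p r = wedge N ∩ Metric.ball p r) :
    interior Pbar ∩ Metric.ball p r = openWedge N ∩ Metric.ball p r := by
  have := congrArg interior h
  rwa [interior_inter, interior_inter, Metric.isOpen_ball.interior_eq, interior_wedge hN] at this

/-- An interior point is the midpoint of a short segment, hence not extreme. -/
theorem interior_subset_punctured (Pbar : Set E3) : interior Pbar ⊆ punctured Pbar := by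
  intro x hx
  refine ⟨interior_subset hx, fun hv => ?_⟩
  obtain ⟨e, he⟩ := exists_ne (0 : E3)
  have h1 : ∀ w : E3, ∀ᶠ t : ℝ in 𝓝 0, x + t • w ∈ Pbar := fun w => by
    have hc : Tendsto (fun t : ℝ => x + t • w) (𝓝 0) (𝓝 x) := by
      have : Continuous fun t : ℝ => x + t • w := by fun_prop
      simpa using this.tendsto 0
    exact hc (mem_interior_iff_mem_nhds.1 hx)
  obtain ⟨t, ⟨ht1, ht2⟩, ht0⟩ := ((((h1 e).and (h1 (-e))).filter_mono nhdsWithin_le_nhds).and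
    (self_mem_nhdsWithin : Ioi (0 : ℝ) ∈ 𝓝[>] 0)).exists
  have ht0' : t ≠ 0 := (show (0 : ℝ) < t from ht0).ne'
  have := (mem_extremePoints.1 hv).2 _ ht1 _ ht2
    ⟨2⁻¹, 2⁻¹, by norm_num, by norm_num, by norm_num, by module⟩
  have h2 : t • e = 0 := by simpa using this
  exact he ((smul_eq_zero.1 h2).resolve_left ht0')

/-- A vector tangent to the active planes of a wedge is tangent to every face through the point. -/
theorem inner_eq_zero_of_isFace {Pbar : Set E3} {p : E3} {r : ℝ} {N : List (E3 × E3 × ℝ)}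
    (hloc : Pbar ∩ Metric.ball p r = wedge N ∩ Metric.ball p r) {x w : E3}
    (hxb : x ∈ Metric.ball p r) (hw : ∀ a ∈ N, ⟪a.1, x⟫_ℝ = a.2.2 → ⟪a.1, w⟫_ℝ = 0)
    {F : Set E3} {ν : E3} (hF : IsFace Pbar F ν) (hxF : x ∈ F) : ⟪ν, w⟫_ℝ = 0 := by
  classical
  obtain ⟨-, ⟨c, hle, rfl⟩, -⟩ := hF
  have hxP : x ∈ Pbar := hxF.1
  have hxc : ⟪ν, x⟫_ℝ = c := hxF.2
  have hxW : x ∈ wedge N := by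
    have : x ∈ Pbar ∩ Metric.ball p r := ⟨hxP, hxb⟩
    rw [hloc] at this
    exact this.1
  have h1 : ∀ w' : E3, (∀ a ∈ N, ⟪a.1, x⟫_ℝ = a.2.2 → ⟪a.1, w'⟫_ℝ = 0) →
      ∀ᶠ t : ℝ in 𝓝 0, x + t • w' ∈ Pbar := by
    intro w' hw'
    have hc : Continuous fun t : ℝ => x + t • w' := by fun_prop
    have e1 : ∀ᶠ t : ℝ in 𝓝 0, x + t • w' ∈ Metric.ball p r :=
      hc.continuousAt.eventually_mem (Metric.isOpen_ball.mem_nhds (by simpa using hxb))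
    have e2 : ∀ᶠ t : ℝ in 𝓝 0, ∀ a ∈ N.toFinset, ⟪a.1, x + t • w'⟫_ℝ ≤ a.2.2 := by
      rw [eventually_all_finset]
      intro a ha
      have ha' : a ∈ N := by simpa using ha
      rcases (hxW a ha').lt_or_eq with hlt | heq
      · have hc2 : Continuous fun t : ℝ => ⟪a.1, x + t • w'⟫_ℝ := by fun_prop
        have := (hc2.tendsto 0).eventually_lt_const (u := a.2.2) (by simpa using hlt)
        filter_upwards [this] with t ht using ht.le
      · refine Eventually.of_forall fun t => ?_
        rw [inner_add_right, inner_smul_right, hw' a ha' heq, heq, mul_zero, add_zero]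
    filter_upwards [e1, e2] with t ht1 ht2
    have : x + t • w' ∈ wedge N ∩ Metric.ball p r := ⟨fun a ha => ht2 a (by simpa using ha), ht1⟩
    rw [← hloc] at this
    exact this.1
  -- Both `x + t • w` and `x - t • w` stay in the polyhedron for small `t > 0`, so the linear
  -- functional maximized at `x` is constant along `w`.
  have h2 := h1 w hw
  have h3 := h1 (-w) fun a ha hax => by rw [inner_neg_right, hw a ha hax, neg_zero]
  obtain ⟨t, ⟨ht1, ht2⟩, ht0⟩ := (((h2.and h3).filter_mono nhdsWithin_le_nhds).and
    (self_mem_nhdsWithin : Ioi (0 : ℝ) ∈ 𝓝[>] 0)).exists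
  have i1 := hle _ ht1
  have i2 := hle _ ht2
  rw [inner_add_right, inner_smul_right, hxc] at i1 i2
  rw [inner_neg_right] at i2
  have ht0' : (0 : ℝ) < t := ht0
  have j1 : t * ⟪ν, w⟫_ℝ = 0 := by linarith
  exact (mul_eq_zero.1 j1).resolve_left ht0'.ne'

/-! ### Localization and local approximation -/

theorem memLp_of_restrict_of_eq_zero {F : Type*} [NormedAddCommGroup F] {μ : Measure E3}
    {f : E3 → F} {q : ℝ≥0∞} {s : Set E3} (hs : MeasurableSet s) (hf : ∀ x ∉ s, f x = 0)
    (h : MemLp f q (μ.restrict s)) : MemLp f q μ := by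
  rw [← memLp_indicator_iff_restrict hs] at h
  rwa [indicator_eq_self.2 fun x hx => by_contra fun hxs => hx (hf x hxs)] at h

theorem eLpNorm_restrict_of_eq_zero {F : Type*} [NormedAddCommGroup F] {μ : Measure E3}
    {f : E3 → F} {q : ℝ≥0∞} {s : Set E3} (hs : MeasurableSet s) (hf : ∀ x ∉ s, f x = 0) :
    eLpNorm f q (μ.restrict s) = eLpNorm f q μ := by
  rw [← eLpNorm_indicator_eq_eLpNorm_restrict hs,
    indicator_eq_self.2 fun x hx => by_contra fun hxs => hx (hf x hxs)]

/-- The weak gradient of the product of a field with a smooth function. -/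
def prodGrad (φ : E3 → ℝ) (m : E3 → E3) (G : E3 → (E3 →L[ℝ] E3)) (x : E3) : E3 →L[ℝ] E3 :=
  φ x • G x + (fderiv ℝ φ x).smulRight (m x)

theorem norm_prodGrad_le (φ : E3 → ℝ) (m : E3 → E3) (G : E3 → (E3 →L[ℝ] E3)) (x : E3) :
    ‖prodGrad φ m G x‖ ≤ ‖φ x‖ * ‖G x‖ + ‖fderiv ℝ φ x‖ * ‖m x‖ := by
  refine (norm_add_le _ _).trans ?_
  rw [norm_smul, ContinuousLinearMap.norm_smulRight_apply]

theorem prodGrad_eq_zero {φ : E3 → ℝ} {m : E3 → E3} {G : E3 → (E3 →L[ℝ] E3)} {x : E3}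
    (hx : x ∉ tsupport φ) : prodGrad φ m G x = 0 := by
  have h0 := notMem_tsupport_iff_eventuallyEq.1 hx
  rw [prodGrad, h0.fderiv_eq, h0.self_of_nhds]
  ext1 w
  simp

theorem aestronglyMeasurable_prodGrad {μ : Measure E3} {φ : E3 → ℝ} (hφ : ContDiff ℝ ∞ φ)
    {m : E3 → E3} {G : E3 → (E3 →L[ℝ] E3)} (hm : AEStronglyMeasurable m μ)
    (hG : AEStronglyMeasurable G μ) : AEStronglyMeasurable (prodGrad φ m G) μ := by
  refine (hφ.continuous.aestronglyMeasurable.smul hG).add ?_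
  have h1 : AEStronglyMeasurable (fun x => fderiv ℝ φ x) μ :=
    (hφ.continuous_fderiv (by simp)).aestronglyMeasurable
  exact (ContinuousLinearMap.smulRightL ℝ E3 E3).aestronglyMeasurable_comp₂ h1 hm

/-- The term containing the derivative of `φ` is merely bounded; finiteness of the measure puts it
in `L²`. -/
theorem memLp_prodGrad {μ : Measure E3} {φ : E3 → ℝ} (hφ : ContDiff ℝ ∞ φ)
    (hφc : HasCompactSupport φ) {m : E3 → E3} {G : E3 → (E3 →L[ℝ] E3)} [IsFiniteMeasure μ]
    (hm : AEStronglyMeasurable m μ) (hm1 : ∀ᵐ x ∂μ, ‖m x‖ ≤ 1) (hG : MemLp G 2 μ) :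
    MemLp (prodGrad φ m G) 2 μ := by
  obtain ⟨M₀, hM₀⟩ := hφc.exists_bound_of_continuous hφ.continuous
  obtain ⟨M₁, hM₁⟩ := (hφc.fderiv ℝ).exists_bound_of_continuous (hφ.continuous_fderiv (by simp))
  have h1 : MemLp (fun x => M₀ * ‖G x‖ + M₁) 2 μ := (hG.norm.const_mul M₀).add (memLp_const M₁)
  refine h1.mono' (aestronglyMeasurable_prodGrad hφ hm hG.aestronglyMeasurable) ?_
  filter_upwards [hm1] with x hx
  refine (norm_prodGrad_le φ m G x).trans ?_
  have a1 := mul_le_mul_of_nonneg_right (hM₀ x) (norm_nonneg (G x))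
  have a2 := mul_le_mul (hM₁ x) hx (norm_nonneg _) ((norm_nonneg _).trans (hM₁ x))
  linarith

theorem CTangent.norm_eq_one {Pbar : Set E3} {m : E3 → E3} (hm : CTangent Pbar m) {x : E3}
    (hx : x ∈ punctured Pbar) : ‖m x‖ = 1 := hm.2.1 x hx

/-- Near a point which is not a vertex, a tangent unit field of finite energy is a limit of
smooth tangent fields, uniformly and in energy. -/
theorem exists_local_approx {Pbar : Set E3} (hP : IsConvexPolyhedron Pbar) {m : E3 → E3}
    (hm : CTangent Pbar m) {G : E3 → (E3 →L[ℝ] E3)} (hw : IsWeakGradient (interior Pbar) m G)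
    (hG : MemLp G 2 (volume.restrict (interior Pbar))) {p : E3} (hp : p ∈ punctured Pbar) :
    ∃ r > 0, ∀ φ : E3 → ℝ, ContDiff ℝ ∞ φ → tsupport φ ⊆ Metric.closedBall p r →
      ∀ δ : ℝ, 0 < δ → ∃ v : E3 → E3, ContDiff ℝ ∞ v ∧
        (∀ F ν, IsFace Pbar F ν → ∀ x ∈ F, ⟪ν, φ x • v x⟫_ℝ = 0) ∧
        (∀ x ∈ punctured Pbar, ‖φ x • v x - φ x • m x‖ ≤ δ) ∧
        eLpNorm (fun x => fderiv ℝ (fun y => φ y • v y) x - prodGrad φ m G x) 2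
          (volume.restrict (interior Pbar)) ≤ ENNReal.ofReal δ := by
  obtain ⟨r, hr, N, hN, hloc, hface, hdisj⟩ := exists_local_wedge hP hp
  have hloci := interior_inter_ball_eq hN hloc
  have hPb : ∀ x ∈ wedge N, x ∈ Metric.ball p r → x ∈ punctured Pbar := fun x h1 h2 => by
    have : x ∈ wedge N ∩ Metric.ball p r := ⟨h1, h2⟩
    rw [← hloc] at this
    exact ⟨this.1, Set.disjoint_left.1 hdisj h2⟩
  have hbm : MeasurableSet (Metric.ball p r) := Metric.isOpen_ball.measurableSet
  have hmc := hm.1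
  let μ : Measure E3 := volume.restrict (Metric.ball p r ∩ interior Pbar)
  have hμ : μ = volume.restrict (Metric.ball p r ∩ openWedge N) := by
    simp only [μ]
    rw [inter_comm, hloci, inter_comm]
  have hfin : IsFiniteMeasure μ := by
    refine ⟨?_⟩
    rw [Measure.restrict_apply_univ]
    exact (measure_mono inter_subset_left).trans_lt measure_ball_lt_top
  have hmeas : MeasurableSet (Metric.ball p r ∩ interior Pbar) :=
    hbm.inter isOpen_interior.measurableSet
  have hmμ : AEStronglyMeasurable m μ :=
    (hmc.mono (inter_subset_right.trans (interior_subset_punctured Pbar))).aestronglyMeasurable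
      hmeas
  have hmμ1 : ∀ᵐ x ∂μ, ‖m x‖ ≤ 1 := (ae_restrict_iff' hmeas).2 (Eventually.of_forall fun x hx =>
    (hm.norm_eq_one (interior_subset_punctured Pbar hx.2)).le)
  have hGμ : MemLp G 2 μ := hG.mono_measure (Measure.restrict_mono inter_subset_right le_rfl)
  -- The inner radius exceeds `r / 2`, so `χ = 1` near the support of every later `φ`; the outer one
  -- is less than `r`, so `χ • m` vanishes outside the ball where the wedge describes the
  -- polyhedron.
  let χ : ContDiffBump p := ⟨2 / 3 * r, 3 / 4 * r, by positivity, by linarith⟩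
  have hχ : ContDiff ℝ ∞ χ := χ.contDiff
  have hχc : HasCompactSupport χ := χ.hasCompactSupport
  have hχb : tsupport χ ⊆ Metric.ball p r := by
    rw [χ.tsupport_eq]
    exact Metric.closedBall_subset_ball (by simp only [χ]; linarith)
  let u : E3 → E3 := fun x => χ x • m x
  have hoff : ∀ x ∉ tsupport χ, u x = 0 := fun x hx => by
    simp only [u]
    rw [image_eq_zero_of_notMem_tsupport hx, zero_smul]
  have hu : ContinuousOn u (wedge N) := by
    intro x hx
    by_cases hxb : x ∈ Metric.ball p r
    · have h1 : ContinuousWithinAt u (punctured Pbar) x :=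
        hχ.continuous.continuousWithinAt.smul (hmc x (hPb x hx hxb))
      refine h1.mono_of_mem_nhdsWithin ?_
      refine mem_of_superset (inter_mem_nhdsWithin (wedge N) (Metric.isOpen_ball.mem_nhds hxb)) ?_
      exact fun y hy => hPb y hy.1 hy.2
    · have h1 : u =ᶠ[𝓝 x] fun _ => 0 := by
        filter_upwards [(isClosed_tsupport χ).isOpen_compl.mem_nhds fun h => hxb (hχb h)] with y hy
        exact hoff y hy
      exact (continuousAt_const.congr h1.symm).continuousWithinAt
  have hχG : MemLp (prodGrad χ m G) 2 μ := memLp_prodGrad hχ hχc hmμ hmμ1 hGμ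
  have hlift : ∀ q : ℝ≥0∞, MemLp (prodGrad χ m G) q μ →
      MemLp (prodGrad χ m G) q (volume.restrict (openWedge N)) := fun q h => by
    rw [hμ, ← Measure.restrict_restrict hbm] at h
    exact memLp_of_restrict_of_eq_zero hbm (fun x hx => prodGrad_eq_zero fun h' => hx (hχb h')) h
  have hG2 := hlift 2 hχG
  have hG1 : IntegrableOn (prodGrad χ m G) (openWedge N) volume :=
    memLp_one_iff_integrable.1 (hlift 1 (hχG.mono_exponent (by norm_num)))
  have hW : IsWeakGradient (openWedge N) u (prodGrad χ m G) := by
    refine hw.smul_of_tsupport_subset (B := Metric.ball p r) ?_ hχ hχb ?_ ?_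
    · rw [inter_comm, ← hloci]
      exact inter_subset_left
    · exact (hu.mono (openWedge_subset_wedge N)).locallyIntegrableOn
        (isOpen_openWedge N).measurableSet
    · exact hG1.locallyIntegrableOn
  have ht : ∀ a ∈ N, ∀ x ∈ wedge N, ⟪a.1, x⟫_ℝ = a.2.2 → ⟪a.1, u x⟫_ℝ = 0 := by
    intro a ha x hx hax
    by_cases hxb : x ∈ Metric.ball p r
    · have hxP := hPb x hx hxb
      simp only [u]
      rw [inner_smul_right, hm.2.2 _ _ (hface a ha) x ⟨hxP.1, hax⟩ hxP.2, mul_zero]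
    · rw [hoff x fun h => hxb (hχb h), inner_zero_right]
  -- The radius is fixed before `φ` and `δ`, so a cover can be chosen first and the errors assigned
  -- afterwards.
  refine ⟨r / 2, by positivity, fun φ hφ hφs δ hδ => ?_⟩
  have hφc : HasCompactSupport φ :=
    (isCompact_closedBall p (r / 2)).of_isClosed_subset (isClosed_tsupport φ) hφs
  have hφb : tsupport φ ⊆ Metric.ball p r :=
    hφs.trans (Metric.closedBall_subset_ball (by linarith))
  obtain ⟨M₀, hM₀⟩ := hφc.exists_bound_of_continuous hφ.continuous
  obtain ⟨M₁, hM₁⟩ := (hφc.fderiv ℝ).exists_bound_of_continuous (hφ.continuous_fderiv (by simp))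
  have hM₀0 : 0 ≤ M₀ := (norm_nonneg _).trans (hM₀ 0)
  have hM₁0 : 0 ≤ M₁ := (norm_nonneg _).trans (hM₁ 0)
  have hVm : MemLp (fun _ : E3 => (1 : ℝ)) 2 μ := memLp_const 1
  let V : ℝ := (eLpNorm (fun _ : E3 => (1 : ℝ)) 2 μ).toReal
  have hV : eLpNorm (fun _ : E3 => (1 : ℝ)) 2 μ = ENNReal.ofReal V :=
    (ENNReal.ofReal_toReal hVm.eLpNorm_ne_top).symm
  have hV0 : 0 ≤ V := ENNReal.toReal_nonneg
  -- `M₀` multiplies the gradient error and `M₁ * V` the uniform error, with `V` the `L²` norm of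
  -- the constant one on the ball; the summand `1` keeps the denominator positive.
  let δ' := δ / (1 + M₀ + M₁ * V)
  have hδ' : 0 < δ' := by positivity
  have hδδ : (1 + M₀ + M₁ * V) * δ' = δ := mul_div_cancel₀ _ (by positivity)
  have hMV : 0 ≤ M₁ * V * δ' := by positivity
  have hM0 : 0 ≤ M₀ * δ' := by positivity
  obtain ⟨v, hv1, hv2, hv3, hv4⟩ := exists_smooth_approx_wedge N hN hu hχc.isCompact hoff hW hG1
    hG2 ht hδ'
  have hχ1 : ∀ x ∈ tsupport φ, (χ : E3 → ℝ) =ᶠ[𝓝 x] 1 := fun x hx =>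
    χ.eventuallyEq_one_of_mem_ball (Metric.closedBall_subset_ball
      (by simp only [χ]; linarith) (hφs hx))
  have hu1 : ∀ x ∈ tsupport φ, u x = m x := fun x hx => by
    simp only [u]
    rw [(hχ1 x hx).self_of_nhds]
    simp
  have hG1' : ∀ x ∈ tsupport φ, prodGrad χ m G x = G x := fun x hx => by
    rw [prodGrad, (hχ1 x hx).fderiv_eq, (hχ1 x hx).self_of_nhds]
    simp
  refine ⟨v, hv1, fun F ν hF x hxF => ?_, fun x hx => ?_, ?_⟩
  · by_cases hxs : x ∈ tsupport φ
    · rw [inner_smul_right, inner_eq_zero_of_isFace hloc (hφb hxs)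
        (fun a ha => hv2 a ha x) hF hxF, mul_zero]
    · rw [image_eq_zero_of_notMem_tsupport hxs, zero_smul, inner_zero_right]
  · by_cases hxs : x ∈ tsupport φ
    · have hxW : x ∈ wedge N := by
        have : x ∈ Pbar ∩ Metric.ball p r := ⟨hx.1, hφb hxs⟩
        rw [hloc] at this
        exact this.1
      have h1 := hv3 x hxW
      rw [hu1 x hxs] at h1
      rw [← smul_sub, norm_smul]
      have := mul_le_mul (hM₀ x) h1 (norm_nonneg _) hM₀0
      nlinarith
    · rw [image_eq_zero_of_notMem_tsupport hxs, zero_smul, zero_smul, sub_zero, norm_zero]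
      exact hδ.le
  · let f : E3 → (E3 →L[ℝ] E3) := fun x => fderiv ℝ (fun y => φ y • v y) x - prodGrad φ m G x
    have hfd : ∀ x, fderiv ℝ (fun y => φ y • v y) x
        = φ x • fderiv ℝ v x + (fderiv ℝ φ x).smulRight (v x) := fun x =>
      fderiv_fun_smul (hφ.differentiable (by simp) x) (hv1.differentiable (by simp) x)
    have hf0 : ∀ x ∉ tsupport φ, f x = 0 := fun x hx => by
      have h0 := notMem_tsupport_iff_eventuallyEq.1 hx
      simp only [f]
      rw [prodGrad_eq_zero hx, hfd, h0.fderiv_eq, h0.self_of_nhds]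
      ext1 w
      simp
    have hE : AEStronglyMeasurable (fun x => fderiv ℝ v x - prodGrad χ m G x) μ :=
      ((hv1.continuous_fderiv (by simp)).aestronglyMeasurable).sub hχG.aestronglyMeasurable
    have hbound : ∀ᵐ x ∂μ, ‖f x‖ ≤
        ((fun x => M₀ * ‖fderiv ℝ v x - prodGrad χ m G x‖) + fun _ => M₁ * δ' : E3 → ℝ) x := by
      refine (ae_restrict_iff' hmeas).2 (Eventually.of_forall fun x hx => ?_)
      simp only [Pi.add_apply]
      by_cases hxs : x ∈ tsupport φ
      · have hxW : x ∈ wedge N := by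
          have : x ∈ Pbar ∩ Metric.ball p r := ⟨interior_subset hx.2, hx.1⟩
          rw [hloc] at this
          exact this.1
        have h1 := hv3 x hxW
        rw [hu1 x hxs] at h1
        rw [hG1' x hxs]
        have e1 : f x = φ x • (fderiv ℝ v x - G x) + (fderiv ℝ φ x).smulRight (v x - m x) := by
          simp only [f]
          rw [hfd, prodGrad]
          ext1 y
          simp only [sub_apply, add_apply, smul_apply, ContinuousLinearMap.smulRight_apply]
          module
        rw [e1]
        refine (norm_add_le _ _).trans ?_
        rw [norm_smul, ContinuousLinearMap.norm_smulRight_apply]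
        exact add_le_add (mul_le_mul_of_nonneg_right (hM₀ x) (norm_nonneg _))
          (mul_le_mul (hM₁ x) h1 (norm_nonneg _) hM₁0)
      · rw [hf0 x hxs, norm_zero]
        positivity
    have hsub : μ ≤ volume.restrict (openWedge N) := by
      rw [hμ]
      exact Measure.restrict_mono inter_subset_right le_rfl
    calc eLpNorm f 2 (volume.restrict (interior Pbar))
        = eLpNorm f 2 μ := by
          simp only [μ]
          rw [← Measure.restrict_restrict hbm]
          exact (eLpNorm_restrict_of_eq_zero hbm fun x hx => hf0 x fun h' => hx (hφb h')).symm
      _ ≤ eLpNorm ((fun x => M₀ * ‖fderiv ℝ v x - prodGrad χ m G x‖) + fun _ => M₁ * δ') 2 μ :=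
          eLpNorm_mono_ae_real hbound
      _ ≤ eLpNorm (fun x => M₀ * ‖fderiv ℝ v x - prodGrad χ m G x‖) 2 μ
          + eLpNorm (fun _ : E3 => M₁ * δ') 2 μ :=
          eLpNorm_add_le (hE.norm.const_mul M₀) aestronglyMeasurable_const (by norm_num)
      _ ≤ ENNReal.ofReal M₀ * ENNReal.ofReal δ' + ENNReal.ofReal (M₁ * δ') * ENNReal.ofReal V := by
          refine add_le_add ?_ ?_
          · refine (eLpNorm_le_mul_eLpNorm_of_ae_le_mul (c := M₀)
              (g := fun x => fderiv ℝ v x - prodGrad χ m G x)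
              (Eventually.of_forall fun x => ?_) 2).trans ?_
            · rw [norm_mul, norm_norm, Real.norm_of_nonneg hM₀0]
            · gcongr
              exact (eLpNorm_mono_measure _ hsub).trans hv4
          · rw [← hV]
            refine eLpNorm_le_mul_eLpNorm_of_ae_le_mul (c := M₁ * δ') (g := fun _ => (1 : ℝ))
              (Eventually.of_forall fun x => ?_) 2
            rw [Real.norm_of_nonneg (by positivity)]
            simp
      _ ≤ ENNReal.ofReal δ := by
          rw [← ENNReal.ofReal_mul hM₀0, ← ENNReal.ofReal_mul (by positivity),
            ← ENNReal.ofReal_add (by positivity) (by positivity)]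
          refine ENNReal.ofReal_le_ofReal ?_
          nlinarith

/-! ### Partition of unity and global approximation -/

theorem sum_mul_prod_one_sub (g : ℕ → ℝ) (n : ℕ) :
    ∑ j ∈ Finset.range n, g j * ∏ k ∈ Finset.range j, (1 - g k)
      = 1 - ∏ k ∈ Finset.range n, (1 - g k) := by
  induction n with
  | zero => simp
  | succ n ih =>
    rw [Finset.sum_range_succ, Finset.prod_range_succ, ih]
    ring

/-- A countable smooth partition of unity on a neighbourhood of a set, subordinate to a family of
closed balls around its points. -/
theorem exists_countable_partition {S : Set E3} (hS : S.Nonempty) {r : E3 → ℝ}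
    (hr : ∀ p ∈ S, 0 < r p) :
    ∃ (c : ℕ → E3) (φ : ℕ → E3 → ℝ) (U : ℕ → Set E3), (∀ k, c k ∈ S) ∧
      (∀ j, ContDiff ℝ ∞ (φ j)) ∧ (∀ j, tsupport (φ j) ⊆ Metric.closedBall (c j) (r (c j))) ∧
      (∀ n, IsOpen (U n)) ∧ Monotone U ∧ S ⊆ ⋃ n, U n ∧
      (∀ n, ∀ x ∈ U n, ∀ j, n < j → φ j x = 0) ∧
      ∀ n, ∀ x ∈ U n, ∑ j ∈ Finset.range (n + 1), φ j x = 1 := by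
  obtain ⟨T, hTS, hTc, hT⟩ := TopologicalSpace.countable_cover_nhdsWithin
    (f := fun p => Metric.ball p (r p / 2)) (s := S)
    (fun p hp => mem_nhdsWithin_of_mem_nhds (Metric.ball_mem_nhds p (half_pos (hr p hp))))
  have hTn : T.Nonempty := by
    obtain ⟨x, hx⟩ := hS
    obtain ⟨p, hp, -⟩ := mem_iUnion₂.1 (hT hx)
    exact ⟨p, hp⟩
  obtain ⟨c, rfl⟩ := hTc.exists_eq_range hTn
  have hc : ∀ k, c k ∈ S := fun k => hTS (mem_range_self k)
  let g : ∀ k, ContDiffBump (c k) := fun k =>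
    ⟨r (c k) / 2, r (c k), half_pos (hr _ (hc k)), half_lt_self (hr _ (hc k))⟩
  -- The `j`-th function is the share of `g j` left over by its predecessors. The sum telescopes,
  -- and as soon as some `g k = 1` all later functions vanish.
  let φ : ℕ → E3 → ℝ := fun j x => g j x * ∏ k ∈ Finset.range j, (1 - g k x)
  have hg1 : ∀ k, ∀ x ∈ Metric.ball (c k) (r (c k) / 2), g k x = 1 := fun k x hx =>
    (g k).one_of_mem_closedBall (Metric.ball_subset_closedBall hx)
  refine ⟨c, φ, Set.accumulate fun k => Metric.ball (c k) (r (c k) / 2), hc, fun j => ?_,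
    fun j => ?_, fun n => ?_, Set.monotone_accumulate, ?_, fun n x hx j hj => ?_, fun n x hx => ?_⟩
  · exact (g j).contDiff.mul (contDiff_prod fun k _ => contDiff_const.sub (g k).contDiff)
  · have h1 : tsupport (φ j) ⊆ tsupport (g j) := tsupport_mul_subset_left
    rwa [(g j).tsupport_eq] at h1
  · rw [Set.accumulate_def]
    exact isOpen_biUnion fun k _ => Metric.isOpen_ball
  · intro x hx
    obtain ⟨p, ⟨k, rfl⟩, hp⟩ := mem_iUnion₂.1 (hT hx)
    exact mem_iUnion.2 ⟨k, Set.subset_accumulate hp⟩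
  · obtain ⟨k, hk, hxk⟩ := Set.mem_accumulate.1 hx
    refine mul_eq_zero_of_right _ (Finset.prod_eq_zero (Finset.mem_range.2 (hk.trans_lt hj)) ?_)
    rw [hg1 k x hxk, sub_self]
  · obtain ⟨k, hk, hxk⟩ := Set.mem_accumulate.1 hx
    simp only [φ]
    rw [sum_mul_prod_one_sub (fun k => g k x),
      Finset.prod_eq_zero (Finset.mem_range.2 (Nat.lt_succ_of_le hk)) (by rw [hg1 k x hxk, sub_self]),
      sub_zero]

/-- A tangent unit field of finite energy is a limit of smooth tangent fields, uniformly and in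
energy. -/
theorem exists_global_approx {Pbar : Set E3} (hP : IsConvexPolyhedron Pbar) {m : E3 → E3}
    (hm : CTangent Pbar m) {G : E3 → (E3 →L[ℝ] E3)} (hw : IsWeakGradient (interior Pbar) m G)
    (hG : MemLp G 2 (volume.restrict (interior Pbar))) {δ : ℝ} (hδ : 0 < δ) :
    ∃ (U : Set E3) (v : E3 → E3), IsOpen U ∧ punctured Pbar ⊆ U ∧ ContDiffOn ℝ ∞ v U ∧
      (∀ F ν, IsFace Pbar F ν → ∀ x ∈ F, x ∉ vertices Pbar → ⟪ν, v x⟫_ℝ = 0) ∧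
      (∀ x ∈ punctured Pbar, ‖v x - m x‖ ≤ δ) ∧
      eLpNorm (fun x => fderiv ℝ v x - G x) 2 (volume.restrict (interior Pbar))
        ≤ ENNReal.ofReal δ := by
  have hne : (punctured Pbar).Nonempty := hP.2.mono (interior_subset_punctured Pbar)
  choose! r hr hloc using fun p (hp : p ∈ punctured Pbar) => exists_local_approx hP hm hw hG hp
  obtain ⟨c, φ, U, hc, hφ, hφs, hU, hUm, hSU, hφ0, hφ1⟩ := exists_countable_partition hne hr
  let d : ℕ → ℝ := fun j => δ * (1 / 2) ^ (j + 1)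
  have hd : ∀ j, 0 < d j := fun j => by positivity
  have hdsum : ∀ n, ∑ j ∈ Finset.range n, d j ≤ δ := fun n => by
    have h1 : ∑ j ∈ Finset.range n, d j = δ * (1 - (1 / 2) ^ n) := by
      induction n with
      | zero => simp
      | succ n ih =>
        rw [Finset.sum_range_succ, ih]
        simp only [d]
        ring
    rw [h1]
    have : (0 : ℝ) < (1 / 2) ^ n := by positivity
    nlinarith
  choose w hw1 hw2 hw3 hw4 using fun j =>
    hloc (c j) (hc j) (φ j) (hφ j) (hφs j) (d j) (hd j)
  let v : E3 → E3 := fun x => ∑ᶠ j, φ j x • w j x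
  have hv : ∀ n, ∀ x ∈ U n, v x = ∑ j ∈ Finset.range (n + 1), φ j x • w j x := fun n x hx => by
    refine finsum_eq_sum_of_support_subset _ fun j hj => ?_
    by_contra hjn
    refine hj ?_
    change φ j x • w j x = 0
    simp only [Finset.coe_range, mem_Iio, not_lt] at hjn
    rw [hφ0 n x hx j hjn, zero_smul]
  have hprod : ∀ j, ContDiff ℝ ∞ fun x => φ j x • w j x := fun j => (hφ j).smul (hw1 j)
  have hvev : ∀ n, ∀ x ∈ U n, v =ᶠ[𝓝 x] fun y => ∑ j ∈ Finset.range (n + 1), φ j y • w j y :=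
    fun n x hx => by
      filter_upwards [(hU n).mem_nhds hx] with y hy using hv n y hy
  have hfv : ∀ n, ∀ x ∈ U n, fderiv ℝ v x
      = ∑ j ∈ Finset.range (n + 1), fderiv ℝ (fun y => φ j y • w j y) x := fun n x hx => by
    rw [(hvev n x hx).fderiv_eq, fderiv_fun_sum fun j _ => (hprod j).differentiable (by simp) x]
  have hfφ : ∀ n, ∀ x ∈ U n, ∑ j ∈ Finset.range (n + 1), fderiv ℝ (φ j) x = 0 := fun n x hx => by
    rw [← fderiv_fun_sum fun j _ => (hφ j).differentiable (by simp) x]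
    have : (fun y => ∑ j ∈ Finset.range (n + 1), φ j y) =ᶠ[𝓝 x] fun _ => (1 : ℝ) := by
      filter_upwards [(hU n).mem_nhds hx] with y hy using hφ1 n y hy
    rw [this.fderiv_eq, fderiv_fun_const]
    rfl
  -- The derivatives of the partition sum to zero, so the terms with `m` in the product gradients
  -- cancel.
  have hGsum : ∀ n, ∀ x ∈ U n, G x = ∑ j ∈ Finset.range (n + 1), prodGrad (φ j) m G x :=
    fun n x hx => by
      have h2 : ∀ y, ∑ j ∈ Finset.range (n + 1), fderiv ℝ (φ j) x y = 0 := fun y => by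
        have := congrArg (fun L : E3 →L[ℝ] ℝ => L y) (hfφ n x hx)
        simpa using this
      ext1 y
      rw [sum_apply]
      simp only [prodGrad, add_apply, smul_apply, ContinuousLinearMap.smulRight_apply]
      rw [Finset.sum_add_distrib, ← Finset.sum_smul, ← Finset.sum_smul, hφ1 n x hx, h2, zero_smul,
        one_smul, add_zero]
  refine ⟨⋃ n, U n, v, isOpen_iUnion hU, hSU, fun x hx => ?_, fun F ν hF x hxF hxv => ?_,
    fun x hx => ?_, ?_⟩
  · obtain ⟨n, hn⟩ := mem_iUnion.1 hx
    exact ((ContDiff.sum fun j _ => hprod j).contDiffAt.congr_of_eventuallyEq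
      (hvev n x hn)).contDiffWithinAt
  · have hxP : x ∈ punctured Pbar := by
      obtain ⟨-, ⟨c, -, rfl⟩, -⟩ := hF
      exact ⟨hxF.1, hxv⟩
    obtain ⟨n, hn⟩ := mem_iUnion.1 (hSU hxP)
    rw [hv n x hn, inner_sum]
    exact Finset.sum_eq_zero fun j _ => hw2 j F ν hF x hxF
  · obtain ⟨n, hn⟩ := mem_iUnion.1 (hSU hx)
    have : v x - m x = ∑ j ∈ Finset.range (n + 1), (φ j x • w j x - φ j x • m x) := by
      rw [Finset.sum_sub_distrib, ← Finset.sum_smul, hφ1 n x hn, one_smul, hv n x hn]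
    rw [this]
    exact (norm_sum_le _ _).trans ((Finset.sum_le_sum fun j _ => hw3 j x hx).trans (hdsum _))
  -- On `U n` only finitely many pieces are present and Minkowski's inequality gives a bound
  -- independent of `n`. Monotone convergence along the increasing sets `U n` then covers the
  -- interior.
  · have hn : ∀ n, eLpNorm (fun x => fderiv ℝ v x - G x) 2
        (volume.restrict (interior Pbar ∩ U n)) ≤ ENNReal.ofReal δ := fun n => by
      let μ := volume.restrict (interior Pbar ∩ U n)
      have hμ : μ ≤ volume.restrict (interior Pbar) :=
        Measure.restrict_mono inter_subset_left le_rfl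
      let f : ℕ → E3 → (E3 →L[ℝ] E3) := fun j x =>
        fderiv ℝ (fun y => φ j y • w j y) x - prodGrad (φ j) m G x
      have hf : ∀ j, AEStronglyMeasurable (f j) μ := fun j => by
        refine (((hprod j).continuous_fderiv (by simp)).aestronglyMeasurable).sub ?_
        refine (aestronglyMeasurable_prodGrad (hφ j) ?_ hG.aestronglyMeasurable).mono_measure hμ
        exact (hm.1.mono (interior_subset_punctured Pbar)).aestronglyMeasurable
          isOpen_interior.measurableSet
      have e1 : eLpNorm (fun x => fderiv ℝ v x - G x) 2 μ
          = eLpNorm (∑ j ∈ Finset.range (n + 1), f j) 2 μ := by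
        refine eLpNorm_congr_ae ?_
        refine (ae_restrict_iff' (isOpen_interior.inter (hU n)).measurableSet).2
          (Eventually.of_forall fun x hx => ?_)
        rw [Finset.sum_apply]
        simp only [f]
        rw [Finset.sum_sub_distrib, ← hfv n x hx.2, ← hGsum n x hx.2]
      change eLpNorm _ 2 μ ≤ _
      rw [e1]
      refine (eLpNorm_sum_le (fun j _ => hf j) (by norm_num)).trans ?_
      refine (Finset.sum_le_sum fun j _ =>
        (eLpNorm_mono_measure (f j) hμ).trans (hw4 j)).trans ?_
      rw [← ENNReal.ofReal_sum_of_nonneg fun j _ => (hd j).le]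
      exact ENNReal.ofReal_le_ofReal (hdsum _)
    have hI : interior Pbar = ⋃ n, interior Pbar ∩ U n := by
      rw [← inter_iUnion]
      exact (inter_eq_left.2 ((interior_subset_punctured Pbar).trans hSU)).symm
    have hmono : Monotone fun n => interior Pbar ∩ U n := fun a b hab =>
      inter_subset_inter_right _ (hUm hab)
    refine (ENNReal.pow_le_pow_left_iff two_ne_zero).1 ?_
    rw [eLpNorm_two_sq]
    conv_lhs => rw [hI]
    rw [setLIntegral_iUnion_of_directed _ hmono.directed_le]
    refine iSup_le fun n => ?_
    rw [← eLpNorm_two_sq]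
    exact pow_le_pow_left' (hn n) 2

/-! ### Energy and orthogonality of the weak gradient -/

theorem aestronglyMeasurable_clm_apply {μ : Measure E3} {G : E3 → (E3 →L[ℝ] E3)}
    (hG : AEStronglyMeasurable G μ) (w : E3) : AEStronglyMeasurable (fun x => G x w) μ :=
  (ContinuousLinearMap.apply ℝ E3 w).continuous.comp_aestronglyMeasurable hG

theorem integrable_of_integrable_sub {F : Type*} [NormedAddCommGroup F] {μ : Measure E3}
    {f g : E3 → F} (h : Integrable (fun x => f x - g x) μ) (hg : Integrable g μ) :
    Integrable f μ := by
  simpa [Pi.add_def] using h.add hg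

theorem norm_clm_le_sum_norm_single (L : E3 →L[ℝ] E3) :
    ‖L‖ ≤ ∑ a : Fin 3, ‖L (EuclideanSpace.single a 1)‖ := by
  refine L.opNorm_le_bound (by positivity) fun w => ?_
  have hw : w = ∑ a : Fin 3, w a • (EuclideanSpace.single a 1 : E3) := by
    have := (EuclideanSpace.basisFun (Fin 3) ℝ).sum_repr w
    simpa using this.symm
  calc ‖L w‖ = ‖∑ a : Fin 3, w a • L (EuclideanSpace.single a 1)‖ := by
        conv_lhs => rw [hw]
        simp only [map_sum, map_smul]
    _ ≤ ∑ a : Fin 3, ‖w a • L (EuclideanSpace.single a 1)‖ := norm_sum_le _ _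
    _ ≤ ∑ a : Fin 3, ‖L (EuclideanSpace.single a 1)‖ * ‖w‖ := by
        refine Finset.sum_le_sum fun a _ => ?_
        rw [norm_smul, mul_comm]
        exact mul_le_mul_of_nonneg_left (PiLp.norm_apply_le w a) (norm_nonneg _)
    _ = _ := by rw [Finset.sum_mul]

theorem exists_memLp_weakGradient {Ω : Set E3} {m : E3 → E3}
    (h : sobolevNorm Ω m < ⊤) :
    ∃ G, IsWeakGradient Ω m G ∧ MemLp G 2 (volume.restrict Ω) := by
  simp only [sobolevNorm, iInf_lt_iff] at h
  obtain ⟨G, hG, hE⟩ := h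
  refine ⟨G, hG, ?_⟩
  have hE' : gradEnergy Ω G < ⊤ := by
    by_contra htop
    rw [not_lt_top_iff.1 htop, ENNReal.top_rpow_of_pos (by norm_num)] at hE
    exact lt_irrefl _ hE
  have hGm : AEStronglyMeasurable G (volume.restrict Ω) :=
    hG.2.1.aestronglyMeasurable
  have h1 : ∀ a : Fin 3, MemLp (fun x => G x (EuclideanSpace.single a 1)) 2
      (volume.restrict Ω) := fun a => by
    refine ⟨aestronglyMeasurable_clm_apply hGm _, ?_⟩
    by_contra htop
    have h2 : eLpNorm (fun x => G x (EuclideanSpace.single a 1)) 2 (volume.restrict Ω) ^ 2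
        ≤ gradEnergy Ω G := by
      rw [eLpNorm_two_sq]
      exact lintegral_mono fun x => Finset.single_le_sum
        (f := fun a : Fin 3 => ‖G x (EuclideanSpace.single a 1)‖ₑ ^ 2)
        (fun _ _ => zero_le) (Finset.mem_univ a)
    rw [not_lt_top_iff.1 htop, ENNReal.top_pow two_ne_zero] at h2
    exact hE'.not_ge h2
  refine MemLp.mono' (g := fun x => ∑ a : Fin 3, ‖G x (EuclideanSpace.single a 1)‖)
    (memLp_finsetSum _ fun a _ => (h1 a).norm) hGm
    (Eventually.of_forall fun x => norm_clm_le_sum_norm_single (G x))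

theorem gradEnergy_rpow_le (Ω : Set E3) (G : E3 → (E3 →L[ℝ] E3)) :
    gradEnergy Ω G ^ (1 / 2 : ℝ) ≤ 2 * eLpNorm G 2 (volume.restrict Ω) := by
  have h1 : gradEnergy Ω G ≤ (2 * eLpNorm G 2 (volume.restrict Ω)) ^ (2 : ℝ) := by
    -- Each of the three columns is at most the operator norm; the factor `2` is a convenient bound
    -- for `√3`.
    rw [ENNReal.rpow_two, mul_pow, eLpNorm_two_sq, gradEnergy,
      ← lintegral_const_mul' _ _ (by norm_num)]
    refine lintegral_mono fun x => ?_
    have h2 : ∀ a : Fin 3, ‖G x (EuclideanSpace.single a 1)‖ₑ ^ 2 ≤ ‖G x‖ₑ ^ 2 := fun a => by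
      refine pow_le_pow_left' (enorm_le_iff_norm_le.2 ?_) 2
      refine ((G x).le_opNorm _).trans ?_
      simp
    refine (Finset.sum_le_sum fun a _ => h2 a).trans ?_
    rw [Finset.sum_const, Finset.card_univ, Fintype.card_fin, nsmul_eq_mul]
    gcongr
    norm_num
  calc gradEnergy Ω G ^ (1 / 2 : ℝ)
      ≤ ((2 * eLpNorm G 2 (volume.restrict Ω)) ^ (2 : ℝ)) ^ (1 / 2 : ℝ) :=
        ENNReal.rpow_le_rpow h1 (by norm_num)
    _ = _ := by rw [← ENNReal.rpow_mul]; norm_num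

/-- The weak gradient of a unit field which is a limit of smooth fields takes values orthogonal to
the field. -/
theorem ae_inner_weakGradient_eq_zero {Ω : Set E3} (hΩ : IsOpen Ω) (hfin : volume Ω ≠ ⊤)
    {m : E3 → E3} (hmc : ContinuousOn m Ω) (hm1 : ∀ x ∈ Ω, ‖m x‖ = 1)
    {G : E3 → (E3 →L[ℝ] E3)} (hG : MemLp G 2 (volume.restrict Ω))
    (happ : ∀ δ : ℝ, 0 < δ → ∃ v : E3 → E3, ContDiffOn ℝ 1 v Ω ∧ (∀ x ∈ Ω, ‖v x - m x‖ ≤ δ) ∧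
      eLpNorm (fun x => fderiv ℝ v x - G x) 2 (volume.restrict Ω) ≤ ENNReal.ofReal δ) :
    ∀ᵐ x ∂volume.restrict Ω, ∀ w, ⟪m x, G x w⟫_ℝ = 0 := by
  let μ : Measure E3 := volume.restrict Ω
  have hμf : IsFiniteMeasure μ := ⟨by
    simp only [μ]
    rw [Measure.restrict_apply_univ]
    exact hfin.lt_top⟩
  have hΩm := hΩ.measurableSet
  have hG1 : Integrable G μ := memLp_one_iff_integrable.1 (hG.mono_exponent (by norm_num))
  have hmm : AEStronglyMeasurable m μ := hmc.aestronglyMeasurable hΩm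
  have hmG : ∀ w, Integrable (fun x => ⟪m x, G x w⟫_ℝ) μ := fun w => by
    refine (hG1.norm.mul_const ‖w‖).mono'
      (hmm.inner (aestronglyMeasurable_clm_apply hG1.aestronglyMeasurable w)) ?_
    refine (ae_restrict_iff' hΩm).2 (Eventually.of_forall fun x hx => ?_)
    refine (norm_inner_le_norm _ _).trans ?_
    rw [hm1 x hx, one_mul]
    exact (G x).le_opNorm w
  -- It suffices that the pairing with every test function vanishes. It is compared with the pairing
  -- of `⟪v, ∂_w v⟫` for an approximation `v`, and both the difference and the latter are of order
  -- `δ`.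
  have key : ∀ w : E3, ∀ᵐ x ∂μ, ⟪m x, G x w⟫_ℝ = 0 := by
    intro w
    refine (ae_restrict_iff' hΩm).2 (hΩ.ae_eq_zero_of_integral_contDiff_smul_eq_zero
      (IntegrableOn.locallyIntegrableOn (hmG w)) fun φ hφ hφc hφs => ?_)
    obtain ⟨B, hB⟩ := hφc.exists_bound_of_continuous hφ.continuous
    obtain ⟨B', hB'⟩ := (hasCompactSupport_fderiv_apply hφc w).exists_bound_of_continuous
      ((hφ.continuous_fderiv (by simp)).clm_apply continuous_const)
    have hB0 : 0 ≤ B := (norm_nonneg _).trans (hB 0)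
    have hB'0 : 0 ≤ B' := (norm_nonneg _).trans (hB' 0)
    rw [← setIntegral_eq_of_tsupport_subset (φ := φ) hφs
      (fun x hx => by simp only [hx, zero_smul])]
    let I : ℝ := ∫ x, ‖G x‖ ∂μ
    let M : ℝ := μ.real univ
    have hI0 : 0 ≤ I := integral_nonneg fun x => norm_nonneg _
    have hM0 : 0 ≤ M := measureReal_nonneg
    let C : ℝ := B * ‖w‖ * (I + 2 * Real.sqrt M) + 2 * B' * M
    have hC0 : 0 ≤ C := by positivity
    have main : ∀ δ : ℝ, 0 < δ → δ ≤ 1 → ‖∫ x, φ x • ⟪m x, G x w⟫_ℝ ∂μ‖ ≤ C * δ := by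
      intro δ hδ hδ1
      obtain ⟨v, hv, hvm, hvG⟩ := happ δ hδ
      have hvc := hv.continuousOn
      have hDc : ContinuousOn (fderiv ℝ v) Ω := hv.continuousOn_fderiv_of_isOpen hΩ le_rfl
      have hv2 : ∀ x ∈ Ω, ‖v x‖ ≤ 2 := fun x hx => by
        have h1 := norm_sub_norm_le (v x) (m x)
        have h2 := hvm x hx
        rw [hm1 x hx] at h1
        linarith
      have hDm : AEStronglyMeasurable (fderiv ℝ v) μ := hDc.aestronglyMeasurable hΩm
      have hD2 : MemLp (fun x => fderiv ℝ v x - G x) 2 μ :=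
        ⟨hDm.sub hG.aestronglyMeasurable, hvG.trans_lt ENNReal.ofReal_lt_top⟩
      have hD1 : Integrable (fun x => fderiv ℝ v x - G x) μ :=
        memLp_one_iff_integrable.1 (hD2.mono_exponent (by norm_num))
      have hDi : Integrable (fderiv ℝ v) μ := integrable_of_integrable_sub hD1 hG1
      have hDle : ∫ x, ‖fderiv ℝ v x - G x‖ ∂μ ≤ δ * Real.sqrt M := by
        rw [integral_norm_eq_lintegral_enorm hD1.aestronglyMeasurable,
          ← eLpNorm_one_eq_lintegral_enorm]
        have h1 := eLpNorm_le_eLpNorm_mul_rpow_measure_univ (μ := μ) (p := 1) (q := 2)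
          (by norm_num) hD1.aestronglyMeasurable
        refine ENNReal.toReal_le_of_le_ofReal (by positivity) (h1.trans ?_)
        rw [ENNReal.ofReal_mul hδ.le]
        refine mul_le_mul' hvG ?_
        rw [Real.sqrt_eq_rpow, ← ENNReal.ofReal_rpow_of_nonneg hM0 (by norm_num)]
        simp only [M]
        rw [ofReal_measureReal]
        norm_num
      have hvD : Integrable (fun x => ⟪v x, fderiv ℝ v x w⟫_ℝ) μ := by
        refine (hDi.norm.mul_const (2 * ‖w‖)).mono' ((hvc.aestronglyMeasurable hΩm).inner
          (aestronglyMeasurable_clm_apply hDm w)) ?_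
        refine (ae_restrict_iff' hΩm).2 (Eventually.of_forall fun x hx => ?_)
        refine (norm_inner_le_norm _ _).trans ?_
        have h1 := (fderiv ℝ v x).le_opNorm w
        have h2 := mul_le_mul (hv2 x hx) h1 (norm_nonneg _) zero_le_two
        linarith
      have hφB : ∀ {f : E3 → ℝ}, Integrable f μ → Integrable (fun x => φ x • f x) μ :=
        fun hf => hf.bdd_smul B hφ.continuous.aestronglyMeasurable (Eventually.of_forall hB)
      have e1 : ∫ x, φ x • ⟪m x, G x w⟫_ℝ ∂μ
          = (∫ x, φ x • (⟪m x, G x w⟫_ℝ - ⟪v x, fderiv ℝ v x w⟫_ℝ) ∂μ)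
            + ∫ x, φ x • ⟪v x, fderiv ℝ v x w⟫_ℝ ∂μ := by
        simp only [smul_sub]
        rw [integral_sub (hφB (hmG w)) (hφB hvD)]
        ring
      have b1 : ‖∫ x, φ x • (⟪m x, G x w⟫_ℝ - ⟪v x, fderiv ℝ v x w⟫_ℝ) ∂μ‖
          ≤ B * ‖w‖ * (I + 2 * Real.sqrt M) * δ := by
        have i1 : Integrable (fun x => B * ‖w‖ * (δ * ‖G x‖ + 2 * ‖fderiv ℝ v x - G x‖)) μ :=
          ((hG1.norm.const_mul δ).add (hD1.norm.const_mul 2)).const_mul _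
        refine (norm_integral_le_of_norm_le i1 ?_).trans ?_
        · refine (ae_restrict_iff' hΩm).2 (Eventually.of_forall fun x hx => ?_)
          have e2 : ⟪m x, G x w⟫_ℝ - ⟪v x, fderiv ℝ v x w⟫_ℝ
              = - ⟪v x - m x, G x w⟫_ℝ - ⟪v x, (fderiv ℝ v x - G x) w⟫_ℝ := by
            rw [sub_apply, inner_sub_left, inner_sub_right]
            ring
          rw [e2, norm_smul]
          have c1 := norm_inner_le_norm (𝕜 := ℝ) (v x - m x) (G x w)
          have c2 := norm_inner_le_norm (𝕜 := ℝ) (v x) ((fderiv ℝ v x - G x) w)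
          have c3 := mul_le_mul (hvm x hx) ((G x).le_opNorm w) (norm_nonneg _) hδ.le
          have c4 := mul_le_mul (hv2 x hx) ((fderiv ℝ v x - G x).le_opNorm w) (norm_nonneg _)
            zero_le_two
          have c5 : ‖-⟪v x - m x, G x w⟫_ℝ - ⟪v x, (fderiv ℝ v x - G x) w⟫_ℝ‖
              ≤ ‖w‖ * (δ * ‖G x‖ + 2 * ‖fderiv ℝ v x - G x‖) := by
            refine (norm_sub_le _ _).trans ?_
            rw [norm_neg]
            linarith
          have := mul_le_mul (hB x) c5 (norm_nonneg _) hB0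
          linarith
        · rw [integral_const_mul, integral_add (hG1.norm.const_mul δ) (hD1.norm.const_mul 2),
            integral_const_mul, integral_const_mul]
          have := mul_le_mul_of_nonneg_left hDle (by positivity : 0 ≤ B * ‖w‖ * 2)
          simp only [I]
          linarith
      -- Here `⟪v, ∂_w v⟫` is half the derivative of `‖v‖ ^ 2`. After integration by parts the
      -- constant one may be subtracted, since the derivative of `φ` has zero integral, and `|‖v‖ ^
      -- 2 - 1| ≤ 3 * δ` from `‖v‖ ≤ 2`.
      have b2 : ‖∫ x, φ x • ⟪v x, fderiv ℝ v x w⟫_ℝ ∂μ‖ ≤ 2 * B' * M * δ := by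
        have hsq : ContDiffOn ℝ 1 (fun x => ⟪v x, v x⟫_ℝ) Ω := hv.inner ℝ hv
        have p1 := integral_fderiv_smul_eq_neg hΩ hsq hφ hφc hφs w
        have p2 : ∫ x in Ω, fderiv ℝ φ x w = 0 := by
          have h1 := integral_fderiv_apply_eq_zero (hφ.of_le (by simp)) hφc w
          have h2 := setIntegral_eq_of_tsupport_subset (φ := fun x => fderiv ℝ φ x w)
            (f := fun x => fderiv ℝ φ x w)
            ((tsupport_fderiv_apply_subset φ w).trans hφs) (fun x hx => hx)
          rw [h2, h1]
        have i1 : Integrable (fun x => fderiv ℝ φ x w) μ :=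
          (memLp_one_iff_integrable.1 (MemLp.of_bound (p := 1)
            ((hφ.continuous_fderiv (by simp)).clm_apply continuous_const).aestronglyMeasurable
            B' (Eventually.of_forall hB')))
        have i2 : Integrable (fun x => fderiv ℝ φ x w • ⟪v x, v x⟫_ℝ) μ := by
          refine i1.smul_bdd 4 ((hvc.aestronglyMeasurable hΩm).inner
            (hvc.aestronglyMeasurable hΩm)) ?_
          refine (ae_restrict_iff' hΩm).2 (Eventually.of_forall fun x hx => ?_)
          rw [real_inner_self_eq_norm_sq, norm_pow, norm_norm]
          have := hv2 x hx
          nlinarith [norm_nonneg (v x)]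
        have p3 : ∀ x ∈ Ω, fderiv ℝ (fun x => ⟪v x, v x⟫_ℝ) x w = 2 * ⟪v x, fderiv ℝ v x w⟫_ℝ := by
          intro x hx
          have hd := (hv.differentiableOn (by norm_num)).differentiableAt (hΩ.mem_nhds hx)
          rw [fderiv_inner_apply ℝ hd hd, real_inner_comm]
          ring
        have p4 : ∫ x, φ x • ⟪v x, fderiv ℝ v x w⟫_ℝ ∂μ
            = - (1 / 2) * ∫ x, (fderiv ℝ φ x w) * (⟪v x, v x⟫_ℝ - 1) ∂μ := by
          have q1 : ∫ x in Ω, φ x • fderiv ℝ (fun x => ⟪v x, v x⟫_ℝ) x w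
              = 2 * ∫ x, φ x • ⟪v x, fderiv ℝ v x w⟫_ℝ ∂μ := by
            rw [← integral_const_mul]
            refine setIntegral_congr_fun hΩm fun x hx => ?_
            simp only [p3 x hx, smul_eq_mul]
            ring
          have q2 : ∫ x, (fderiv ℝ φ x w) * (⟪v x, v x⟫_ℝ - 1) ∂μ
              = (∫ x in Ω, fderiv ℝ φ x w • ⟪v x, v x⟫_ℝ) - ∫ x in Ω, fderiv ℝ φ x w := by
            rw [← integral_sub i2 i1]
            refine integral_congr_ae (Eventually.of_forall fun x => ?_)
            simp only [smul_eq_mul]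
            ring
          rw [q2, p2, p1, q1]
          ring
        rw [p4, norm_mul]
        have : ‖∫ x, (fderiv ℝ φ x w) * (⟪v x, v x⟫_ℝ - 1) ∂μ‖ ≤ B' * (3 * δ) * M := by
          refine norm_integral_le_of_norm_le_const ?_
          refine (ae_restrict_iff' hΩm).2 (Eventually.of_forall fun x hx => ?_)
          rw [norm_mul]
          refine mul_le_mul (hB' x) ?_ (norm_nonneg _) hB'0
          have h1 := (abs_norm_sub_norm_le (v x) (m x)).trans (hvm x hx)
          rw [hm1 x hx] at h1
          rw [real_inner_self_eq_norm_sq,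
            show ‖v x‖ ^ 2 - 1 = (‖v x‖ - 1) * (‖v x‖ + 1) by ring, norm_mul, mul_comm]
          refine mul_le_mul ?_ h1 (norm_nonneg _) (by norm_num)
          rw [Real.norm_of_nonneg (by positivity)]
          linarith [hv2 x hx]
        have h2 : ‖(-(1 / 2) : ℝ)‖ = 1 / 2 := by norm_num
        rw [h2]
        have : 0 ≤ B' * M * δ := by positivity
        linarith
      rw [e1]
      refine (norm_add_le _ _).trans ((add_le_add b1 b2).trans (le_of_eq ?_))
      simp only [C]
      ring
    by_contra hne
    have hpos : 0 < ‖∫ x, φ x • ⟪m x, G x w⟫_ℝ ∂μ‖ := norm_pos_iff.2 hne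
    set J := ‖∫ x, φ x • ⟪m x, G x w⟫_ℝ ∂μ‖
    have h1 := main (min 1 (J / (2 * (C + 1)))) (by positivity) (min_le_left _ _)
    have h2 : C * min 1 (J / (2 * (C + 1))) ≤ C * (J / (2 * (C + 1))) :=
      mul_le_mul_of_nonneg_left (min_le_right _ _) hC0
    have h3 : (C + 1) * (J / (2 * (C + 1))) = J / 2 := by field_simp
    have h4 : 0 < J / (2 * (C + 1)) := by positivity
    nlinarith
  have hall : ∀ᵐ x ∂μ, ∀ a : Fin 3, ⟪m x, G x (EuclideanSpace.single a 1)⟫_ℝ = 0 :=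
    ae_all_iff.2 fun a => key _
  filter_upwards [hall] with x hx w
  have hw : w = ∑ a : Fin 3, w a • (EuclideanSpace.single a 1 : E3) := by
    have := (EuclideanSpace.basisFun (Fin 3) ℝ).sum_repr w
    simpa using this.symm
  rw [hw, map_sum, inner_sum]
  refine Finset.sum_eq_zero fun a _ => ?_
  rw [map_smul, inner_smul_right, hx a, mul_zero]

/-! ### Normalization and homotopy -/

theorem norm_inv_norm_smul {v : E3} (hv : v ≠ 0) : ‖‖v‖⁻¹ • v‖ = 1 := by
  rw [norm_smul, norm_inv, norm_norm, inv_mul_cancel₀ (norm_ne_zero_iff.2 hv)]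

/-- Normalizing moves `v` by `|‖v‖ - 1|`, which is at most `‖v - y‖` because `y` is a unit vector.
-/
theorem norm_inv_norm_smul_sub_le {v y : E3} {δ : ℝ} (hy : ‖y‖ = 1) (h : ‖v - y‖ ≤ δ)
    (hv : v ≠ 0) : ‖‖v‖⁻¹ • v - y‖ ≤ 2 * δ := by
  have h1 := (abs_norm_sub_norm_le v y).trans h
  have hn : ‖v‖ ≠ 0 := norm_ne_zero_iff.2 hv
  have h2 : ‖‖v‖⁻¹ • v - v‖ ≤ δ := by
    have : ‖v‖⁻¹ • v - v = (‖v‖⁻¹ - 1) • v := by module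
    rw [this, norm_smul, Real.norm_eq_abs, ← abs_of_nonneg (norm_nonneg v), ← abs_mul, sub_mul,
      abs_of_nonneg (norm_nonneg v), inv_mul_cancel₀ hn, one_mul, ← hy, abs_sub_comm]
    exact h1
  calc ‖‖v‖⁻¹ • v - y‖ = ‖(‖v‖⁻¹ • v - v) + (v - y)‖ := by congr 1; abel
    _ ≤ _ := (norm_add_le _ _).trans (by linarith)

/-- With `n = v / ‖v‖`, the derivative of `v` splits into `‖v‖` times that of `n`, orthogonal to
`n`, and a multiple of `n`. Since `g w` is orthogonal to `y` and `n` is `2 * δ`-close to `y`, the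
component of `g w` along `n` is small, and only the orthogonal parts need comparison. -/
theorem norm_fderiv_normalize_sub_le {v : E3 → E3} {x y : E3} {g : E3 →L[ℝ] E3} {δ : ℝ}
    (hv : DifferentiableAt ℝ v x) (hy : ‖y‖ = 1) (hδ : δ ≤ 1 / 4) (h : ‖v x - y‖ ≤ δ)
    (hg : ∀ w, ⟪y, g w⟫_ℝ = 0) :
    ‖fderiv ℝ (fun z => ‖v z‖⁻¹ • v z) x - g‖ ≤ 2 * ‖fderiv ℝ v x - g‖ + 4 * δ * ‖g‖ := by
  have hδ0 : 0 ≤ δ := (norm_nonneg _).trans h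
  have h1 := (abs_norm_sub_norm_le (v x) y).trans h
  rw [hy] at h1
  obtain ⟨h1a, h1b⟩ := abs_le.1 h1
  have hs0 : 0 < ‖v x‖ := by linarith
  have hvx : v x ≠ 0 := norm_pos_iff.1 hs0
  have hsd : DifferentiableAt ℝ (fun z => ‖v z‖) x := hv.norm ℝ hvx
  let n : E3 → E3 := fun z => ‖v z‖⁻¹ • v z
  have hnd : DifferentiableAt ℝ n x := (hsd.inv hs0.ne').smul hv
  have hev : ∀ᶠ z in 𝓝 x, v z ≠ 0 := hv.continuousAt.eventually_ne hvx
  have hvn : v =ᶠ[𝓝 x] fun z => ‖v z‖ • n z := by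
    filter_upwards [hev] with z hz
    simp only [n]
    rw [smul_inv_smul₀ (norm_ne_zero_iff.2 hz)]
  have hnn : (fun z => ⟪n z, n z⟫_ℝ) =ᶠ[𝓝 x] fun _ => 1 := by
    filter_upwards [hev] with z hz
    have : ‖n z‖ = 1 := norm_inv_norm_smul hz
    rw [real_inner_self_eq_norm_sq, this, one_pow]
  have hn1 : ‖n x‖ = 1 := norm_inv_norm_smul hvx
  have hny : ‖n x - y‖ ≤ 2 * δ := norm_inv_norm_smul_sub_le hy h hvx
  have horth : ∀ w, ⟪n x, fderiv ℝ n x w⟫_ℝ = 0 := fun w => by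
    have e1 := fderiv_inner_apply ℝ hnd hnd w
    rw [hnn.fderiv_eq, fderiv_fun_const, real_inner_comm (n x)] at e1
    simp only [Pi.zero_apply, zero_apply] at e1
    linarith
  have hDv : ∀ w, fderiv ℝ v x w
      = ‖v x‖ • fderiv ℝ n x w + (fderiv ℝ (fun z => ‖v z‖) x w) • n x := fun w => by
    conv_lhs => rw [hvn.fderiv_eq, fderiv_fun_smul hsd hnd]
    simp
  change ‖fderiv ℝ n x - g‖ ≤ _
  clear_value n
  refine ContinuousLinearMap.opNorm_le_bound _ (by positivity) fun w => ?_
  set A := fderiv ℝ n x w with hA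
  set c := fderiv ℝ (fun z => ‖v z‖) x w
  set s := ‖v x‖
  have hAo : ⟪n x, A⟫_ℝ = 0 := horth w
  have hE : fderiv ℝ v x w - g w = (s • A - (g w - ⟪n x, g w⟫_ℝ • n x))
      + (c - ⟪n x, g w⟫_ℝ) • n x := by
    rw [hDv w]
    module
  have hgn : ‖⟪n x, g w⟫_ℝ‖ ≤ 2 * δ * ‖g w‖ := by
    have : ⟪n x, g w⟫_ℝ = ⟪n x - y, g w⟫_ℝ := by rw [inner_sub_left, hg w, sub_zero]
    rw [this]
    exact (norm_inner_le_norm _ _).trans (mul_le_mul_of_nonneg_right hny (norm_nonneg _))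
  -- Pythagoras: the discarded component along `n x` is orthogonal to the one kept.
  have hproj : ‖s • A - (g w - ⟪n x, g w⟫_ℝ • n x)‖ ≤ ‖fderiv ℝ v x w - g w‖ := by
    have ho : ⟪s • A - (g w - ⟪n x, g w⟫_ℝ • n x), (c - ⟪n x, g w⟫_ℝ) • n x⟫_ℝ = 0 := by
      rw [inner_smul_right, real_inner_comm (n x) (_ - _), inner_sub_right, inner_sub_right, inner_smul_right,
        inner_smul_right, hAo, real_inner_self_eq_norm_sq, hn1]
      ring
    have := norm_add_sq_eq_norm_sq_add_norm_sq_of_inner_eq_zero _ _ ho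
    rw [← hE] at this
    nlinarith [norm_nonneg (fderiv ℝ v x w - g w),
      norm_nonneg (s • A - (g w - ⟪n x, g w⟫_ℝ • n x)), norm_nonneg ((c - ⟪n x, g w⟫_ℝ) • n x)]
  have hsplit : s • (A - g w) = (s • A - (g w - ⟪n x, g w⟫_ℝ • n x)) + (1 - s) • g w
      - ⟪n x, g w⟫_ℝ • n x := by module
  have hfin : s * ‖A - g w‖ ≤ ‖fderiv ℝ v x w - g w‖ + 3 * δ * ‖g w‖ := by
    have hsn : s * ‖A - g w‖ = ‖s • (A - g w)‖ := by rw [norm_smul, Real.norm_of_nonneg hs0.le]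
    rw [hsn, hsplit]
    refine (norm_sub_le _ _).trans ?_
    have k1 := norm_add_le (s • A - (g w - ⟪n x, g w⟫_ℝ • n x)) ((1 - s) • g w)
    have k2 : ‖(1 - s) • g w‖ ≤ δ * ‖g w‖ := by
      rw [norm_smul]
      refine mul_le_mul_of_nonneg_right ?_ (norm_nonneg _)
      rw [Real.norm_eq_abs, abs_sub_comm]
      exact h1
    have k3 : ‖⟪n x, g w⟫_ℝ • n x‖ ≤ 2 * δ * ‖g w‖ := by rwa [norm_smul, hn1, mul_one]
    linarith
  have hop1 : ‖fderiv ℝ v x w - g w‖ ≤ ‖fderiv ℝ v x - g‖ * ‖w‖ :=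
    (fderiv ℝ v x - g).le_opNorm w
  have hop2 := mul_le_mul_of_nonneg_left (g.le_opNorm w) hδ0
  have hres : ‖(fderiv ℝ n x - g) w‖ = ‖A - g w‖ := rfl
  rw [hres]
  -- Dividing `3 * δ` by `3 / 4` yields the constant `4 * δ`, and `4 / 3 ≤ 2` covers the other term.
  have hs34 : 3 / 4 ≤ s := by linarith
  have := mul_le_mul_of_nonneg_right hs34 (norm_nonneg (A - g w))
  have := norm_nonneg (fderiv ℝ v x w - g w)
  have := norm_nonneg (A - g w)
  nlinarith

/-- A zero on the segment would give `m x = (1 - t) • (m x - n x)`, impossible for a unit vector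
when the distance is below one. Tangency is a linear condition, so it survives interpolation and
rescaling. -/
theorem tangentHomotopic_of_norm_sub_lt_one {Pbar : Set E3} {n m : E3 → E3} (hn : CTangent Pbar n)
    (hm : CTangent Pbar m) (h : ∀ x ∈ punctured Pbar, ‖n x - m x‖ < 1) :
    TangentHomotopic Pbar n m := by
  let K : E3 × ℝ → E3 := fun z => (1 - z.2) • n z.1 + z.2 • m z.1
  have hK0 : ∀ x ∈ punctured Pbar, ∀ t ∈ Icc (0 : ℝ) 1, K (x, t) ≠ 0 := by
    intro x hx t ht h0
    have e : m x = (1 - t) • (m x - n x) := by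
      rw [← sub_eq_zero, ← h0]
      simp only [K]
      module
    have h1 := hm.norm_eq_one hx
    rw [e, norm_smul, norm_sub_rev (m x), Real.norm_of_nonneg (by linarith [ht.2])] at h1
    have h2 := h x hx
    nlinarith [ht.1, ht.2, norm_nonneg (n x - m x)]
  have hfst : MapsTo Prod.fst (punctured Pbar ×ˢ Icc (0 : ℝ) 1) (punctured Pbar) :=
    fun z hz => hz.1
  have hKc : ContinuousOn K (punctured Pbar ×ˢ Icc (0 : ℝ) 1) :=
    ((continuous_const.sub continuous_snd).continuousOn.smul
      (hn.1.comp continuous_fst.continuousOn hfst)).add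
      (continuous_snd.continuousOn.smul (hm.1.comp continuous_fst.continuousOn hfst))
  have hHc : ContinuousOn (fun z => ‖K z‖⁻¹ • K z) (punctured Pbar ×ˢ Icc (0 : ℝ) 1) :=
    (hKc.norm.inv₀ fun z hz => norm_ne_zero_iff.2 (hK0 z.1 hz.1 z.2 hz.2)).smul hKc
  refine ⟨fun z => ‖K z‖⁻¹ • K z, hHc, fun t ht => ⟨?_, fun x hx => ?_, fun F ν hF x hxF hxv => ?_⟩,
    fun x hx => ?_, fun x hx => ?_⟩
  · exact hHc.comp (by fun_prop : Continuous fun x : E3 => (x, t)).continuousOn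
      fun x hx => ⟨hx, ht⟩
  · exact norm_inv_norm_smul (hK0 x hx t ht)
  · simp only [K]
    rw [inner_smul_right, inner_add_right, inner_smul_right, inner_smul_right,
      hn.2.2 F ν hF x hxF hxv, hm.2.2 F ν hF x hxF hxv]
    ring
  · simp [K, hn.norm_eq_one hx]
  · simp [K, hm.norm_eq_one hx]

theorem SmoothTangent.cTangent {Pbar : Set E3} {n : E3 → E3} (hn : SmoothTangent Pbar n) :
    CTangent Pbar n := ⟨hn.1.continuousOn, hn.2⟩

theorem volume_interior_ne_top {Pbar : Set E3} (hP : IsConvexPolyhedron Pbar) :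
    volume (interior Pbar) ≠ ⊤ := by
  obtain ⟨⟨s, hs, rfl⟩, -⟩ := hP
  exact (((isBounded_convexHull.2 hs.isBounded).subset interior_subset).measure_lt_top).ne

end PolyField

/-! ### Conclusion -/

theorem theorem2 (Pbar : Set PolyField.E3) (hP : PolyField.IsConvexPolyhedron Pbar)
    (m : PolyField.E3 → PolyField.E3) (hm : PolyField.CTangent Pbar m)
    (hfin : PolyField.sobolevNorm (interior Pbar) m < ⊤)
    (ε : ℝ) (hε : 0 < ε) :
    ∃ n : PolyField.E3 → PolyField.E3,
      PolyField.SmoothTangent Pbar n ∧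
      PolyField.TangentHomotopic Pbar n m ∧
      PolyField.sobolevNorm (interior Pbar) (fun x => m x - n x) ≤ ENNReal.ofReal ε := by
  open PolyField MeasureTheory Set Filter in
  obtain ⟨G, hw, hG⟩ := exists_memLp_weakGradient hfin
  have hint := interior_subset_punctured Pbar
  have hmo : ∀ᵐ x ∂volume.restrict (interior Pbar), ∀ w, ⟪m x, G x w⟫_ℝ = 0 := by
    refine ae_inner_weakGradient_eq_zero isOpen_interior (volume_interior_ne_top hP)
      (hm.1.mono hint) (fun x hx => hm.norm_eq_one (hint hx)) hG fun δ hδ => ?_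
    obtain ⟨U, v, -, hPU, hv, -, hvm, hvG⟩ := exists_global_approx hP hm hw hG hδ
    exact ⟨v, (hv.mono (hint.trans hPU)).of_le (by simp), fun x hx => hvm x (hint hx), hvG⟩
  let K : ℝ := (eLpNorm G 2 (volume.restrict (interior Pbar))).toReal
  have hK : eLpNorm G 2 (volume.restrict (interior Pbar)) = ENNReal.ofReal K :=
    (ENNReal.ofReal_toReal hG.eLpNorm_ne_top).symm
  have hK0 : 0 ≤ K := ENNReal.toReal_nonneg
  -- The bound `1 / 4` is what the normalization estimate asks for, and it also keeps `v` away from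
  -- zero and the unit fields within `1 / 2`. The other bound absorbs `2 * (2 * δ + 4 * δ * K)`,
  -- whose outer factor comes from `gradEnergy_rpow_le`.
  let δ : ℝ := min (1 / 4) (ε / (4 + 8 * K))
  have hδ : 0 < δ := lt_min (by norm_num) (by positivity)
  have hδ4 : δ ≤ 1 / 4 := min_le_left _ _
  have hδε : 2 * (2 * δ + 4 * δ * K) ≤ ε := by
    have h1 : (4 + 8 * K) * δ ≤ (4 + 8 * K) * (ε / (4 + 8 * K)) :=
      mul_le_mul_of_nonneg_left (min_le_right _ _) (by positivity)
    rw [mul_div_cancel₀ _ (by positivity)] at h1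
    linarith
  obtain ⟨U, v, hU, hPU, hv, hvt, hvm, hvG⟩ := exists_global_approx hP hm hw hG hδ
  have hv0 : ∀ x ∈ punctured Pbar, v x ≠ 0 := fun x hx h0 => by
    have h1 := hvm x hx
    rw [h0, zero_sub, norm_neg, hm.norm_eq_one hx] at h1
    linarith
  let n : E3 → E3 := fun x => ‖v x‖⁻¹ • v x
  have hvP : ContDiffOn ℝ ∞ v (punctured Pbar) := hv.mono hPU
  have hn : SmoothTangent Pbar n := by
    refine ⟨((hvP.norm ℝ hv0).inv fun x hx => norm_ne_zero_iff.2 (hv0 x hx)).smul hvP,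
      fun x hx => norm_inv_norm_smul (hv0 x hx), fun F ν hF x hxF hxv => ?_⟩
    simp only [n]
    rw [inner_smul_right, hvt F ν hF x hxF hxv, mul_zero]
  refine ⟨n, hn, tangentHomotopic_of_norm_sub_lt_one hn.cTangent hm fun x hx => ?_, ?_⟩
  · have := norm_inv_norm_smul_sub_le (hm.norm_eq_one hx) (hvm x hx) (hv0 x hx)
    simp only [n]
    linarith
  · have hni : ContDiffOn ℝ 1 n (interior Pbar) := (hn.1.mono hint).of_le (by simp)
    have hwn := isWeakGradient_fderiv isOpen_interior hni
    refine (iInf₂_le _ (hw.sub hwn)).trans ((gradEnergy_rpow_le _ _).trans ?_)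
    have hGm := hG.aestronglyMeasurable
    have hvD : AEStronglyMeasurable (fderiv ℝ v) (volume.restrict (interior Pbar)) :=
      ((hv.mono (hint.trans hPU)).continuousOn_fderiv_of_isOpen isOpen_interior
        (by simp)).aestronglyMeasurable isOpen_interior.measurableSet
    have hbound : ∀ᵐ x ∂volume.restrict (interior Pbar), ‖G x - fderiv ℝ n x‖
        ≤ ((fun x => 2 * ‖fderiv ℝ v x - G x‖) + fun x => 4 * δ * ‖G x‖ : E3 → ℝ) x := by
      filter_upwards [hmo, ae_restrict_mem isOpen_interior.measurableSet] with x hx hxi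
      rw [norm_sub_rev]
      refine norm_fderiv_normalize_sub_le ?_ (hm.norm_eq_one (hint hxi)) hδ4 (hvm x (hint hxi)) hx
      exact (hv.contDiffAt (hU.mem_nhds (hPU (hint hxi)))).differentiableAt (by simp)
    have h1 : eLpNorm (fun x => G x - fderiv ℝ n x) 2 (volume.restrict (interior Pbar))
        ≤ ENNReal.ofReal 2 * ENNReal.ofReal δ + ENNReal.ofReal (4 * δ) * ENNReal.ofReal K := by
      refine (eLpNorm_mono_ae_real hbound).trans ((eLpNorm_add_le
        ((hvD.sub hGm).norm.const_mul 2) (hGm.norm.const_mul _) (by norm_num)).trans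
        (add_le_add ?_ ?_))
      · refine (eLpNorm_le_mul_eLpNorm_of_ae_le_mul (c := 2) (g := fun x => fderiv ℝ v x - G x)
          (Eventually.of_forall fun x => ?_) 2).trans ?_
        · rw [norm_mul, norm_norm, Real.norm_of_nonneg zero_le_two]
          exact le_rfl
        · gcongr
      · rw [← hK]
        refine eLpNorm_le_mul_eLpNorm_of_ae_le_mul (c := 4 * δ) (g := G)
          (Eventually.of_forall fun x => ?_) 2
        rw [norm_mul, norm_norm, Real.norm_of_nonneg (by positivity)]
    refine (mul_le_mul_right h1 2).trans ?_
    rw [← ENNReal.ofReal_mul zero_le_two, ← ENNReal.ofReal_mul (by positivity),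
      ← ENNReal.ofReal_add (by positivity) (by positivity),
      show (2 : ℝ≥0∞) = ENNReal.ofReal 2 by simp, ← ENNReal.ofReal_mul zero_le_two]
    exact ENNReal.ofReal_le_ofReal hδε

end
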